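/- Let $n\ge 2$, let $(N^{n-1},g_0)$ be a Riemannian manifold, and let $M^n=\mathbb R\times N$ carry the warped product metric $dt^2+e^{2\rho(t)}g_0$, where $\rho:\mathbb R\to\mathbb R$ is smooth and $\rho'(t)\ge\kappa$ for all $t$, for some constant $\kappa>0$. Let $\widetilde M^m$ be a complete Riemannian manifold and let $\pi:\widetilde M\to M$ be a Riemannian submersion, that is, a smooth surjective map with surjective differentials that preserve the lengths of horizontal vectors. Let $H^{\mathcal F}=\sum_{i=1}^{m-n}(\widetilde\nabla_{e_i}e_i)^{\mathcal H}$ be the mean curvature vector of the fibers, where $\widetilde\nabla$ is the Levi-Civita connection of $\widetilde M$, $\{e_i\}$ is a local orthonormal frame of vector fields tangent to the fibers and $\mathcal H$ denotes the component orthogonal to the fibers. Suppose that $\|H^{\mathcal F}\|\le\alpha$ on $\widetilde M$ for a constant $\alpha<(n-1)\kappa$. Then, for every $1<p<\infty$, $$\lambda_{1,p}(\widetilde M)\ \ge\ \frac{\big((n-1)\kappa-\alpha\big)^p}{p^p}.$$ Here, for an open set $\Omega\subset\widetilde M$, $\lambda_{1,p}(\Omega)=\inf\big\{\int_\Omega\|\nabla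 u\|^p/\int_\Omega|u|^p:\ u\in W_0^{1,p}(\Omega),\ u\ne0\big\}$, where $W_0^{1,p}(\Omega)$ is the closure of $C_c^\infty(\Omega)$ in the $W^{1,p}$ norm, and $\lambda_{1,p}(\widetilde M)=\lim_{k\to\infty}\lambda_{1,p}(\Omega_k)$ for an exhaustion $\Omega_1\subset\Omega_2\subset\cdots$ of $\widetilde M$ by relatively compact open sets; the limit exists in $[0,\infty]$ and does not depend on the exhaustion. -/

import Mathlib

open Set Filter Topology MeasureTheory Manifold
open scoped ENNReal ContDiff

noncomputable section

namespace SubmersionTone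

instance tangentSpace_finiteDimensional {m : ℕ} {M : Type*} [TopologicalSpace M]
    [ChartedSpace (EuclideanSpace ℝ (Fin m)) M] (x : M) :
    FiniteDimensional ℝ (TangentSpace (𝓡 m) x) :=
  inferInstanceAs (FiniteDimensional ℝ (EuclideanSpace ℝ (Fin m)))

/-! ### Warped products -/

section Warped

variable {d : ℕ} {N : Type*} [TopologicalSpace N] [ChartedSpace (EuclideanSpace ℝ (Fin d)) N]
  [IsManifold (𝓡 d) ∞ N]

/-- The bilinear form `dt² + e^{2ρ(t)} g₀` on the tangent space of `ℝ × N` at `y = (t, x)`, which is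
(by definition) the product of `ℝ` and of the tangent space of `N` at `x`. -/
def warpedInner
    (g₀ : Bundle.ContMDiffRiemannianMetric (𝓡 d) ∞ (EuclideanSpace ℝ (Fin d))
      (fun x : N => TangentSpace (𝓡 d) x))
    (ρ : ℝ → ℝ) (y : ℝ × N) :
    (ℝ × EuclideanSpace ℝ (Fin d)) →L[ℝ] (ℝ × EuclideanSpace ℝ (Fin d)) →L[ℝ] ℝ :=
  let g : EuclideanSpace ℝ (Fin d) →L[ℝ] EuclideanSpace ℝ (Fin d) →L[ℝ] ℝ := g₀.inner y.2
  (ContinuousLinearMap.mul ℝ ℝ).bilinearComp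
      (ContinuousLinearMap.fst ℝ ℝ (EuclideanSpace ℝ (Fin d)))
      (ContinuousLinearMap.fst ℝ ℝ (EuclideanSpace ℝ (Fin d)))
    + Real.exp (2 * ρ y.1) • g.bilinearComp
      (ContinuousLinearMap.snd ℝ ℝ (EuclideanSpace ℝ (Fin d)))
      (ContinuousLinearMap.snd ℝ ℝ (EuclideanSpace ℝ (Fin d)))

theorem warpedInner_apply
    (g₀ : Bundle.ContMDiffRiemannianMetric (𝓡 d) ∞ (EuclideanSpace ℝ (Fin d))
      (fun x : N => TangentSpace (𝓡 d) x))
    (ρ : ℝ → ℝ) (y : ℝ × N) (v w : ℝ × EuclideanSpace ℝ (Fin d)) :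
    warpedInner g₀ ρ y v w = v.1 * w.1 + Real.exp (2 * ρ y.1) * g₀.inner y.2 v.2 w.2 :=
  rfl

theorem warpedInner_symm
    (g₀ : Bundle.ContMDiffRiemannianMetric (𝓡 d) ∞ (EuclideanSpace ℝ (Fin d))
      (fun x : N => TangentSpace (𝓡 d) x))
    (ρ : ℝ → ℝ) (y : ℝ × N) (v w : ℝ × EuclideanSpace ℝ (Fin d)) :
    warpedInner g₀ ρ y v w = warpedInner g₀ ρ y w v := by
  rw [warpedInner_apply, warpedInner_apply, mul_comm v.1, g₀.symm y.2 v.2 w.2]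

theorem warpedInner_pos
    (g₀ : Bundle.ContMDiffRiemannianMetric (𝓡 d) ∞ (EuclideanSpace ℝ (Fin d))
      (fun x : N => TangentSpace (𝓡 d) x))
    (ρ : ℝ → ℝ) (y : ℝ × N) (v : ℝ × EuclideanSpace ℝ (Fin d)) (hv : v ≠ 0) :
    0 < warpedInner g₀ ρ y v v := by
  rw [warpedInner_apply]
  have hexp := Real.exp_pos (2 * ρ y.1)
  by_cases h2 : v.2 = 0
  · have h1 : v.1 ≠ 0 := fun h1 => hv (Prod.ext h1 h2)
    have h0 : g₀.inner y.2 v.2 v.2 = 0 := by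
      rw [h2]
      exact (g₀.inner y.2 0).map_zero
    rw [h0]
    have := mul_self_pos.2 h1
    linarith
  · have := mul_pos hexp (g₀.pos y.2 v.2 h2)
    have := mul_self_nonneg v.1
    linarith

/-- A positive definite bilinear form on a finite-dimensional space has a bounded unit ball. -/
theorem isVonNBounded_of_pos {F : Type*} [NormedAddCommGroup F] [NormedSpace ℝ F]
    [FiniteDimensional ℝ F] (b : F →L[ℝ] F →L[ℝ] ℝ) (hb : ∀ v, v ≠ 0 → 0 < b v v) :
    Bornology.IsVonNBounded ℝ {v : F | b v v < 1} := by
  have hcont : Continuous fun v : F => b v v := by fun_prop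
  rw [NormedSpace.isVonNBounded_iff, isBounded_iff_forall_norm_le]
  rcases (Metric.sphere (0 : F) 1).eq_empty_or_nonempty with hE | hne
  · refine ⟨0, fun v _ => ?_⟩
    by_contra h
    have hv : v ≠ 0 := by
      rintro rfl
      simp at h
    have : (‖v‖⁻¹ • v) ∈ Metric.sphere (0 : F) 1 := by
      simp [norm_smul, hv]
    rw [hE] at this
    exact this
  · obtain ⟨u, hu, hmin⟩ := (isCompact_sphere (0 : F) 1).exists_isMinOn hne hcont.continuousOn
    have hu0 : u ≠ 0 := by
      rintro rfl
      simp at hu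
    have hc := hb u hu0
    refine ⟨Real.sqrt (1 / b u u), fun v hv => ?_⟩
    by_cases hv0 : v = 0
    · rw [hv0, norm_zero]
      positivity
    have hn : 0 < ‖v‖ := norm_pos_iff.2 hv0
    have hmem : (‖v‖⁻¹ • v) ∈ Metric.sphere (0 : F) 1 := by
      simp [norm_smul, hv0]
    have h1 : b u u ≤ b (‖v‖⁻¹ • v) (‖v‖⁻¹ • v) := hmin hmem
    simp only [map_smul, smul_apply, smul_eq_mul] at h1
    have h2 : b v v < 1 := hv
    apply Real.le_sqrt_of_sq_le
    rw [le_div_iff₀ hc]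
    have h3 : ‖v‖ ^ 2 * b u u ≤ ‖v‖ ^ 2 * (‖v‖⁻¹ * (‖v‖⁻¹ * b v v)) := by gcongr
    have h4 : ‖v‖ ^ 2 * (‖v‖⁻¹ * (‖v‖⁻¹ * b v v)) = b v v := by field_simp
    linarith

/-- The warped product metric `dt² + e^{2ρ(t)} g₀` on `ℝ × N`. -/
def warpedMetric
    (g₀ : Bundle.ContMDiffRiemannianMetric (𝓡 d) ∞ (EuclideanSpace ℝ (Fin d))
      (fun x : N => TangentSpace (𝓡 d) x))
    (ρ : ℝ → ℝ) :
    Bundle.RiemannianMetric (fun y : ℝ × N => TangentSpace (𝓘(ℝ, ℝ).prod (𝓡 d)) y) where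
  inner y := warpedInner g₀ ρ y
  symm y v w := warpedInner_symm g₀ ρ y v w
  pos y v hv := warpedInner_pos g₀ ρ y v hv
  continuousAt y := by
    have : Continuous fun v : ℝ × EuclideanSpace ℝ (Fin d) => warpedInner g₀ ρ y v v := by
      fun_prop
    exact this.continuousAt
  isVonNBounded y := isVonNBounded_of_pos (warpedInner g₀ ρ y) (warpedInner_pos g₀ ρ y)

end Warped

/-! ### Linear algebra -/

section LinearAlgebra

variable {F : Type*} [NormedAddCommGroup F] [InnerProductSpace ℝ F] [FiniteDimensional ℝ F]

/-- The vector dual to a linear form. -/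
def rieszVector (l : F →L[ℝ] ℝ) : F :=
  haveI : CompleteSpace F := FiniteDimensional.complete ℝ F
  (InnerProductSpace.toDual ℝ F).symm l

/-- The vector whose inner product with each vector `e` of an orthonormal basis is `l e`; if `l` is
linear, this is the vector dual to `l`. -/
def vectorOfInner (l : F → ℝ) : F :=
  ∑ i, l (stdOrthonormalBasis ℝ F i) • stdOrthonormalBasis ℝ F i

/-- The orthogonal projection onto a subspace. -/
def orthProj (K : Submodule ℝ F) (v : F) : F :=
  K.starProjection v

/-- The trace over the subspace `K` of a bilinear map: the sum of `b e e` over an orthonormal basis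
of `K`. -/
def traceOn (K : Submodule ℝ F) (b : F → F → F) : F :=
  ∑ i, b (stdOrthonormalBasis ℝ K i) (stdOrthonormalBasis ℝ K i)

end LinearAlgebra

end SubmersionTone

end

open Bundle

noncomputable section

namespace SubmersionTone

/-! ### Riemannian geometry of the total space -/

section Riemannian

variable {m : ℕ} {M : Type*} [TopologicalSpace M] [ChartedSpace (EuclideanSpace ℝ (Fin m)) M]
  [IsManifold (𝓡 m) ∞ M] [RiemannianBundle (fun x : M => TangentSpace (𝓡 m) x)]

/-- The gradient of a function: the tangent vector dual to its differential. -/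
def gradient (f : M → ℝ) (x : M) : TangentSpace (𝓡 m) x :=
  rieszVector (mfderiv (𝓡 m) 𝓘(ℝ, ℝ) f x)

/-- The right-hand side of the Koszul formula, that is `⟨∇_X Y, Z⟩` at `x`. -/
def koszul (X Y Z : Π y : M, TangentSpace (𝓡 m) y) (x : M) : ℝ :=
  let D : (Π y : M, TangentSpace (𝓡 m) y) → (Π y : M, TangentSpace (𝓡 m) y) →
      (Π y : M, TangentSpace (𝓡 m) y) → ℝ := fun A B C =>
    mfderiv (𝓡 m) 𝓘(ℝ, ℝ) (fun y => inner ℝ (B y) (C y)) x (A x)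
  (D X Y Z + D Y Z X - D Z X Y
    + inner ℝ (VectorField.mlieBracket (𝓡 m) X Y x) (Z x)
    - inner ℝ (VectorField.mlieBracket (𝓡 m) Y Z x) (X x)
    + inner ℝ (VectorField.mlieBracket (𝓡 m) Z X x) (Y x)) / 2

/-- The Levi-Civita derivative `∇_v Y` at `x` of a vector field `Y` (differentiable at `x`) in the
direction `v`: its components in an orthonormal basis of the tangent space at `x` are given by the
Koszul formula, which is tensorial in the first and third fields. -/
def leviCivita (x : M) (v : TangentSpace (𝓡 m) x) (Y : Π y : M, TangentSpace (𝓡 m) y) :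
    TangentSpace (𝓡 m) x :=
  vectorOfInner fun z : TangentSpace (𝓡 m) x =>
    koszul (FiberBundle.extend (EuclideanSpace ℝ (Fin m)) v) Y
      (FiberBundle.extend (EuclideanSpace ℝ (Fin m)) z) x

section Submersion

variable {E' : Type*} [NormedAddCommGroup E'] [NormedSpace ℝ E'] {H' : Type*} [TopologicalSpace H']
  {J : ModelWithCorners ℝ E' H'} {B : Type*} [TopologicalSpace B] [ChartedSpace H' B]

variable (J) in
/-- The vertical subspace at `x`: the kernel of the differential of `proj`. -/
def vertical (proj : M → B) (x : M) : Submodule ℝ (TangentSpace (𝓡 m) x) :=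
  LinearMap.ker (mfderiv (𝓡 m) J proj x).toLinearMap

/-- `proj` is a Riemannian submersion onto `B`, where `B` carries the Riemannian metric `g`: a smooth
surjective map with surjective differentials that preserve the lengths of horizontal vectors. -/
structure IsRiemannianSubmersion (g : RiemannianMetric (fun y : B => TangentSpace J y))
    (proj : M → B) : Prop where
  contMDiff : ContMDiff (𝓡 m) J ∞ proj
  surjective : Function.Surjective proj
  mfderiv_surjective : ∀ x : M, Function.Surjective (mfderiv (𝓡 m) J proj x)
  length_horizontal : ∀ x : M, ∀ v ∈ (vertical J proj x)ᗮ,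
    g.inner (proj x) (mfderiv (𝓡 m) J proj x v) (mfderiv (𝓡 m) J proj x v) = ‖v‖ ^ 2

variable (J) in
/-- The vertical part of a tangent vector at `x`. -/
def verticalPart (proj : M → B) (x : M) (v : TangentSpace (𝓡 m) x) : TangentSpace (𝓡 m) x :=
  orthProj (vertical J proj x) v

variable (J) in
/-- The second fundamental form `(∇_v W)^H` of the fibers at `x`, on vertical vectors `v, w` at `x`,
where `W` is a vertical vector field with `W x = w` and `^H` takes the horizontal part. As
`(∇_v W)^H` does not depend on the choice of `W`, we take for `W` the vertical part of a smooth
local extension of `w`. -/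
def secondFundamentalForm (proj : M → B) (x : M) (v w : TangentSpace (𝓡 m) x) :
    TangentSpace (𝓡 m) x :=
  let D : TangentSpace (𝓡 m) x := leviCivita x v fun y =>
    verticalPart J proj y (FiberBundle.extend (EuclideanSpace ℝ (Fin m)) w y)
  D - verticalPart J proj x D

variable (J) in
/-- The mean curvature vector at `x` of the fiber through `x`: the (non-normalized) trace of the
second fundamental form of the fiber. -/
def meanCurvature (proj : M → B) (x : M) : TangentSpace (𝓡 m) x :=
  traceOn (vertical J proj x) fun v w => secondFundamentalForm J proj x v w

end Submersion

/-! ### Volume, Sobolev functions and the fundamental tone -/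

/-- The Gram matrix `(g_ij)` at the point of coordinates `z` in the chart at `x`. -/
def gramMatrix (x : M) (z : EuclideanSpace ℝ (Fin m)) : Matrix (Fin m) (Fin m) ℝ :=
  Matrix.of fun i j => inner ℝ
    (mfderiv 𝓘(ℝ, EuclideanSpace ℝ (Fin m)) (𝓡 m) (extChartAt (𝓡 m) x).symm z
      (EuclideanSpace.single i (1 : ℝ)))
    (mfderiv 𝓘(ℝ, EuclideanSpace ℝ (Fin m)) (𝓡 m) (extChartAt (𝓡 m) x).symm z
      (EuclideanSpace.single j (1 : ℝ)))

variable [MeasurableSpace M]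

/-- The Riemannian volume of the domain of the chart at `x`, that is `√det(g_ij) dz` in this
chart, as a measure on `M`. -/
def chartVolume (x : M) : Measure M :=
  Measure.map (extChartAt (𝓡 m) x).symm
    ((volume.restrict (extChartAt (𝓡 m) x).target).withDensity
      fun z => ENNReal.ofReal (Real.sqrt (gramMatrix x z).det))

variable (m M) in
/-- The Riemannian volume measure. The chart volumes agree on overlaps, so that their supremum in
the lattice of measures is the measure restricting to each of them. -/
def riemannianVolume : Measure M :=
  ⨆ x : M, chartVolume (m := m) x

/-- `u ∈ W₀^{1,p}(Ω)` with weak gradient `V`: the pair `(u, V)` is the limit in `L^p(Ω)` of pairs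
`(φ_k, ∇φ_k)` with `φ_k` smooth and compactly supported in `Ω`. -/
structure MemSobolevZero (p : ℝ) (Ω : Set M) (u : M → ℝ) (V : Π x : M, TangentSpace (𝓡 m) x) :
    Prop where
  aestronglyMeasurable : AEStronglyMeasurable u ((riemannianVolume m M).restrict Ω)
  aestronglyMeasurable_gradient :
    AEStronglyMeasurable (fun x => (⟨x, V x⟩ : TangentBundle (𝓡 m) M))
      ((riemannianVolume m M).restrict Ω)
  exists_approx : ∃ φ : ℕ → M → ℝ,
    (∀ k, ContMDiff (𝓡 m) 𝓘(ℝ, ℝ) ∞ (φ k) ∧ HasCompactSupport (φ k) ∧ tsupport (φ k) ⊆ Ω) ∧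
    Tendsto (fun k => ∫⁻ x in Ω, ‖u x - φ k x‖ₑ ^ p ∂(riemannianVolume m M)) atTop (𝓝 0) ∧
    Tendsto (fun k => ∫⁻ x in Ω, ‖V x - gradient (φ k) x‖ₑ ^ p ∂(riemannianVolume m M))
      atTop (𝓝 0)

variable (m) in
/-- The first Dirichlet eigenvalue `λ_{1,p}(Ω)` of the `p`-Laplacian: the infimum of
`∫_Ω ‖∇u‖^p / ∫_Ω |u|^p` over the nonzero `u ∈ W₀^{1,p}(Ω)`. -/
def firstEigenvalue (p : ℝ) (Ω : Set M) : ℝ≥0∞ :=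
  ⨅ (u : M → ℝ) (V : Π x : M, TangentSpace (𝓡 m) x) (_ : MemSobolevZero p Ω u V)
    (_ : ¬ u =ᵐ[(riemannianVolume m M).restrict Ω] 0),
    (∫⁻ x in Ω, ‖V x‖ₑ ^ p ∂(riemannianVolume m M)) /
      (∫⁻ x in Ω, ‖u x‖ₑ ^ p ∂(riemannianVolume m M))

/-- An exhaustion of `M` by an increasing sequence of relatively compact open sets. -/
structure IsExhaustion {M : Type*} [TopologicalSpace M] (Ω : ℕ → Set M) : Prop where
  isOpen : ∀ k, IsOpen (Ω k)
  isCompact_closure : ∀ k, IsCompact (closure (Ω k))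
  monotone : Monotone Ω
  iUnion_eq : ⋃ k, Ω k = univ

variable (m M) in
/-- `L` is the fundamental tone `λ_{1,p}(M)`: the limit of `λ_{1,p}(Ω_k)` along the exhaustions
`(Ω_k)` of `M` (there is at least one, and the limit is the same for all of them). -/
def IsFundamentalTone (p : ℝ) (L : ℝ≥0∞) : Prop :=
  (∃ Ω : ℕ → Set M, IsExhaustion Ω) ∧
    ∀ Ω : ℕ → Set M, IsExhaustion Ω →
      Tendsto (fun k => firstEigenvalue m p (Ω k)) atTop (𝓝 L)

end Riemannian

end SubmersionTone

end

noncomputable section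

namespace SubmersionTone

set_option synthInstance.maxHeartbeats 200000

/-! ### Calculus in coordinates -/

section Determinant

variable {ι : Type*} [Fintype ι] [DecidableEq ι]

/-! Let f be the first coordinate t ∘ π of the submersion. Its gradient is the horizontal lift of
∂_t, hence a unit field, and everything follows from the bound div ∇f ≥ c, where c = (n-1)κ - α > 0.

The divergence is the trace of half the Lie derivative of the metric along ∇f, taken over an
orthonormal basis adapted to the vertical and horizontal spaces (`sub_le_trace`, `le_divergence`).
On a vertical v, half the Lie derivative is ⟨∇_v ∇f, v⟩ = -⟨∇_v W, ∇f⟩ for any vertical field W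
extending v, since W stays orthogonal to ∇f. These terms add up to -⟨H, ∇f⟩ ≥ -α
(`tangentInner_secondFundamentalForm`). On horizontal vectors it is the Lie derivative of dt² +
e^{2ρ}g₀ along ∂_t: each of the n-1 directions orthogonal to ∇f contributes ρ' ≥ κ, and ∇f itself
contributes 0 (`lieDerivForm_horizontal`).

Given the bound, integrate div ∇f against |φ|^p for φ smooth with compact support: c ∫|φ|^p ≤ p
∫|φ|^{p-1}‖∇φ‖. Young's inequality with weight c/p absorbs the power of φ and leaves (c/p)^p ∫|φ|^p
≤ ∫‖∇φ‖^p (`integral_abs_rpow_le`). The inequality survives L^p limits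
(`mul_lintegral_rpow_le_of_tendsto`), so it bounds λ_{1,p}(Ω) for every Ω. Domain monotonicity
(`firstEigenvalue_anti`) shows that the limit along an exhaustion exists, is an infimum and is the
same for all exhaustions.

The geometry is done in charts. There the divergence of X is tr(DX + ½ G⁻¹ D_X G), where the second
term is the logarithmic derivative of the density √det G by Jacobi's formula. The divergence theorem
thus reduces to a compactly supported Euclidean field, and a partition of unity globalizes it. -/

theorem hasDerivAt_det_one_add_smul (B : Matrix ι ι ℝ) :
    HasDerivAt (fun s : ℝ => (1 + s • B).det) B.trace 0 := by
  -- The determinant is a polynomial in s, and its formal derivative at 0 is the trace.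
  have h : ∀ s : ℝ, (1 + s • B).det =
      (Matrix.det (1 + (Polynomial.X : Polynomial ℝ) • B.map Polynomial.C)).eval s := by
    intro s
    rw [← Polynomial.coe_evalRingHom, RingHom.map_det]
    congr 1
    ext i j
    by_cases hij : i = j <;> simp [hij, mul_comm s]
  simp only [h]
  have := (Matrix.det (1 + (Polynomial.X : Polynomial ℝ) • B.map Polynomial.C)).hasDerivAt 0
  rwa [Matrix.derivative_det_one_add_X_smul] at this

theorem contDiff_det {k : WithTop ℕ∞} :
    ContDiff ℝ k (fun A : ι → ι → ℝ => (Matrix.of A).det) := by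
  simp only [Matrix.det_apply]
  refine ContDiff.sum fun σ _ => ContDiff.const_smul _ (contDiff_prod fun i _ => ?_)
  simp only [Matrix.of_apply]
  fun_prop

/-- Jacobi's formula. -/
theorem fderiv_det_mul (A B : Matrix ι ι ℝ) :
    fderiv ℝ (fun A : ι → ι → ℝ => (Matrix.of A).det) A (B * A : Matrix ι ι ℝ) =
      A.det * B.trace := by
  have hd : DifferentiableAt ℝ (fun A : ι → ι → ℝ => (Matrix.of A).det) A :=
    (contDiff_det (k := 1)).differentiable one_ne_zero A
  have h1 : HasLineDerivAt ℝ (fun A : ι → ι → ℝ => (Matrix.of A).det) _ A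
    (B * A : Matrix ι ι ℝ) := hd.hasFDerivAt.hasLineDerivAt _
  have h2 := (hasDerivAt_det_one_add_smul B).mul_const A.det
  -- Since A + sBA = (1 + sB)A, differentiating along BA needs neither the inverse of A nor its
  -- cofactors.
  have h3 : (fun s : ℝ => (1 + s • B).det * A.det) =
      fun s : ℝ => (Matrix.of ((A : ι → ι → ℝ) + s • (B * A : Matrix ι ι ℝ))).det := by
    ext s
    rw [← Matrix.det_mul, add_mul, one_mul, smul_mul_assoc]
    rfl
  rw [h3] at h2
  rw [h1.unique h2, mul_comm]

end Determinant

/-! ### The Riemannian density and the divergence theorem in one chart. -/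

section Density

variable {m : ℕ}

local notation "𝔼" => EuclideanSpace ℝ (Fin m)

/-- The Riemannian density `√det(g_ij)` of a field of bilinear forms. -/
def density (G : 𝔼 → 𝔼 →L[ℝ] 𝔼 →L[ℝ] ℝ) (z : 𝔼) : ℝ :=
  Real.sqrt (Matrix.of fun i j : Fin m =>
    G z (EuclideanSpace.single i (1 : ℝ)) (EuclideanSpace.single j (1 : ℝ))).det

theorem bilin_eq_sum (b : 𝔼 →L[ℝ] 𝔼 →L[ℝ] ℝ) (v w : 𝔼) :
    b v w = ∑ i, ∑ j, v i * w j *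
      b (EuclideanSpace.single i (1 : ℝ)) (EuclideanSpace.single j (1 : ℝ)) := by
  have h : ∀ x : 𝔼, x = ∑ i, x i • EuclideanSpace.single i (1 : ℝ) := fun x => by
    ext j
    simp [Pi.single_apply]
  conv_lhs => rw [h v, h w]
  simp only [map_sum, map_smul, sum_apply, smul_apply, smul_eq_mul, Finset.mul_sum, mul_assoc]
  rw [Finset.sum_comm]
  exact Finset.sum_congr rfl fun i _ => Finset.sum_congr rfl fun j _ => by ring

theorem trace_eq_sum_apply (T : 𝔼 →ₗ[ℝ] 𝔼) :
    LinearMap.trace ℝ 𝔼 T = ∑ i, T (EuclideanSpace.single i (1 : ℝ)) i := by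
  rw [LinearMap.trace_eq_sum_inner T (EuclideanSpace.basisFun (Fin m) ℝ)]
  simp [EuclideanSpace.inner_single_left]

theorem matrix_posDef {b : 𝔼 →L[ℝ] 𝔼 →L[ℝ] ℝ} (hs : ∀ v w, b v w = b w v)
    (hp : ∀ v, v ≠ 0 → 0 < b v v) :
    (Matrix.of fun i j : Fin m =>
      b (EuclideanSpace.single i (1 : ℝ)) (EuclideanSpace.single j (1 : ℝ))).PosDef := by
  refine Matrix.PosDef.of_dotProduct_mulVec_pos (Matrix.IsHermitian.ext fun i j => ?_)
    fun x hx => ?_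
  · simp [hs]
  · have h : x ⬝ᵥ ((Matrix.of fun i j : Fin m =>
      b (EuclideanSpace.single i (1 : ℝ)) (EuclideanSpace.single j (1 : ℝ))).mulVec x) =
      b (WithLp.toLp 2 x) (WithLp.toLp 2 x) := by
      rw [bilin_eq_sum]
      simp only [dotProduct, Matrix.mulVec, Finset.mul_sum, Matrix.of_apply]
      exact Finset.sum_congr rfl fun i _ => Finset.sum_congr rfl fun j _ => by ring
    simp only [star_trivial]
    rw [h]
    refine hp _ fun h0 => hx ?_
    ext i
    simpa using congrArg (fun v : 𝔼 => v i) h0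

theorem contDiffAt_det_gram {G : 𝔼 → 𝔼 →L[ℝ] 𝔼 →L[ℝ] ℝ} {z : 𝔼} {k : WithTop ℕ∞}
    (hG : ContDiffAt ℝ k G z) :
    ContDiffAt ℝ k (fun z => (Matrix.of fun i j : Fin m =>
      G z (EuclideanSpace.single i (1 : ℝ)) (EuclideanSpace.single j (1 : ℝ))).det) z := by
  refine (contDiff_det (k := k)).contDiffAt.comp z ?_
  refine contDiffAt_pi.2 fun i => contDiffAt_pi.2 fun j => ?_
  exact (hG.clm_apply contDiffAt_const).clm_apply contDiffAt_const

theorem contDiffAt_density {G : 𝔼 → 𝔼 →L[ℝ] 𝔼 →L[ℝ] ℝ} {z : 𝔼} {k : WithTop ℕ∞}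
    (hG : ContDiffAt ℝ k G z) (hs : ∀ v w, G z v w = G z w v)
    (hp : ∀ v, v ≠ 0 → 0 < G z v v) : ContDiffAt ℝ k (density G) z :=
  (contDiffAt_det_gram hG).sqrt (matrix_posDef hs hp).det_pos.ne'

/-- The derivative of the Riemannian density. -/
theorem fderiv_density {G : 𝔼 → 𝔼 →L[ℝ] 𝔼 →L[ℝ] ℝ} {z : 𝔼} (hG : ContDiffAt ℝ 1 G z)
    (hs : ∀ v w, G z v w = G z w v) (hp : ∀ v, v ≠ 0 → 0 < G z v v) (u : 𝔼) (T : 𝔼 →L[ℝ] 𝔼)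
    (hT : ∀ v w, G z (T v) w = fderiv ℝ G z u v w / 2) :
    fderiv ℝ (density G) z u = density G z * LinearMap.trace ℝ 𝔼 T.toLinearMap := by
  set gm : 𝔼 → Fin m → Fin m → ℝ := fun z i j =>
    G z (EuclideanSpace.single i (1 : ℝ)) (EuclideanSpace.single j (1 : ℝ)) with hgm
  set gm' : Fin m → Fin m → ℝ := fun i j =>
    fderiv ℝ G z u (EuclideanSpace.single i (1 : ℝ)) (EuclideanSpace.single j (1 : ℝ)) with hgm'
  have hdet := (matrix_posDef hs hp).det_pos
  have hG1 : HasDerivAt (fun s : ℝ => G (z + s • u)) (fderiv ℝ G z u) 0 :=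
    (hG.differentiableAt one_ne_zero).hasFDerivAt.hasLineDerivAt u
  have h1 : HasDerivAt (fun s : ℝ => gm (z + s • u)) gm' 0 := by
    refine hasDerivAt_pi.2 fun i => hasDerivAt_pi.2 fun j => ?_
    have := (hG1.clm_apply (hasDerivAt_const (0 : ℝ) (EuclideanSpace.single i (1 : ℝ)))).clm_apply
      (hasDerivAt_const (0 : ℝ) (EuclideanSpace.single j (1 : ℝ)))
    simpa using this
  -- `hT` says that the Gram matrix has derivative B · Gram along u. The factor 2 in B is cancelled
  -- later by the derivative of the square root.
  set B : Matrix (Fin m) (Fin m) ℝ :=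
    Matrix.of fun i k => 2 * T (EuclideanSpace.single i (1 : ℝ)) k with hB
  have h2 : gm' = (B * Matrix.of (gm z) : Matrix (Fin m) (Fin m) ℝ) := by
    ext i j
    rw [Matrix.mul_apply]
    have h3 := hT (EuclideanSpace.single i (1 : ℝ)) (EuclideanSpace.single j (1 : ℝ))
    rw [bilin_eq_sum] at h3
    simp only [hgm', hB, hgm, Matrix.of_apply]
    have h4 : ∀ k : Fin m, ∑ l : Fin m, T (EuclideanSpace.single i (1 : ℝ)) k *
        (EuclideanSpace.single j (1 : ℝ) : 𝔼) l *
        G z (EuclideanSpace.single k (1 : ℝ)) (EuclideanSpace.single l (1 : ℝ)) =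
        T (EuclideanSpace.single i (1 : ℝ)) k *
          G z (EuclideanSpace.single k (1 : ℝ)) (EuclideanSpace.single j (1 : ℝ)) := fun k => by
      rw [Finset.sum_eq_single j] <;> simp +contextual
    simp only [h4] at h3
    simp only [mul_assoc, ← Finset.mul_sum, h3]
    ring
  have h5 : HasFDerivAt (fun A : Fin m → Fin m → ℝ => (Matrix.of A).det) _
      (gm (z + (0 : ℝ) • u)) :=
    ((contDiff_det (k := 1)).differentiable one_ne_zero _).hasFDerivAt
  have h6 := h5.comp_hasDerivAt (0 : ℝ) h1
  have e0 : z + (0 : ℝ) • u = z := by simp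
  rw [e0, h2] at h6
  have h7 := fderiv_det_mul (Matrix.of (gm z)) B
  erw [h7] at h6
  have h8 := h6.sqrt (by simpa only [Function.comp_apply, e0] using hdet.ne')
  have h9 : HasDerivAt (fun s : ℝ => density G (z + s • u)) (fderiv ℝ (density G) z u) 0 :=
    ((contDiffAt_density hG hs hp).differentiableAt one_ne_zero).hasFDerivAt.hasLineDerivAt u
  rw [h9.unique h8]
  have htr : B.trace = 2 * LinearMap.trace ℝ 𝔼 T.toLinearMap := by
    rw [trace_eq_sum_apply, Finset.mul_sum]
    rfl
  simp only [Function.comp_apply, e0]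
  rw [htr]
  have h10 : (Matrix.of (gm z)).det = density G z ^ 2 := (Real.sq_sqrt hdet.le).symm
  have h11 : Real.sqrt (Matrix.of (gm z)).det = density G z := rfl
  have h12 : density G z ≠ 0 := (Real.sqrt_pos.2 hdet).ne'
  rw [h11, h10]
  field_simp

/-- The integral of the divergence of a compactly supported vector field vanishes. -/
theorem integral_trace_fderiv_eq_zero {Y : 𝔼 → 𝔼} (hY : ContDiff ℝ 1 Y)
    (hc : HasCompactSupport Y) :
    ∫ z, LinearMap.trace ℝ 𝔼 (fderiv ℝ Y z).toLinearMap = 0 := by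
  simp only [trace_eq_sum_apply]
  have hint : ∀ i : Fin m, Integrable (fun z =>
      (fderiv ℝ Y z).toLinearMap (EuclideanSpace.single i (1 : ℝ)) i) := fun i => by
    have hcont : Continuous fun z => fderiv ℝ Y z (EuclideanSpace.single i (1 : ℝ)) i := by
      have := hY.continuous_fderiv one_ne_zero
      fun_prop
    refine hcont.integrable_of_hasCompactSupport ?_
    refine (hc.fderiv (𝕜 := ℝ)).mono fun z hz hz0 => hz ?_
    simp only [hz0]
    rfl
  rw [integral_finsetSum _ fun i _ => hint i]
  refine Finset.sum_eq_zero fun i _ => ?_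
  have hYi : ContDiff ℝ 1 fun z => Y z i := by fun_prop
  have hci : HasCompactSupport fun z => Y z i := hc.mono fun z hz hz0 => hz (by
    simp only [hz0]
    rfl)
  obtain ⟨C, hC⟩ := hYi.lipschitzWith_of_hasCompactSupport hci one_ne_zero
  -- Integration by parts against the constant 1. The formula reverses the direction on the second
  -- factor, whence the sign of the basis vector.
  have h := LipschitzWith.integral_lineDeriv_mul_eq (μ := (volume : Measure 𝔼))
    (LipschitzWith.const (1 : ℝ) : LipschitzWith 0 fun _ : 𝔼 => (1 : ℝ)) hC hci
    (-EuclideanSpace.single i (1 : ℝ))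
  have h0 : ∀ z v : 𝔼, lineDeriv ℝ (fun _ : 𝔼 => (1 : ℝ)) z v = 0 := fun z v => by
    simp [lineDeriv]
  simp only [h0, zero_mul, integral_zero, neg_neg, mul_one] at h
  rw [h]
  refine integral_congr_ae (Eventually.of_forall fun z => ?_)
  have h1 : HasFDerivAt Y (fderiv ℝ Y z) z := (hY.differentiable one_ne_zero z).hasFDerivAt
  have h2 : HasFDerivAt (fun z => Y z i)
      ((EuclideanSpace.proj i : 𝔼 →L[ℝ] ℝ).comp (fderiv ℝ Y z)) z :=
    (EuclideanSpace.proj i : 𝔼 →L[ℝ] ℝ).hasFDerivAt.comp z h1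
  exact (h2.hasLineDerivAt _).lineDeriv.symm

/-- Coordinate expressions are controlled only on the open target of a chart and may blow up at its
boundary; vanishing off a compact subset restores integrability. -/
theorem integrableOn_of_continuousOn_of_eq_zero {F : Type*} [TopologicalSpace F] [MeasurableSpace F]
    [T2Space F] [OpensMeasurableSpace F] {μ : Measure F} [IsFiniteMeasureOnCompacts μ]
    {U K : Set F} {g : F → ℝ} (hU : IsOpen U) (hK : IsCompact K) (hKU : K ⊆ U)
    (hg : ContinuousOn g U)
    (h0 : ∀ z ∈ U \ K, g z = 0) : IntegrableOn g U μ :=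
  ((hg.mono hKU).integrableOn_compact hK).of_forall_sdiff_eq_zero hU.measurableSet h0

/-- The integrated form of a lower bound of the divergence `tr (DX + T)` of a vector field. -/
theorem integral_fderiv_le_of_le_divergence {G : 𝔼 → 𝔼 →L[ℝ] 𝔼 →L[ℝ] ℝ} {X : 𝔼 → 𝔼}
    {T : 𝔼 → 𝔼 →L[ℝ] 𝔼} {U K : Set 𝔼} {η : 𝔼 → ℝ} {c : ℝ} (hU : IsOpen U) (hK : IsCompact K)
    (hKU : K ⊆ U) (hG : ContDiffOn ℝ 1 G U) (hs : ∀ z ∈ U, ∀ v w, G z v w = G z w v)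
    (hp : ∀ z ∈ U, ∀ v, v ≠ 0 → 0 < G z v v) (hX : ContDiffOn ℝ 1 X U)
    (hT : ∀ z ∈ U, ∀ v w, G z (T z v) w = fderiv ℝ G z (X z) v w / 2)
    (hc : ∀ z ∈ U, c ≤ LinearMap.trace ℝ 𝔼 (fderiv ℝ X z + T z).toLinearMap)
    (hη : ContDiffOn ℝ 1 η U) (hη0 : ∀ z ∈ U, 0 ≤ η z) (hηK : ∀ z ∈ U \ K, η z = 0) :
    c * ∫ z in U, η z * density G z ≤ -∫ z in U, fderiv ℝ η z (X z) * density G z := by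
  set J := density G with hJ
  have hJU : ContDiffOn ℝ 1 J U := fun z hz =>
    (contDiffAt_density (hG.contDiffAt (hU.mem_nhds hz)) (hs z hz) (hp z hz)).contDiffWithinAt
  -- X and the density are regular only on U, but the factor η vanishes off K, so extension by zero
  -- gives a C¹ field with compact support on the whole space.
  set Y : 𝔼 → 𝔼 := U.indicator fun z => (η z * J z) • X z with hY
  have hKc : ∀ z, z ∉ K → ∀ᶠ y in 𝓝 z, y ∈ U → η y = 0 := fun z hz => by
    filter_upwards [hK.isClosed.isOpen_compl.mem_nhds hz] with y hy hyU
    exact hηK y ⟨hyU, hy⟩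
  have hYK : ∀ z, z ∉ K → Y =ᶠ[𝓝 z] 0 := fun z hz => by
    filter_upwards [hKc z hz] with y hy
    by_cases hyU : y ∈ U
    · simp [hY, hyU, hy hyU]
    · simp [hY, hyU]
  have hYU : ∀ z ∈ U, Y =ᶠ[𝓝 z] fun z => (η z * J z) • X z := fun z hz => by
    filter_upwards [hU.mem_nhds hz] with y hy
    simp [hY, hy]
  have hYC : ContDiff ℝ 1 Y := contDiff_iff_contDiffAt.2 fun z => by
    by_cases hz : z ∈ K
    · have hzU := hU.mem_nhds (hKU hz)
      exact (((hη.contDiffAt hzU).mul (hJU.contDiffAt hzU)).smul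
        (hX.contDiffAt hzU)).congr_of_eventuallyEq (hYU z (hKU hz))
    · exact contDiffAt_const.congr_of_eventuallyEq (hYK z hz)
  have hYc : HasCompactSupport Y := HasCompactSupport.intro hK fun z hz => (hYK z hz).self_of_nhds
  have hDη : ∀ z ∈ U \ K, fderiv ℝ η z = 0 := fun z hz => by
    have : η =ᶠ[𝓝 z] fun _ => 0 := by
      filter_upwards [hKc z hz.2, hU.mem_nhds hz.1] with y hy hyU using hy hyU
    rw [this.fderiv_eq]
    simp
  have hdiv : ∀ z ∈ U, LinearMap.trace ℝ 𝔼 (fderiv ℝ Y z).toLinearMap =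
      fderiv ℝ η z (X z) * J z +
        η z * J z * LinearMap.trace ℝ 𝔼 (fderiv ℝ X z + T z).toLinearMap := fun z hz => by
    have hzU := hU.mem_nhds hz
    have h1 := ((hη.contDiffAt hzU).differentiableAt one_ne_zero).hasFDerivAt
    have h2 := ((hJU.contDiffAt hzU).differentiableAt one_ne_zero).hasFDerivAt
    have h3 := ((hX.contDiffAt hzU).differentiableAt one_ne_zero).hasFDerivAt
    have h4 : HasFDerivAt (fun z => (η z * J z) • X z) _ z := (h1.mul h2).smul h3
    rw [(hYU z hz).fderiv_eq, h4.fderiv]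
    -- The derivative of the density along X supplies the trace of T; the product rule gives the
    -- other two terms.
    have h5 := fderiv_density (hG.contDiffAt hzU) (hs z hz) (hp z hz) (X z) (T z) (hT z hz)
    have h6 : ∀ l : 𝔼 →L[ℝ] ℝ, LinearMap.trace ℝ 𝔼 (l.smulRight (X z)).toLinearMap = l (X z) :=
      fun l => LinearMap.trace_smulRight _ _
    simp only [ContinuousLinearMap.toLinearMap_add, ContinuousLinearMap.toLinearMap_smul, map_add,
      map_smul, h6, smul_eq_mul]
    simp only [add_apply, smul_apply, smul_eq_mul, Pi.mul_apply, ← hJ] at h5 ⊢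
    rw [h5]
    ring
  have hdiv0 : ∀ z, z ∉ U → LinearMap.trace ℝ 𝔼 (fderiv ℝ Y z).toLinearMap = 0 := fun z hz => by
    rw [(hYK z fun h => hz (hKU h)).fderiv_eq]
    simp
  have hint := integral_trace_fderiv_eq_zero hYC hYc
  rw [← setIntegral_eq_integral_of_forall_compl_eq_zero hdiv0,
    setIntegral_congr_fun hU.measurableSet hdiv] at hint
  have i1 : IntegrableOn (fun z => fderiv ℝ η z (X z) * J z) U :=
    integrableOn_of_continuousOn_of_eq_zero hU hK hKU
      (((hη.continuousOn_fderiv_of_isOpen hU le_rfl).clm_apply hX.continuousOn).mul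
        hJU.continuousOn)
      fun z hz => by simp [hDη z hz]
  have i2 : IntegrableOn (fun z => η z * J z) U :=
    integrableOn_of_continuousOn_of_eq_zero hU hK hKU (hη.continuousOn.mul hJU.continuousOn)
      fun z hz => by simp [hηK z hz]
  have i4 : IntegrableOn (fun z => LinearMap.trace ℝ 𝔼 (fderiv ℝ Y z).toLinearMap) U := by
    have : Continuous fun z => LinearMap.trace ℝ 𝔼 (fderiv ℝ Y z).toLinearMap := by
      simp only [trace_eq_sum_apply]
      have := hYC.continuous_fderiv one_ne_zero
      simp only [ContinuousLinearMap.coe_coe]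
      fun_prop
    refine (this.integrable_of_hasCompactSupport ?_).integrableOn
    refine (hYc.fderiv (𝕜 := ℝ)).mono fun z hz hz0 => hz ?_
    simp [hz0]
  -- No continuity of T is assumed, so this term is integrable as the difference of the two others
  -- in `hdiv`.
  have i3 : IntegrableOn (fun z => η z * J z *
      LinearMap.trace ℝ 𝔼 (fderiv ℝ X z + T z).toLinearMap) U := by
    refine (i4.sub i1).congr_fun (fun z hz => ?_) hU.measurableSet
    simp only [Pi.sub_apply, hdiv z hz]
    ring
  rw [integral_add i1 i3] at hint
  have hle : c * ∫ z in U, η z * J z ≤ ∫ z in U, η z * J z *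
      LinearMap.trace ℝ 𝔼 (fderiv ℝ X z + T z).toLinearMap := by
    rw [← integral_const_mul]
    refine setIntegral_mono_on (i2.const_mul c) i3 hU.measurableSet fun z hz => ?_
    rw [mul_comm c]
    exact mul_le_mul_of_nonneg_left (hc z hz) (mul_nonneg (hη0 z hz) (Real.sqrt_nonneg _))
  linarith

end Density

/-! ### Lie derivatives of fields of bilinear forms. -/

section LieDerivative

variable {E : Type*} [NormedAddCommGroup E] [NormedSpace ℝ E]
  {E' : Type*} [NormedAddCommGroup E'] [NormedSpace ℝ E']

/-- The quadratic form of the Lie derivative of the field of bilinear forms `G` along `X`. -/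
def lieDerivForm (G : E → E →L[ℝ] E →L[ℝ] ℝ) (X : E → E) (z v : E) : ℝ :=
  fderiv ℝ G z (X z) v v + G z (fderiv ℝ X z v) v + G z v (fderiv ℝ X z v)

/-- Lie derivatives commute with pullbacks. -/
theorem lieDerivForm_pullback {G : E → E →L[ℝ] E →L[ℝ] ℝ} {X : E → E} {ψ : E → E'}
    {γ : E' → E' →L[ℝ] E' →L[ℝ] ℝ} {Y : E' → E'} {z : E} (hψ : ContDiffAt ℝ 2 ψ z)
    (hX : DifferentiableAt ℝ X z) (hγ : DifferentiableAt ℝ γ (ψ z))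
    (hY : DifferentiableAt ℝ Y (ψ z))
    (hG : ∀ᶠ y in 𝓝 z, ∀ v w, G y v w = γ (ψ y) (fderiv ℝ ψ y v) (fderiv ℝ ψ y w))
    (hXY : ∀ᶠ y in 𝓝 z, fderiv ℝ ψ y (X y) = Y (ψ y)) (hGd : DifferentiableAt ℝ G z) (v : E) :
    lieDerivForm G X z v = lieDerivForm γ Y (ψ z) (fderiv ℝ ψ z v) := by
  have hψ1 : HasFDerivAt ψ (fderiv ℝ ψ z) z := (hψ.differentiableAt two_ne_zero).hasFDerivAt
  have hDψ : HasFDerivAt (fderiv ℝ ψ) (fderiv ℝ (fderiv ℝ ψ) z) z :=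
    ((hψ.fderiv_right (m := 1) (by norm_num)).differentiableAt one_ne_zero).hasFDerivAt
  have hsymm := hψ.isSymmSndFDerivAt (by simp)
  -- Differentiating Dψ(X) = Y ∘ ψ along v gives D²ψ(v, X) + Dψ(DX v) = DY(Dψ v).
  have h1 := (hDψ.clm_apply hX.hasFDerivAt).congr_of_eventuallyEq
    (hXY.mono fun y hy => hy.symm)
  have h2 : HasFDerivAt (fun y => Y (ψ y)) ((fderiv ℝ Y (ψ z)).comp (fderiv ℝ ψ z)) z :=
    hY.hasFDerivAt.comp z hψ1
  have h3 := congrArg (fun L : E →L[ℝ] E' => L v) (h1.unique h2)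
  have h4 : HasFDerivAt (fun y => γ (ψ y)) ((fderiv ℝ γ (ψ z)).comp (fderiv ℝ ψ z)) z :=
    (HasFDerivAt.comp (g := γ) (f := ψ) z (hγ.hasFDerivAt) hψ1 :)
  have hv := hDψ.clm_apply (hasFDerivAt_const v z)
  have h5 := ((h4.clm_apply hv).clm_apply hv).congr_of_eventuallyEq
    (hG.mono fun y hy => hy v v)
  have h6 := (hGd.hasFDerivAt.clm_apply (hasFDerivAt_const v z)).clm_apply (hasFDerivAt_const v z)
  have h7 := congrArg (fun L : E →L[ℝ] ℝ => L (X z)) (h6.unique h5)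
  -- Differentiating the pulled-back form along X produces D²ψ(X, v), while relatedness produces
  -- D²ψ(v, X). Their symmetry is what makes the second-order terms cancel.
  have h8 := hsymm.eq (X z) v
  simp at h3 h7
  unfold lieDerivForm
  rw [hG.self_of_nhds, hG.self_of_nhds]
  rw [h7, ← hXY.self_of_nhds, ← h3, h8]
  simp
  ring

end LieDerivative

/-! ### The trace over a subspace and its orthogonal complement. -/

section Trace

variable {F : Type*} [NormedAddCommGroup F] [InnerProductSpace ℝ F] [FiniteDimensional ℝ F]

theorem trace_eq_sum_add_sum_orthogonal (K : Submodule ℝ F) (T : F →ₗ[ℝ] F) :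
    LinearMap.trace ℝ F T =
      ∑ i, inner ℝ (stdOrthonormalBasis ℝ K i : F) (T (stdOrthonormalBasis ℝ K i)) +
      ∑ i, inner ℝ (stdOrthonormalBasis ℝ Kᗮ i : F) (T (stdOrthonormalBasis ℝ Kᗮ i)) := by
  rw [LinearMap.trace_eq_sum_inner T (((stdOrthonormalBasis ℝ K).prod
    (stdOrthonormalBasis ℝ Kᗮ)).map K.orthogonalDecomposition.symm)]
  simp

end Trace

/-! ### The metric in coordinates -/

section Coordinates

variable {m : ℕ} {M : Type*} [TopologicalSpace M] [ChartedSpace (EuclideanSpace ℝ (Fin m)) M]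

local notation "𝔼" => EuclideanSpace ℝ (Fin m)

/-- The coordinate frame at the point of coordinates `z` in the chart at `x`, with values in the
model space underlying the tangent space. -/
def frame (x : M) (z : 𝔼) : 𝔼 →L[ℝ] 𝔼 :=
  mfderiv 𝓘(ℝ, 𝔼) (𝓡 m) (extChartAt (𝓡 m) x).symm z

/-- The transition map from the chart at `x` to the chart at `x'`. -/
def transition (x x' : M) (z : 𝔼) : 𝔼 :=
  extChartAt (𝓡 m) x' ((extChartAt (𝓡 m) x).symm z)

theorem isOpen_transition_domain (x x' : M) :
    IsOpen ((extChartAt (𝓡 m) x).target ∩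
      (extChartAt (𝓡 m) x).symm ⁻¹' (extChartAt (𝓡 m) x').source) :=
  (continuousOn_extChartAt_symm x).isOpen_inter_preimage (isOpen_extChartAt_target x)
    (isOpen_extChartAt_source x')

theorem transition_symm_eq {x x' : M} {z : 𝔼}
    (hz : (extChartAt (𝓡 m) x).symm z ∈ (extChartAt (𝓡 m) x').source) :
    (extChartAt (𝓡 m) x').symm (transition x x' z) = (extChartAt (𝓡 m) x).symm z :=
  (extChartAt (𝓡 m) x').left_inv hz

variable [IsManifold (𝓡 m) ∞ M]

theorem contDiffOn_transition (x x' : M) :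
    ContDiffOn ℝ ∞ (transition x x') ((extChartAt (𝓡 m) x).target ∩
      (extChartAt (𝓡 m) x).symm ⁻¹' (extChartAt (𝓡 m) x').source) := by
  rw [← contMDiffOn_iff_contDiffOn]
  exact ((contMDiffOn_extChartAt (x := x')).mono (by simp)).comp
    ((contMDiffOn_extChartAt_symm x).mono inter_subset_left) fun z hz => hz.2

theorem mdifferentiableAt_symm {x : M} {z : 𝔼} (hz : z ∈ (extChartAt (𝓡 m) x).target) :
    MDifferentiableAt 𝓘(ℝ, 𝔼) (𝓡 m) (extChartAt (𝓡 m) x).symm z :=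
  ((contMDiffOn_extChartAt_symm (n := ∞) x).contMDiffAt
    ((isOpen_extChartAt_target x).mem_nhds hz)).mdifferentiableAt (by simp)

omit [IsManifold (𝓡 m) ∞ M] in
theorem frame_eq_mfderivWithin (x : M) (z : 𝔼) :
    frame x z = mfderivWithin 𝓘(ℝ, 𝔼) (𝓡 m) (extChartAt (𝓡 m) x).symm (range (𝓡 m)) z := by
  rw [ModelWithCorners.range_eq_univ, mfderivWithin_univ]
  rfl

theorem mfderiv_extChartAt_frame {x : M} {z : 𝔼} (hz : z ∈ (extChartAt (𝓡 m) x).target) (v : 𝔼) :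
    mfderiv (𝓡 m) 𝓘(ℝ, 𝔼) (extChartAt (𝓡 m) x) ((extChartAt (𝓡 m) x).symm z) (frame x z v) = v := by
  have := mfderiv_extChartAt_comp_mfderivWithin_extChartAt_symm (I := 𝓡 m) hz
  rw [← frame_eq_mfderivWithin] at this
  exact congrArg (fun L : 𝔼 →L[ℝ] 𝔼 => L v) this

theorem frame_mfderiv_extChartAt {x : M} {z : 𝔼} (hz : z ∈ (extChartAt (𝓡 m) x).target) (v : 𝔼) :
    frame x z (mfderiv (𝓡 m) 𝓘(ℝ, 𝔼) (extChartAt (𝓡 m) x) ((extChartAt (𝓡 m) x).symm z) v) = v := by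
  have := mfderivWithin_extChartAt_symm_comp_mfderiv_extChartAt (I := 𝓡 m) hz
  rw [← frame_eq_mfderivWithin] at this
  exact congrArg (fun L : 𝔼 →L[ℝ] 𝔼 => L v) this

/-- The coordinate frame as an isomorphism. -/
def frameEquiv {x : M} {z : 𝔼} (hz : z ∈ (extChartAt (𝓡 m) x).target) : 𝔼 ≃L[ℝ] 𝔼 :=
  ContinuousLinearEquiv.equivOfInverse (frame x z)
    (mfderiv (𝓡 m) 𝓘(ℝ, 𝔼) (extChartAt (𝓡 m) x) ((extChartAt (𝓡 m) x).symm z))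
    (mfderiv_extChartAt_frame hz) (frame_mfderiv_extChartAt hz)

theorem frameEquiv_apply {x : M} {z : 𝔼} (hz : z ∈ (extChartAt (𝓡 m) x).target) (v : 𝔼) :
    frameEquiv hz v = frame x z v :=
  rfl

/-- The tangent space at x is modelled on the Euclidean space through the chart at x itself.
Pointwise computations are therefore made at the base point of a chart, where no change of frame
intervenes. -/
theorem frame_self (x : M) : frame x (extChartAt (𝓡 m) x x) = ContinuousLinearMap.id ℝ 𝔼 := by
  have h := TangentBundle.symmL_trivializationAt (𝕜 := ℝ) (I := 𝓡 m) (mem_chart_source 𝔼 x)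
  rw [← frame_eq_mfderivWithin,
    TangentBundle.symmL_trivializationAt_eq_core (mem_chart_source 𝔼 x)] at h
  rw [← h]
  ext1 v
  exact (tangentBundleCore (𝓡 m) M).coordChange_self _ _ (mem_chart_source 𝔼 x) v

/-- The chain rule for a map read in a chart. -/
theorem mfderiv_frame {E' : Type*} [NormedAddCommGroup E'] [NormedSpace ℝ E'] {f : M → E'} {x : M}
    {z : 𝔼} (hz : z ∈ (extChartAt (𝓡 m) x).target)
    (hf : MDifferentiableAt (𝓡 m) 𝓘(ℝ, E') f ((extChartAt (𝓡 m) x).symm z)) (v : 𝔼) :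
    @Eq E' (mfderiv (𝓡 m) 𝓘(ℝ, E') f ((extChartAt (𝓡 m) x).symm z) (frame x z v))
      (fderiv ℝ (fun y => f ((extChartAt (𝓡 m) x).symm y)) z v) := by
  have := mfderiv_comp z hf (mdifferentiableAt_symm hz)
  rw [← mfderiv_eq_fderiv]
  exact (congrArg (fun L : 𝔼 →L[ℝ] E' => L v) this).symm

theorem frame_transition {x x' : M} {z : 𝔼} (hz : z ∈ (extChartAt (𝓡 m) x).target)
    (hz' : (extChartAt (𝓡 m) x).symm z ∈ (extChartAt (𝓡 m) x').source) (v : 𝔼) :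
    frame x' (transition x x' z) (fderiv ℝ (transition x x') z v) = frame x z v := by
  have hD := (isOpen_transition_domain x x').mem_nhds ⟨hz, hz'⟩
  have ht : transition x x' z ∈ (extChartAt (𝓡 m) x').target := (extChartAt (𝓡 m) x').map_source hz'
  have h1 : (extChartAt (𝓡 m) x).symm =ᶠ[𝓝 z] (extChartAt (𝓡 m) x').symm ∘ transition x x' := by
    filter_upwards [hD] with y hy using (transition_symm_eq hy.2).symm
  have h2 : MDifferentiableAt 𝓘(ℝ, 𝔼) 𝓘(ℝ, 𝔼) (transition x x') z :=
    (((contDiffOn_transition x x').contDiffAt hD).differentiableAt (by simp)).mdifferentiableAt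
  have h3 := mfderiv_comp z (mdifferentiableAt_symm ht) h2
  rw [← h1.mfderiv_eq, mfderiv_eq_fderiv] at h3
  exact (congrArg (fun L : 𝔼 →L[ℝ] 𝔼 => L v) h3).symm

theorem contMDiffOn_frame (x : M) (v : 𝔼) :
    ContMDiffOn 𝓘(ℝ, 𝔼) (𝓡 m).tangent ∞
      (fun z => (⟨(extChartAt (𝓡 m) x).symm z, frame x z v⟩ : TangentBundle (𝓡 m) M))
      (extChartAt (𝓡 m) x).target := by
  have h1 := (contMDiffOn_extChartAt_symm (I := 𝓡 m) (n := ∞) x).contMDiffOn_tangentMapWithin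
    (m := ∞) (by simp) (isOpen_extChartAt_target x).uniqueMDiffOn
  have h2 : ContMDiffOn 𝓘(ℝ, 𝔼) 𝓘(ℝ, 𝔼).tangent ∞ (fun z => (⟨z, v⟩ : TangentBundle 𝓘(ℝ, 𝔼) 𝔼))
      (extChartAt (𝓡 m) x).target :=
    contMDiffOn_vectorSpace_iff_contDiffOn.2 contDiffOn_const
  refine (h1.comp h2 fun z hz => hz).congr fun z hz => ?_
  simp only [Function.comp_apply, tangentMapWithin]
  rw [mfderivWithin_of_isOpen (isOpen_extChartAt_target x) hz]
  rfl

variable [RiemannianBundle (fun x : M => TangentSpace (𝓡 m) x)]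

/-- The inner product of the tangent space at `y`, read on the underlying model space. -/
def tangentInner (y : M) : 𝔼 →L[ℝ] 𝔼 →L[ℝ] ℝ :=
  innerSL ℝ (E := TangentSpace (𝓡 m) y)

/-- The metric in the chart at `x`. -/
def coordMetric (x : M) (z : 𝔼) : 𝔼 →L[ℝ] 𝔼 →L[ℝ] ℝ :=
  (tangentInner ((extChartAt (𝓡 m) x).symm z)).bilinearComp (frame x z) (frame x z)

omit [IsManifold (𝓡 m) ∞ M] in
theorem coordMetric_apply (x : M) (z v w : 𝔼) :
    coordMetric x z v w =
      tangentInner ((extChartAt (𝓡 m) x).symm z) (frame x z v) (frame x z w) :=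
  rfl

omit [IsManifold (𝓡 m) ∞ M] in
theorem coordMetric_symm (x : M) (z v w : 𝔼) : coordMetric x z v w = coordMetric x z w v :=
  real_inner_comm (F := TangentSpace (𝓡 m) ((extChartAt (𝓡 m) x).symm z)) _ _

theorem coordMetric_pos {x : M} {z : 𝔼} (hz : z ∈ (extChartAt (𝓡 m) x).target) (v : 𝔼)
    (hv : v ≠ 0) : 0 < coordMetric x z v v := by
  refine real_inner_self_pos (F := TangentSpace (𝓡 m) ((extChartAt (𝓡 m) x).symm z)).2
    fun h => hv ?_
  exact (frameEquiv hz).map_eq_zero_iff.1 h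

theorem coordMetric_transition {x x' : M} {z : 𝔼} (hz : z ∈ (extChartAt (𝓡 m) x).target)
    (hz' : (extChartAt (𝓡 m) x).symm z ∈ (extChartAt (𝓡 m) x').source) (v w : 𝔼) :
    coordMetric x z v w = coordMetric x' (transition x x' z) (fderiv ℝ (transition x x') z v)
      (fderiv ℝ (transition x x') z w) := by
  rw [coordMetric_apply, coordMetric_apply, frame_transition hz hz', frame_transition hz hz',
    transition_symm_eq hz']

variable [IsContMDiffRiemannianBundle (𝓡 m) ∞ (EuclideanSpace ℝ (Fin m))
  (fun x : M => TangentSpace (𝓡 m) x)]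

theorem contDiffOn_coordMetric (x : M) :
    ContDiffOn ℝ ∞ (coordMetric x) (extChartAt (𝓡 m) x).target := by
  refine contDiffOn_clm_apply.2 fun v => contDiffOn_clm_apply.2 fun w => ?_
  rw [← contMDiffOn_iff_contDiffOn]
  exact ContMDiffOn.inner_bundle (contMDiffOn_frame x v) (contMDiffOn_frame x w)

end Coordinates

/-! ### The Riemannian volume in coordinates -/

section Volume

variable {m : ℕ}

local notation "𝔼" => EuclideanSpace ℝ (Fin m)

/-- The Gram matrix becomes QᵀGQ, whose determinant gains the square of det P. The root leaves |det
P|, exactly the Jacobian factor of a change of variables. -/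
theorem sqrt_det_gram_comp (b : 𝔼 →L[ℝ] 𝔼 →L[ℝ] ℝ) (P : 𝔼 →L[ℝ] 𝔼) :
    Real.sqrt (Matrix.of fun i j : Fin m =>
      b (P (EuclideanSpace.single i (1 : ℝ))) (P (EuclideanSpace.single j (1 : ℝ)))).det =
    |P.det| * Real.sqrt (Matrix.of fun i j : Fin m =>
      b (EuclideanSpace.single i (1 : ℝ)) (EuclideanSpace.single j (1 : ℝ))).det := by
  set Q : Matrix (Fin m) (Fin m) ℝ := LinearMap.toMatrix
    (EuclideanSpace.basisFun (Fin m) ℝ).toBasis (EuclideanSpace.basisFun (Fin m) ℝ).toBasis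
    P.toLinearMap with hQ
  have hQa : ∀ k i, Q k i = P (EuclideanSpace.single i (1 : ℝ)) k := fun k i => by
    simp [hQ, LinearMap.toMatrix_apply]
  have hdet : Q.det = P.det := LinearMap.det_toMatrix _ _
  have h : (Matrix.of fun i j : Fin m =>
      b (P (EuclideanSpace.single i (1 : ℝ))) (P (EuclideanSpace.single j (1 : ℝ)))) =
      Q.transpose * (Matrix.of fun i j : Fin m =>
      b (EuclideanSpace.single i (1 : ℝ)) (EuclideanSpace.single j (1 : ℝ))) * Q := by
    ext i j
    rw [Matrix.of_apply, bilin_eq_sum, Finset.sum_comm]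
    simp only [Matrix.mul_apply, Finset.sum_mul, Matrix.transpose_apply, Matrix.of_apply, hQa]
    exact Finset.sum_congr rfl fun k _ => Finset.sum_congr rfl fun l _ => by ring
  rw [h, Matrix.det_mul, Matrix.det_mul, Matrix.det_transpose, hdet,
    show ∀ a b : ℝ, a * b * a = a ^ 2 * b from fun a b => by ring,
    Real.sqrt_mul (sq_nonneg _), Real.sqrt_sq_eq_abs]

variable {M : Type*} [TopologicalSpace M] [ChartedSpace (EuclideanSpace ℝ (Fin m)) M]
  [IsManifold (𝓡 m) ∞ M] [RiemannianBundle (fun x : M => TangentSpace (𝓡 m) x)]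

theorem density_transition {x x' : M} {z : 𝔼} (hz : z ∈ (extChartAt (𝓡 m) x).target)
    (hz' : (extChartAt (𝓡 m) x).symm z ∈ (extChartAt (𝓡 m) x').source) :
    density (coordMetric x) z =
      |(fderiv ℝ (transition x x') z).det| * density (coordMetric x') (transition x x' z) := by
  unfold density
  simp only [coordMetric_transition hz hz']
  exact sqrt_det_gram_comp _ _

variable [IsContMDiffRiemannianBundle (𝓡 m) ∞ (EuclideanSpace ℝ (Fin m))
  (fun x : M => TangentSpace (𝓡 m) x)]

theorem contDiffOn_density (x : M) :
    ContDiffOn ℝ ∞ (density (coordMetric x)) (extChartAt (𝓡 m) x).target := fun _ hz =>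
  (contDiffAt_density ((contDiffOn_coordMetric x).contDiffAt
    ((isOpen_extChartAt_target x).mem_nhds hz)) (coordMetric_symm x _)
    (coordMetric_pos hz)).contDiffWithinAt

variable [MeasurableSpace M] [BorelSpace M]

omit [IsManifold (𝓡 m) ∞ M] [RiemannianBundle (fun x : M => TangentSpace (𝓡 m) x)]
  [IsContMDiffRiemannianBundle (𝓡 m) ∞ (EuclideanSpace ℝ (Fin m))
  (fun x : M => TangentSpace (𝓡 m) x)] in
theorem aemeasurable_symm (x : M) (f : 𝔼 → ℝ≥0∞) : AEMeasurable (extChartAt (𝓡 m) x).symm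
    ((volume.restrict (extChartAt (𝓡 m) x).target).withDensity f) :=
  ((continuousOn_extChartAt_symm x).aemeasurable
    (isOpen_extChartAt_target x).measurableSet).mono_ac (withDensity_absolutelyContinuous _ _)

omit [IsManifold (𝓡 m) ∞ M] [IsContMDiffRiemannianBundle (𝓡 m) ∞ (EuclideanSpace ℝ (Fin m))
  (fun x : M => TangentSpace (𝓡 m) x)] in
theorem chartVolume_apply (x : M) {s : Set M} (hs : MeasurableSet s) :
    chartVolume (m := m) x s =
      ∫⁻ z in (extChartAt (𝓡 m) x).target ∩ (extChartAt (𝓡 m) x).symm ⁻¹' s,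
        ENNReal.ofReal (density (coordMetric x) z) := by
  rw [chartVolume, Measure.map_apply_of_aemeasurable (aemeasurable_symm x _) hs,
    withDensity_apply', Measure.restrict_restrict' (isOpen_extChartAt_target x).measurableSet,
    inter_comm]
  rfl

omit [IsContMDiffRiemannianBundle (𝓡 m) ∞ (EuclideanSpace ℝ (Fin m))
    (fun x : M => TangentSpace (𝓡 m) x)] in
/-- The chart volumes agree on overlaps. -/
theorem chartVolume_eq_of_subset (x x' : M) {s : Set M} (hs : MeasurableSet s)
    (hx : s ⊆ (extChartAt (𝓡 m) x).source) (hx' : s ⊆ (extChartAt (𝓡 m) x').source) :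
    chartVolume (m := m) x s = chartVolume (m := m) x' s := by
  rw [chartVolume_apply x hs, chartVolume_apply x' hs]
  set A := (extChartAt (𝓡 m) x).target ∩ (extChartAt (𝓡 m) x).symm ⁻¹' s with hA
  have hAm : MeasurableSet A := by
    have h := (isOpen_extChartAt_target x).measurableSet.subtype_image
      ((continuousOn_iff_continuous_domRestrict.1
        (continuousOn_extChartAt_symm (I := 𝓡 m) x)).measurable
        hs)
    convert h using 1
    ext z
    simp [hA, and_comm]
  have hsub : A ⊆ (extChartAt (𝓡 m) x).target ∩
      (extChartAt (𝓡 m) x).symm ⁻¹' (extChartAt (𝓡 m) x').source := fun z hz => ⟨hz.1, hx' hz.2⟩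
  have himage : (extChartAt (𝓡 m) x').target ∩ (extChartAt (𝓡 m) x').symm ⁻¹' s =
      transition x x' '' A := by
    ext y
    constructor
    · rintro ⟨hy, hys⟩
      refine ⟨transition x' x y, ⟨(extChartAt (𝓡 m) x).map_source (hx hys), ?_⟩, ?_⟩
      · simpa only [mem_preimage, transition_symm_eq (hx hys)] using hys
      · rw [transition, transition_symm_eq (hx hys), (extChartAt (𝓡 m) x').right_inv hy]
    · rintro ⟨z, hz, rfl⟩
      refine ⟨(extChartAt (𝓡 m) x').map_source (hx' hz.2), ?_⟩
      simpa only [mem_preimage, transition_symm_eq (hx' hz.2)] using hz.2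
  have hinj : InjOn (transition x x') A := fun z hz y hy h => by
    have h1 := congrArg (extChartAt (𝓡 m) x').symm h
    rw [transition_symm_eq (hx' hz.2), transition_symm_eq (hx' hy.2)] at h1
    rw [← (extChartAt (𝓡 m) x).right_inv hz.1, h1, (extChartAt (𝓡 m) x).right_inv hy.1]
  have hderiv : ∀ z ∈ A, HasFDerivWithinAt (transition x x') (fderiv ℝ (transition x x') z) A z :=
    fun z hz => (((contDiffOn_transition x x').contDiffAt ((isOpen_transition_domain x x').mem_nhds
      (hsub hz))).differentiableAt (by simp)).hasFDerivAt.hasFDerivWithinAt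
  rw [himage, lintegral_image_eq_lintegral_abs_det_fderiv_mul volume hAm hderiv hinj]
  refine setLIntegral_congr_fun hAm fun z hz => ?_
  rw [density_transition hz.1 (hx' hz.2), ENNReal.ofReal_mul (abs_nonneg _)]

omit [IsContMDiffRiemannianBundle (𝓡 m) ∞ (EuclideanSpace ℝ (Fin m))
    (fun x : M => TangentSpace (𝓡 m) x)] in
-- On the source of the chart at x every chart volume is dominated by that of x, by agreement on
-- overlaps. Hence the chart volume of x plus the part of the total volume outside this source
-- bounds all chart volumes, and so their supremum. Restricting to the source removes the second
-- term. No countability of the atlas is involved.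
theorem riemannianVolume_restrict_source (x : M) :
    (riemannianVolume m M).restrict (extChartAt (𝓡 m) x).source = chartVolume (m := m) x := by
  have hS : MeasurableSet (extChartAt (𝓡 m) x).source := (isOpen_extChartAt_source x).measurableSet
  have hres : ∀ y : M, (chartVolume (m := m) y).restrict (extChartAt (𝓡 m) x).source ≤
      chartVolume (m := m) x := fun y => by
    refine Measure.le_iff.2 fun s hs => ?_
    rw [Measure.restrict_apply hs]
    have hsub : chartVolume (m := m) y (s ∩ (extChartAt (𝓡 m) x).source) =
        chartVolume (m := m) y (s ∩ (extChartAt (𝓡 m) x).source ∩ (extChartAt (𝓡 m) y).source) := by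
      rw [chartVolume_apply y (hs.inter hS), chartVolume_apply y
        ((hs.inter hS).inter (isOpen_extChartAt_source y).measurableSet)]
      congr 2
      ext z
      simp only [mem_inter_iff, mem_preimage]
      have := fun h => (extChartAt (𝓡 m) y).map_target (x := z) h
      tauto
    rw [hsub, chartVolume_eq_of_subset y x
      ((hs.inter hS).inter (isOpen_extChartAt_source y).measurableSet) inter_subset_right
      fun z hz => hz.1.2]
    exact measure_mono fun z hz => hz.1.1
  have hself : (chartVolume (m := m) x).restrict (extChartAt (𝓡 m) x).source =
      chartVolume (m := m) x := by
    refine Measure.restrict_eq_self_of_ae_mem ?_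
    rw [ae_iff]
    change chartVolume (m := m) x (extChartAt (𝓡 m) x).sourceᶜ = 0
    rw [chartVolume_apply x hS.compl]
    have : (extChartAt (𝓡 m) x).target ∩
        (extChartAt (𝓡 m) x).symm ⁻¹' (extChartAt (𝓡 m) x).sourceᶜ = ∅ := by
      ext z
      simp only [mem_inter_iff, mem_preimage, mem_compl_iff, mem_empty_iff_false, iff_false,
        not_and, not_not]
      exact fun h => (extChartAt (𝓡 m) x).map_target h
    rw [this, Measure.restrict_empty, lintegral_zero_measure]
  refine le_antisymm ?_ ?_
  · have hle : riemannianVolume m M ≤ chartVolume (m := m) x +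
        (riemannianVolume m M).restrict (extChartAt (𝓡 m) x).sourceᶜ := by
      refine iSup_le fun y => ?_
      rw [← Measure.restrict_add_restrict_compl (μ := chartVolume (m := m) y) hS]
      refine add_le_add (hres y) (Measure.restrict_mono le_rfl ?_)
      exact le_iSup (fun y : M => chartVolume (m := m) y) y
    refine (Measure.restrict_mono le_rfl hle).trans ?_
    rw [Measure.restrict_add, Measure.restrict_restrict hS, inter_compl_self,
      Measure.restrict_empty, add_zero]
    exact Measure.restrict_le_self
  · rw [← hself]
    exact Measure.restrict_mono le_rfl (le_iSup (fun y : M => chartVolume (m := m) y) x)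

/-- Near x the volume is the integral of a continuous density over part of a compact set. Local
finiteness is what makes continuous functions with compact support integrable. -/
instance isLocallyFiniteMeasure_riemannianVolume :
    IsLocallyFiniteMeasure (riemannianVolume m M) := by
  refine ⟨fun x => ?_⟩
  obtain ⟨K, hK, hKx, hKt⟩ := exists_compact_subset (isOpen_extChartAt_target (I := 𝓡 m) x)
    (mem_extChartAt_target x)
  have hopen : IsOpen ((extChartAt (𝓡 m) x).source ∩ extChartAt (𝓡 m) x ⁻¹' interior K) :=
    (continuousOn_extChartAt x).isOpen_inter_preimage (isOpen_extChartAt_source x) isOpen_interior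
  refine ⟨_, hopen.mem_nhds ⟨mem_extChartAt_source x, hKx⟩, ?_⟩
  have h1 : riemannianVolume m M ((extChartAt (𝓡 m) x).source ∩ extChartAt (𝓡 m) x ⁻¹' interior K) =
      chartVolume (m := m) x
        ((extChartAt (𝓡 m) x).source ∩ extChartAt (𝓡 m) x ⁻¹' interior K) := by
    rw [← riemannianVolume_restrict_source x, Measure.restrict_apply hopen.measurableSet]
    congr 1
    ext y
    simp only [mem_inter_iff]
    tauto
  rw [h1, chartVolume_apply x hopen.measurableSet]
  have hint : IntegrableOn (density (coordMetric x)) K volume :=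
    ((contDiffOn_density x).continuousOn.mono hKt).integrableOn_compact hK
  refine (lintegral_mono_set fun z hz => ?_).trans_lt (Integrable.lintegral_lt_top hint)
  have := hz.2.2
  rw [mem_preimage, (extChartAt (𝓡 m) x).right_inv hz.1] at this
  exact interior_subset this

/-- Integration of a function in a chart. -/
theorem setIntegral_source_eq (x : M) {g : M → ℝ}
    (hg : ContinuousOn g (extChartAt (𝓡 m) x).source) :
    ∫ y in (extChartAt (𝓡 m) x).source, g y ∂(riemannianVolume m M) =
      ∫ z in (extChartAt (𝓡 m) x).target,
        g ((extChartAt (𝓡 m) x).symm z) * density (coordMetric x) z := by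
  have hgm : AEStronglyMeasurable g (chartVolume (m := m) x) := by
    rw [← riemannianVolume_restrict_source x]
    exact hg.aestronglyMeasurable (isOpen_extChartAt_source x).measurableSet
  have hd : AEMeasurable (density (coordMetric x))
      (volume.restrict (extChartAt (𝓡 m) x).target) :=
    (contDiffOn_density x).continuousOn.aemeasurable (isOpen_extChartAt_target x).measurableSet
  rw [riemannianVolume_restrict_source, chartVolume, integral_map (aemeasurable_symm x _) hgm,
    integral_withDensity_eq_integral_toReal_smul₀]
  · refine integral_congr_ae (Eventually.of_forall fun z => ?_)
    change (ENNReal.ofReal (density (coordMetric x) z)).toReal • _ = _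
    have h0 : 0 ≤ density (coordMetric x) z := Real.sqrt_nonneg _
    rw [ENNReal.toReal_ofReal h0, smul_eq_mul, mul_comm]
  · exact hd.ennreal_ofReal
  · exact Eventually.of_forall fun z => ENNReal.ofReal_lt_top

end Volume

/-! ### Projections with respect to a field of inner products -/

section Projection

variable {E : Type*} [NormedAddCommGroup E] [NormedSpace ℝ E] [FiniteDimensional ℝ E]
  {F : Type*} [NormedAddCommGroup F] [NormedSpace ℝ F] [FiniteDimensional ℝ F]

theorem isInvertible_of_injective {T : E →L[ℝ] F} (hT : Function.Injective T)
    (h : Module.finrank ℝ E = Module.finrank ℝ F) : T.IsInvertible :=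
  ⟨(LinearEquiv.ofInjectiveOfFinrankEq T.toLinearMap hT h).toContinuousLinearEquiv, by ext; rfl⟩

variable (E) in
theorem finrank_dual : Module.finrank ℝ (E →L[ℝ] ℝ) = Module.finrank ℝ E :=
  (LinearMap.toContinuousLinearMap (𝕜 := ℝ) (E := E) (F' := ℝ)).finrank_eq.symm.trans
    Subspace.dual_finrank_eq

theorem isInvertible_of_pos {b : E →L[ℝ] E →L[ℝ] ℝ} (hp : ∀ v, v ≠ 0 → 0 < b v v) :
    b.IsInvertible := by
  refine isInvertible_of_injective ((injective_iff_map_eq_zero b).2 fun v hv => ?_)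
    (finrank_dual E).symm
  by_contra h
  exact (hp v h).ne' (by simp [hv])

/-- The vectors dual to the pullbacks by `D` of linear forms. -/
def raise (b : E →L[ℝ] E →L[ℝ] ℝ) (D : E →L[ℝ] F) : (F →L[ℝ] ℝ) →L[ℝ] E :=
  b.inverse.comp ((ContinuousLinearMap.compL ℝ E F ℝ).flip D)

omit [FiniteDimensional ℝ F] in
theorem apply_raise {b : E →L[ℝ] E →L[ℝ] ℝ} (hp : ∀ v, v ≠ 0 → 0 < b v v) (D : E →L[ℝ] F)
    (l : F →L[ℝ] ℝ) (w : E) : b (raise b D l) w = l (D w) := by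
  simp [raise, (isInvertible_of_pos hp).self_apply_inverse]

/-- This is the operator D b⁻¹ D*. If it kills l, then b(w, w) = l(D w) = 0 for w = `raise b D l`,
so w = 0 and l vanishes on the range of D, which is everything. -/
theorem isInvertible_comp_raise {b : E →L[ℝ] E →L[ℝ] ℝ} (hp : ∀ v, v ≠ 0 → 0 < b v v)
    {D : E →L[ℝ] F} (hD : Function.Surjective D) : (D.comp (raise b D)).IsInvertible := by
  refine isInvertible_of_injective ((injective_iff_map_eq_zero _).2 fun l hl => ?_) (finrank_dual F)
  have h0 : raise b D l = 0 := by
    by_contra h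
    have h1 := apply_raise hp D l (raise b D l)
    rw [show D (raise b D l) = 0 from hl, map_zero] at h1
    exact (hp _ h).ne' h1
  ext y
  obtain ⟨w, rfl⟩ := hD y
  rw [← apply_raise hp D l w, h0]
  simp

/-- The `b`-orthogonal projection onto the orthogonal of the kernel of `D`. -/
def horizontalProj (b : E →L[ℝ] E →L[ℝ] ℝ) (D : E →L[ℝ] F) : E →L[ℝ] E :=
  (raise b D).comp ((D.comp (raise b D)).inverse.comp D)

theorem apply_horizontalProj {b : E →L[ℝ] E →L[ℝ] ℝ} (hp : ∀ v, v ≠ 0 → 0 < b v v)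
    {D : E →L[ℝ] F} (hD : Function.Surjective D) (v : E) : D (horizontalProj b D v) = D v :=
  (isInvertible_comp_raise hp hD).self_apply_inverse (D v)

omit [FiniteDimensional ℝ F] in
theorem horizontalProj_orthogonal {b : E →L[ℝ] E →L[ℝ] ℝ} (hp : ∀ v, v ≠ 0 → 0 < b v v)
    (D : E →L[ℝ] F) (v : E) {w : E} (hw : D w = 0) : b (horizontalProj b D v) w = 0 := by
  refine (apply_raise hp D _ w).trans ?_
  rw [hw, map_zero]

/-- The formula b⁻¹D*(D b⁻¹D*)⁻¹D uses only composition and inversion of invertible maps, so it is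
as smooth as b and D. This is why the projection is written this way rather than as the orthogonal
projection onto a moving subspace. -/
theorem contDiffAt_horizontalProj {E₀ : Type*} [NormedAddCommGroup E₀] [NormedSpace ℝ E₀]
    {G : E₀ → E →L[ℝ] E →L[ℝ] ℝ} {D : E₀ → E →L[ℝ] F} {z : E₀} {k : WithTop ℕ∞}
    (hG : ContDiffAt ℝ k G z) (hD : ContDiffAt ℝ k D z)
    (hp : ∀ v, v ≠ 0 → 0 < G z v v) (hs : Function.Surjective (D z)) :
    ContDiffAt ℝ k (fun y => horizontalProj (G y) (D y)) z := by
  have hr : ContDiffAt ℝ k (fun y => raise (G y) (D y)) z := by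
    have h1 : ContDiffAt ℝ k (fun y => (G y).inverse) z :=
      (isInvertible_of_pos hp).contDiffAt_map_inverse.comp z hG
    have h2 : ContDiffAt ℝ k (fun y => (ContinuousLinearMap.compL ℝ E F ℝ).flip (D y)) z :=
      (ContinuousLinearMap.contDiff _).contDiffAt.comp z hD
    exact h1.clm_comp h2
  have h3 : ContDiffAt ℝ k (fun y => ((D y).comp (raise (G y) (D y))).inverse) z :=
    ContDiffAt.comp (g := ContinuousLinearMap.inverse) z
      ((isInvertible_comp_raise hp hs).contDiffAt_map_inverse) (hD.clm_comp hr)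
  exact hr.clm_comp (h3.clm_comp hD)

end Projection

/-! ### The Koszul formula in the chart at a point -/

section Koszul

variable {m : ℕ} {M : Type*} [TopologicalSpace M] [ChartedSpace (EuclideanSpace ℝ (Fin m)) M]
  [IsManifold (𝓡 m) ∞ M]

local notation "𝔼" => EuclideanSpace ℝ (Fin m)

theorem mfderiv_extChartAt_self (x : M) :
    mfderiv (𝓡 m) 𝓘(ℝ, 𝔼) (extChartAt (𝓡 m) x) x = ContinuousLinearMap.id ℝ 𝔼 := by
  have h := mfderiv_extChartAt_comp_mfderivWithin_extChartAt_symm' (I := 𝓡 m)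
    (mem_extChartAt_source (I := 𝓡 m) x)
  rw [← frame_eq_mfderivWithin, frame_self] at h
  exact h

/-- The derivative of a map which reads `h'` in the chart at `x`. -/
theorem mfderiv_eq_fderiv_of_eventuallyEq {E' : Type*} [NormedAddCommGroup E'] [NormedSpace ℝ E']
    {x : M} {h : M → E'} {h' : 𝔼 → E'}
    (hh : ∀ᶠ z in 𝓝 (extChartAt (𝓡 m) x x), h ((extChartAt (𝓡 m) x).symm z) = h' z)
    (hd : DifferentiableAt ℝ h' (extChartAt (𝓡 m) x x)) (a : 𝔼) :
    @Eq E' (mfderiv (𝓡 m) 𝓘(ℝ, E') h x a) (fderiv ℝ h' (extChartAt (𝓡 m) x x) a) := by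
  have h1 : h =ᶠ[𝓝 x] h' ∘ extChartAt (𝓡 m) x := by
    filter_upwards [(continuousAt_extChartAt (I := 𝓡 m) x).eventually hh,
      extChartAt_source_mem_nhds (I := 𝓡 m) x] with y hy hys
    rwa [(extChartAt (𝓡 m) x).left_inv hys] at hy
  have h2 := mfderiv_comp x hd.mdifferentiableAt
    (mdifferentiableAt_extChartAt (I := 𝓡 m) (mem_chart_source 𝔼 x))
  rw [← h1.mfderiv_eq, mfderiv_extChartAt_self, mfderiv_eq_fderiv] at h2
  exact congrArg (fun L : 𝔼 →L[ℝ] E' => L a) h2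

/-- The bracket of vector fields which read `V'` and `W'` in the chart at `x`. -/
theorem mlieBracket_eq_of_eventuallyEq {x : M} {V W : Π y : M, TangentSpace (𝓡 m) y} {V' W' : 𝔼 → 𝔼}
    (hV : ∀ᶠ z in 𝓝 (extChartAt (𝓡 m) x x),
      V ((extChartAt (𝓡 m) x).symm z) = frame x z (V' z))
    (hW : ∀ᶠ z in 𝓝 (extChartAt (𝓡 m) x x),
      W ((extChartAt (𝓡 m) x).symm z) = frame x z (W' z)) :
    VectorField.mlieBracket (𝓡 m) V W x =
      fderiv ℝ W' (extChartAt (𝓡 m) x x) (V' (extChartAt (𝓡 m) x x)) -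
      fderiv ℝ V' (extChartAt (𝓡 m) x x) (W' (extChartAt (𝓡 m) x x)) := by
  have key : ∀ {A : Π y : M, TangentSpace (𝓡 m) y} {A' : 𝔼 → 𝔼},
      (∀ᶠ z in 𝓝 (extChartAt (𝓡 m) x x), A ((extChartAt (𝓡 m) x).symm z) = frame x z (A' z)) →
      (VectorField.mpullbackWithin 𝓘(ℝ, 𝔼) (𝓡 m) (extChartAt (𝓡 m) x).symm A (range (𝓡 m)) :
        𝔼 → 𝔼) =ᶠ[𝓝 (extChartAt (𝓡 m) x x)] A' := fun {A A'} hA => by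
    filter_upwards [hA, extChartAt_target_mem_nhds (I := 𝓡 m) x] with z hz hzt
    rw [VectorField.mpullbackWithin_apply, ← frame_eq_mfderivWithin, hz]
    exact ContinuousLinearMap.IsInvertible.inverse_apply_self (f := frame x z)
      ⟨frameEquiv hzt, rfl⟩ _
  have h1 : ∀ L : 𝔼 →L[ℝ] 𝔼, L = ContinuousLinearMap.id ℝ 𝔼 → ∀ u : 𝔼, L.inverse u = u := by
    rintro L rfl u
    rw [ContinuousLinearMap.inverse_id]
    rfl
  have h2 : ∀ {A B A' B' : 𝔼 → 𝔼} {s : Set 𝔼} {z : 𝔼}, A =ᶠ[𝓝 z] A' → B =ᶠ[𝓝 z] B' → s = univ →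
      VectorField.lieBracketWithin ℝ A B s z = fderiv ℝ B' z (A' z) - fderiv ℝ A' z (B' z) := by
    rintro A B A' B' s z hA hB rfl
    rw [VectorField.lieBracketWithin_univ, hA.lieBracket_vectorField_eq hB,
      VectorField.lieBracket_eq]
  exact (h1 _ (mfderiv_extChartAt_self x) _).trans (h2 (key hV) (key hW) (by simp))

/-- The extensions chosen in `leviCivita` are constant in the trivialization at x, so they have
constant coefficients in the chart at x and commute near x. -/
theorem extend_eq_frame (x : M) (v : TangentSpace (𝓡 m) x) {z : 𝔼}
    (hz : z ∈ (extChartAt (𝓡 m) x).target) :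
    FiberBundle.extend 𝔼 v ((extChartAt (𝓡 m) x).symm z) = frame x z v := by
  have hs : (extChartAt (𝓡 m) x).symm z ∈ (chartAt 𝔼 x).source := by
    rw [← extChartAt_source (𝓡 m)]
    exact (extChartAt (𝓡 m) x).map_target hz
  have h := TangentBundle.symmL_trivializationAt (𝕜 := ℝ) (I := 𝓡 m) hs
  rw [(extChartAt (𝓡 m) x).right_inv hz, ← frame_eq_mfderivWithin] at h
  rw [← h]
  have h2 : (trivializationAt 𝔼 (TangentSpace (𝓡 m)) x ⟨x, v⟩).2 = v :=
    (tangentBundleCore (𝓡 m) M).coordChange_self _ _ (mem_chart_source 𝔼 x) v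
  unfold FiberBundle.extend
  rw [h2]
  exact (Trivialization.symmL_apply (R := ℝ) (trivializationAt 𝔼 (TangentSpace (𝓡 m)) x)
    (b := (extChartAt (𝓡 m) x).symm z) hs (v : 𝔼)).symm

variable [RiemannianBundle (fun x : M => TangentSpace (𝓡 m) x)]

omit [IsManifold (𝓡 m) ∞ M] in
theorem inner_eq_coordMetric {x : M} {z : 𝔼} {B C : Π y : M, TangentSpace (𝓡 m) y} {b c : 𝔼}
    (hB : B ((extChartAt (𝓡 m) x).symm z) = frame x z b)
    (hC : C ((extChartAt (𝓡 m) x).symm z) = frame x z c) :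
    inner ℝ (B ((extChartAt (𝓡 m) x).symm z)) (C ((extChartAt (𝓡 m) x).symm z)) =
      coordMetric x z b c := by
  rw [hB, hC]
  rfl

theorem coordMetric_self (x : M) (v w : 𝔼) :
    coordMetric x (extChartAt (𝓡 m) x x) v w = tangentInner x v w := by
  rw [coordMetric_apply, frame_self, extChartAt_to_inv]
  rfl

variable [IsContMDiffRiemannianBundle (𝓡 m) ∞ (EuclideanSpace ℝ (Fin m))
  (fun x : M => TangentSpace (𝓡 m) x)]

theorem differentiableAt_coordMetric {x : M} {z : 𝔼} (hz : z ∈ (extChartAt (𝓡 m) x).target) :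
    DifferentiableAt ℝ (coordMetric x) z :=
  ((contDiffOn_coordMetric x).contDiffAt
    ((isOpen_extChartAt_target x).mem_nhds hz)).differentiableAt (by simp)

/-- The Koszul formula for fields with constant coefficients in the first and third places. -/
theorem koszul_extend (x : M) (v ζ : 𝔼) {W : Π y : M, TangentSpace (𝓡 m) y}
    {W' : 𝔼 → 𝔼}
    (hW : ∀ᶠ z in 𝓝 (extChartAt (𝓡 m) x x),
      W ((extChartAt (𝓡 m) x).symm z) = frame x z (W' z))
    (hd : DifferentiableAt ℝ W' (extChartAt (𝓡 m) x x)) :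
    koszul (FiberBundle.extend 𝔼 (E := TangentSpace (𝓡 m)) (x := x) v) W
      (FiberBundle.extend 𝔼 (E := TangentSpace (𝓡 m)) (x := x) ζ) x =
      (fderiv ℝ (coordMetric x) (extChartAt (𝓡 m) x x) v (W' (extChartAt (𝓡 m) x x)) ζ
        + fderiv ℝ (coordMetric x) (extChartAt (𝓡 m) x x) (W' (extChartAt (𝓡 m) x x)) ζ v
        - fderiv ℝ (coordMetric x) (extChartAt (𝓡 m) x x) ζ v (W' (extChartAt (𝓡 m) x x))) / 2
      + coordMetric x (extChartAt (𝓡 m) x x) (fderiv ℝ W' (extChartAt (𝓡 m) x x) v) ζ := by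
  set z₀ := extChartAt (𝓡 m) x x with hz₀
  have htg := extChartAt_target_mem_nhds (I := 𝓡 m) x
  have hv : ∀ a : 𝔼, ∀ᶠ z in 𝓝 z₀,
      FiberBundle.extend 𝔼 (E := TangentSpace (𝓡 m)) (x := x) a ((extChartAt (𝓡 m) x).symm z) =
        frame x z ((fun _ => a) z) :=
    fun a => by filter_upwards [htg] with z hz using extend_eq_frame x a hz
  have hGd := (differentiableAt_coordMetric (mem_extChartAt_target (I := 𝓡 m) x)).hasFDerivAt
  have hD : ∀ {B C : Π y : M, TangentSpace (𝓡 m) y} {B' C' : 𝔼 → 𝔼} (a : 𝔼),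
      (∀ᶠ z in 𝓝 z₀, B ((extChartAt (𝓡 m) x).symm z) = frame x z (B' z)) →
      (∀ᶠ z in 𝓝 z₀, C ((extChartAt (𝓡 m) x).symm z) = frame x z (C' z)) →
      DifferentiableAt ℝ B' z₀ → DifferentiableAt ℝ C' z₀ →
      @Eq ℝ (mfderiv (𝓡 m) 𝓘(ℝ, ℝ) (fun y => inner ℝ (B y) (C y)) x a)
        (fderiv ℝ (coordMetric x) z₀ a (B' z₀) (C' z₀) + coordMetric x z₀ (fderiv ℝ B' z₀ a) (C' z₀)
          + coordMetric x z₀ (B' z₀) (fderiv ℝ C' z₀ a)) := fun {B C B' C'} a hB hC hB' hC' => by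
    have h1 := (hGd.clm_apply hB'.hasFDerivAt).clm_apply hC'.hasFDerivAt
    refine (mfderiv_eq_fderiv_of_eventuallyEq (h' := fun z => coordMetric x z (B' z) (C' z))
      (by filter_upwards [hB, hC] with z h1 h2 using inner_eq_coordMetric h1 h2)
      h1.differentiableAt a).trans ?_
    rw [h1.fderiv]
    simp only [add_apply, ContinuousLinearMap.comp_apply, ContinuousLinearMap.flip_apply, ← hz₀]
    ring
  have hWx : (W x : 𝔼) = W' z₀ := by
    have h1 : ∀ y : M, y = x → (W y : 𝔼) = W' z₀ → (W x : 𝔼) = W' z₀ := by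
      rintro y rfl h
      exact h
    refine h1 _ (extChartAt_to_inv x) (hW.self_of_nhds.trans ?_)
    rw [frame_self]
    rfl
  have hx : ∀ a : 𝔼, FiberBundle.extend 𝔼 (E := TangentSpace (𝓡 m)) (x := x) a x = a := fun a =>
    FiberBundle.extend_apply_self (F := 𝔼) (E := TangentSpace (𝓡 m)) (x := x) a
  have hI : ∀ {a b a' b' : 𝔼}, a = a' → b = b' → tangentInner x a b = coordMetric x z₀ a' b' := by
    rintro a b a' b' rfl rfl
    exact (coordMetric_self x a b).symm
  have hM : ∀ {L : 𝔼 →L[ℝ] ℝ} {a b : 𝔼} {r : ℝ}, L b = r → a = b → L a = r := by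
    rintro L a b r h rfl
    exact h
  have sum : ∀ {a b c d e f a' b' c' d' e' f' : ℝ}, a = a' → b = b' → c = c' → d = d' → e = e' →
      f = f' → (a + b - c + d - e + f) / 2 = (a' + b' - c' + d' - e' + f') / 2 := by
    rintro a b c d e f _ _ _ _ _ _ rfl rfl rfl rfl rfl rfl
    rfl
  have hc := fun a : 𝔼 => differentiableAt_const (𝕜 := ℝ) (x := z₀) a
  -- The six Koszul terms in coordinates. The bracket of the two constant fields vanishes, [W, ζ] =
  -- -DW'(ζ) cancels the derivative of W' in the third term, and [v, W] doubles the one in the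
  -- first.
  refine (sum (hM (hD v hW (hv ζ) hd (hc ζ)) (hx v))
    (hM (hD (W' z₀) (hv ζ) (hv v) (hc ζ) (hc v)) hWx)
    (hM (hD ζ (hv v) hW (hc v) hd) (hx ζ))
    (hI (mlieBracket_eq_of_eventuallyEq (hv v) hW) (hx ζ))
    (hI (mlieBracket_eq_of_eventuallyEq hW (hv ζ)) (hx v))
    (hI (mlieBracket_eq_of_eventuallyEq (hv ζ) (hv v)) hWx)).trans ?_
  have hsm := coordMetric_symm x z₀
  rw [← hz₀]
  simp only [fderiv_fun_const, Pi.zero_apply, zero_apply, map_zero, add_zero, sub_zero, zero_sub,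
    map_neg, neg_apply]
  rw [hsm v (fderiv ℝ W' z₀ ζ)]
  ring

end Koszul

/-! ### Linear algebra of Riemannian submersions -/

section LinearSubmersion

variable {F : Type*} [NormedAddCommGroup F] [InnerProductSpace ℝ F] [FiniteDimensional ℝ F]

theorem inner_rieszVector (l : F →L[ℝ] ℝ) (v : F) : inner ℝ (rieszVector l) v = l v :=
  haveI : CompleteSpace F := FiniteDimensional.complete ℝ F
  InnerProductSpace.toDual_symm_apply

/-- The Koszul expression is not visibly linear in its last vector, so linearity enters as agreement
with some linear form; expanding v in the basis then suffices. -/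
theorem inner_vectorOfInner {l : F → ℝ} (L : F →ₗ[ℝ] ℝ) (hL : ∀ v, l v = L v) (v : F) :
    inner ℝ (vectorOfInner l) v = l v := by
  conv_rhs => rw [hL, ← (stdOrthonormalBasis ℝ F).sum_repr v]
  simp only [vectorOfInner, sum_inner, inner_smul_left, map_sum, map_smul, smul_eq_mul, hL,
    OrthonormalBasis.repr_apply_apply]
  exact Finset.sum_congr rfl fun i _ => by simp [mul_comm]

variable {V : Type*} [NormedAddCommGroup V] [NormedSpace ℝ V] {D : F →L[ℝ] ℝ × V}
  {β : V →L[ℝ] V →L[ℝ] ℝ}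

theorem exists_mem_orthogonal_ker (D : F →L[ℝ] ℝ × V) (u : F) :
    ∃ k ∈ LinearMap.ker D.toLinearMap, ∃ h ∈ (LinearMap.ker D.toLinearMap)ᗮ, u = k + h ∧
      D u = D h := by
  refine ⟨(LinearMap.ker D.toLinearMap).starProjection u, Submodule.starProjection_apply_mem _ _,
    u - (LinearMap.ker D.toLinearMap).starProjection u,
    Submodule.sub_starProjection_mem_orthogonal _,
    by abel, ?_⟩
  have h : D ((LinearMap.ker D.toLinearMap).starProjection u) = 0 :=
    Submodule.starProjection_apply_mem (LinearMap.ker D.toLinearMap) u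
  rw [map_sub, h, sub_zero]

variable (hs : ∀ a b, β a b = β b a)
  (hlen : ∀ v ∈ (LinearMap.ker D.toLinearMap)ᗮ,
    (D v).1 * (D v).1 + β (D v).2 (D v).2 = ‖v‖ ^ 2)
include hs hlen

/-- Polarization of the length condition. Only one vector has to be horizontal, because the vertical
part of the other is killed by D and orthogonal to the first. -/
theorem inner_eq_of_mem_orthogonal (u : F) {v : F} (hv : v ∈ (LinearMap.ker D.toLinearMap)ᗮ) :
    (D u).1 * (D v).1 + β (D u).2 (D v).2 = inner ℝ u v := by
  obtain ⟨k, hk, h, hh, rfl, hD⟩ := exists_mem_orthogonal_ker D u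
  have h0 : inner ℝ k v = 0 := hv k hk
  rw [hD, inner_add_left, h0, zero_add]
  have h1 := hlen _ (Submodule.add_mem _ hh hv)
  have h2 := hlen _ hh
  have h3 := hlen _ hv
  rw [norm_add_sq_real] at h1
  simp only [map_add, add_apply, Prod.fst_add, Prod.snd_add] at h1
  have h4 := hs (D v).2 (D h).2
  linarith

omit hs in
-- The pulled-back form sees only the horizontal part. With equality on horizontal vectors, this
-- makes such a vector a minimum of the difference of the two forms, as used in
-- `lieDerivForm_horizontal`.
theorem add_le_inner_self (u : F) :
    (D u).1 * (D u).1 + β (D u).2 (D u).2 ≤ inner ℝ u u := by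
  obtain ⟨k, hk, h, hh, rfl, hD⟩ := exists_mem_orthogonal_ker D u
  rw [hD, hlen _ hh, real_inner_self_eq_norm_sq, norm_add_sq_real]
  have h0 : inner ℝ k h = 0 := hh k hk
  rw [h0]
  nlinarith [sq_nonneg ‖k‖]

/-- The horizontal lift of (1, 0) represents the first component of D, because D is isometric on
horizontal vectors and (1, 0) is dual to that component. Hence the gradient of f is the horizontal
lift of ∂_t. -/
theorem rieszVector_fst_properties (hD : Function.Surjective D) :
    rieszVector ((ContinuousLinearMap.fst ℝ ℝ V).comp D) ∈ (LinearMap.ker D.toLinearMap)ᗮ ∧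
      D (rieszVector ((ContinuousLinearMap.fst ℝ ℝ V).comp D)) = (1, 0) := by
  obtain ⟨u, hu⟩ := hD (1, 0)
  obtain ⟨k, hk, h, hh, rfl, hDh⟩ := exists_mem_orthogonal_ker D u
  have : h = rieszVector ((ContinuousLinearMap.fst ℝ ℝ V).comp D) := by
    refine ext_inner_left ℝ fun v => ?_
    rw [← inner_eq_of_mem_orthogonal hs hlen v hh, real_inner_comm, inner_rieszVector, ← hDh, hu]
    simp
  rw [← this, ← hDh]
  exact ⟨hh, hu⟩

end LinearSubmersion

/-! ### Maps and gradients in charts -/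

section Charts

variable {m : ℕ} {M : Type*} [TopologicalSpace M] [ChartedSpace (EuclideanSpace ℝ (Fin m)) M]
  [IsManifold (𝓡 m) ∞ M]

local notation "𝔼" => EuclideanSpace ℝ (Fin m)

section Maps

variable {d : ℕ} {N : Type*} [TopologicalSpace N] [ChartedSpace (EuclideanSpace ℝ (Fin d)) N]
  [IsManifold (𝓡 d) ∞ N]

/-- The map `q` read in the charts at `x` and `y`. -/
def readMap (q : M → N) (x : M) (y : N) (z : 𝔼) : EuclideanSpace ℝ (Fin d) :=
  extChartAt (𝓡 d) y (q ((extChartAt (𝓡 m) x).symm z))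

/-- The domain of `readMap`. -/
def readDomain (q : M → N) (x : M) (y : N) : Set 𝔼 :=
  (extChartAt (𝓡 m) x).target ∩
    (fun z => q ((extChartAt (𝓡 m) x).symm z)) ⁻¹' (extChartAt (𝓡 d) y).source

variable {q : M → N} (hq : ContMDiff (𝓡 m) (𝓡 d) ∞ q)
include hq

omit [IsManifold (𝓡 m) ∞ M] [IsManifold (𝓡 d) ∞ N] in
theorem isOpen_readDomain (x : M) (y : N) : IsOpen (readDomain (m := m) (d := d) q x y) :=
  (hq.continuous.comp_continuousOn (continuousOn_extChartAt_symm x)).isOpen_inter_preimage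
    (isOpen_extChartAt_target x) (isOpen_extChartAt_source y)

theorem contDiffOn_readMap (x : M) (y : N) :
    ContDiffOn ℝ ∞ (readMap (m := m) (d := d) q x y)
      (readDomain (m := m) (d := d) q x y) := by
  rw [← contMDiffOn_iff_contDiffOn]
  exact ((contMDiffOn_extChartAt (x := y)).mono (by simp)).comp
    (hq.comp_contMDiffOn ((contMDiffOn_extChartAt_symm x).mono inter_subset_left)) fun z hz => hz.2

theorem frame_readMap {x : M} {y : N} {z : 𝔼} (hz : z ∈ readDomain (d := d) q x y) (v : 𝔼) :
    @Eq (EuclideanSpace ℝ (Fin d)) (frame y (readMap q x y z) (fderiv ℝ (readMap q x y) z v))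
      (mfderiv (𝓡 m) (𝓡 d) q ((extChartAt (𝓡 m) x).symm z) (frame x z v)) := by
  have hD := (isOpen_readDomain hq x y).mem_nhds hz
  have ht : readMap q x y z ∈ (extChartAt (𝓡 d) y).target := (extChartAt (𝓡 d) y).map_source hz.2
  have h1 : (q ∘ (extChartAt (𝓡 m) x).symm) =ᶠ[𝓝 z]
      (extChartAt (𝓡 d) y).symm ∘ readMap q x y := by
    filter_upwards [hD] with a ha using ((extChartAt (𝓡 d) y).left_inv ha.2).symm
  have h2 : MDifferentiableAt 𝓘(ℝ, 𝔼) 𝓘(ℝ, EuclideanSpace ℝ (Fin d)) (readMap q x y) z :=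
    (((contDiffOn_readMap hq x y).contDiffAt hD).differentiableAt (by simp)).mdifferentiableAt
  have h3 := mfderiv_comp z (mdifferentiableAt_symm ht) h2
  have h4 := mfderiv_comp z ((hq.contMDiffAt (x := (extChartAt (𝓡 m) x).symm z)).mdifferentiableAt
    (by simp)) (mdifferentiableAt_symm hz.1)
  rw [← h1.mfderiv_eq, mfderiv_eq_fderiv, h4] at h3
  exact (congrArg (fun L : 𝔼 →L[ℝ] EuclideanSpace ℝ (Fin d) => L v) h3).symm

end Maps

theorem contDiffOn_comp_symm {f : M → ℝ} {k : WithTop ℕ∞} (hk : k ≤ (∞ : ℕ∞ω))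
    (hf : ContMDiff (𝓡 m) 𝓘(ℝ, ℝ) k f) (x : M) :
    ContDiffOn ℝ k (fun z => f ((extChartAt (𝓡 m) x).symm z)) (extChartAt (𝓡 m) x).target := by
  rw [← contMDiffOn_iff_contDiffOn]
  exact hf.comp_contMDiffOn ((contMDiffOn_extChartAt_symm x).of_le hk)

variable [RiemannianBundle (fun x : M => TangentSpace (𝓡 m) x)]

/-- The gradient of `f` in the chart at `x`. -/
def coordGradient (f : M → ℝ) (x : M) (z : 𝔼) : 𝔼 :=
  (coordMetric x z).inverse (fderiv ℝ (fun y => f ((extChartAt (𝓡 m) x).symm y)) z)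

theorem coordMetric_coordGradient (f : M → ℝ) {x : M} {z : 𝔼}
    (hz : z ∈ (extChartAt (𝓡 m) x).target) (v : 𝔼) :
    coordMetric x z (coordGradient f x z) v =
      fderiv ℝ (fun y => f ((extChartAt (𝓡 m) x).symm y)) z v := by
  rw [coordGradient, (isInvertible_of_pos (coordMetric_pos hz)).self_apply_inverse]

/-- The gradient, read on the underlying model space. -/
def gradientVec (f : M → ℝ) (y : M) : 𝔼 :=
  gradient f y

omit [IsManifold (𝓡 m) ∞ M] in
theorem tangentInner_gradient (f : M → ℝ) (y : M) (v : 𝔼) :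
    @Eq ℝ (tangentInner y (gradientVec f y) v) (mfderiv (𝓡 m) 𝓘(ℝ, ℝ) f y v) :=
  inner_rieszVector (F := TangentSpace (𝓡 m) y) _ v

theorem frame_coordGradient {f : M → ℝ} {x : M} {z : 𝔼} (hz : z ∈ (extChartAt (𝓡 m) x).target)
    (hf : MDifferentiableAt (𝓡 m) 𝓘(ℝ, ℝ) f ((extChartAt (𝓡 m) x).symm z)) :
    frame x z (coordGradient f x z) = gradientVec f ((extChartAt (𝓡 m) x).symm z) := by
  refine ext_inner_right ℝ (E := TangentSpace (𝓡 m) ((extChartAt (𝓡 m) x).symm z)) fun v => ?_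
  obtain ⟨w, hw⟩ := (frameEquiv hz).surjective v
  have h1 := coordMetric_coordGradient f hz w
  have h2 := tangentInner_gradient f ((extChartAt (𝓡 m) x).symm z) (frame x z w)
  have h3 := mfderiv_frame hz hf w
  have h4 : tangentInner ((extChartAt (𝓡 m) x).symm z) (frame x z (coordGradient f x z))
      (frame x z w) = tangentInner ((extChartAt (𝓡 m) x).symm z)
      (gradientVec f ((extChartAt (𝓡 m) x).symm z)) (frame x z w) :=
    h1.trans (h3.symm.trans h2.symm)
  rw [← hw]
  exact h4

theorem transition_coordGradient {f : M → ℝ} (hf : MDifferentiable (𝓡 m) 𝓘(ℝ, ℝ) f) {x x' : M}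
    {z : 𝔼} (hz : z ∈ (extChartAt (𝓡 m) x).target)
    (hz' : (extChartAt (𝓡 m) x).symm z ∈ (extChartAt (𝓡 m) x').source) :
    fderiv ℝ (transition x x') z (coordGradient f x z) =
      coordGradient f x' (transition x x' z) := by
  have ht : transition x x' z ∈ (extChartAt (𝓡 m) x').target := (extChartAt (𝓡 m) x').map_source hz'
  refine (frameEquiv ht).injective ?_
  rw [frameEquiv_apply, frameEquiv_apply, frame_transition hz hz', frame_coordGradient hz (hf _),
    frame_coordGradient ht (hf _), transition_symm_eq hz']

variable [IsContMDiffRiemannianBundle (𝓡 m) ∞ (EuclideanSpace ℝ (Fin m))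
  (fun x : M => TangentSpace (𝓡 m) x)]

theorem contDiffOn_coordGradient {f : M → ℝ} (hf : ContMDiff (𝓡 m) 𝓘(ℝ, ℝ) ∞ f) (x : M) :
    ContDiffOn ℝ ∞ (coordGradient f x) (extChartAt (𝓡 m) x).target := fun z hz => by
  have hn := (isOpen_extChartAt_target (I := 𝓡 m) x).mem_nhds hz
  have h1 : ContDiffAt ℝ ∞ (fun y => (coordMetric x y).inverse) z :=
    (isInvertible_of_pos (coordMetric_pos hz)).contDiffAt_map_inverse.comp z
      ((contDiffOn_coordMetric x).contDiffAt hn)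
  have h2 : ContDiffAt ℝ ∞ (fderiv ℝ fun y => f ((extChartAt (𝓡 m) x).symm y)) z :=
    ((contDiffOn_comp_symm le_rfl hf x).contDiffAt hn).fderiv_right (m := (∞ : ℕ∞ω)) (by simp)
  exact (h1.clm_apply h2).contDiffWithinAt

end Charts

/-! ### The divergence of the gradient of the first coordinate of a submersion -/

section Submersion

variable {m d : ℕ} {M : Type*} [TopologicalSpace M] [ChartedSpace (EuclideanSpace ℝ (Fin m)) M]
  [IsManifold (𝓡 m) ∞ M]
  {N : Type*} [TopologicalSpace N] [ChartedSpace (EuclideanSpace ℝ (Fin d)) N]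
  [IsManifold (𝓡 d) ∞ N]

local notation "𝔼" => EuclideanSpace ℝ (Fin m)
local notation "𝔼d" => EuclideanSpace ℝ (Fin d)

section Maps

variable {proj : M → ℝ × N} (hp : ContMDiff (𝓡 m) (𝓘(ℝ, ℝ).prod (𝓡 d)) ∞ proj)

variable (d) in
/-- The differential of a map to a product, read on the underlying model spaces. -/
def projDeriv (proj : M → ℝ × N) (y : M) : 𝔼 →L[ℝ] ℝ × 𝔼d :=
  mfderiv (𝓡 m) (𝓘(ℝ, ℝ).prod (𝓡 d)) proj y

include hp

omit [IsManifold (𝓡 m) ∞ M] [IsManifold (𝓡 d) ∞ N] in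
theorem contMDiff_fst_comp : ContMDiff (𝓡 m) 𝓘(ℝ, ℝ) ∞ fun y => (proj y).1 :=
  contMDiff_fst.comp hp

omit [IsManifold (𝓡 m) ∞ M] [IsManifold (𝓡 d) ∞ N] in
theorem contMDiff_snd_comp : ContMDiff (𝓡 m) (𝓡 d) ∞ fun y => (proj y).2 :=
  contMDiff_snd.comp hp

omit [IsManifold (𝓡 m) ∞ M] [IsManifold (𝓡 d) ∞ N] in
theorem projDeriv_apply (y : M) (v : 𝔼) : projDeriv d proj y v =
    Prod.mk (α := ℝ) (β := 𝔼d) (mfderiv (𝓡 m) 𝓘(ℝ, ℝ) (fun y => (proj y).1) y v)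
      (mfderiv (𝓡 m) (𝓡 d) (fun y => (proj y).2) y v) :=
  congrArg (fun L : 𝔼 →L[ℝ] ℝ × 𝔼d => L v)
    (mfderiv_prodMk ((contMDiff_fst_comp hp y).mdifferentiableAt (by simp))
      ((contMDiff_snd_comp hp y).mdifferentiableAt (by simp)))

/-- The differential of `proj` in charts. -/
def coordDeriv (_ : ContMDiff (𝓡 m) (𝓘(ℝ, ℝ).prod (𝓡 d)) ∞ proj) (x : M) (y : N) (z : 𝔼) :
    𝔼 →L[ℝ] ℝ × 𝔼d :=
  (fderiv ℝ (fun z => (proj ((extChartAt (𝓡 m) x).symm z)).1) z).prod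
    (fderiv ℝ (readMap (fun y => (proj y).2) x y) z)

theorem projDeriv_frame {x : M} {y : N} {z : 𝔼}
    (hz : z ∈ readDomain (d := d) (fun y => (proj y).2) x y) (v : 𝔼) :
    projDeriv d proj ((extChartAt (𝓡 m) x).symm z) (frame x z v) =
      ((coordDeriv hp x y z v).1,
        frame y (readMap (fun y => (proj y).2) x y z) (coordDeriv hp x y z v).2) := by
  rw [projDeriv_apply hp]
  refine Prod.ext ?_ ?_
  · exact mfderiv_frame hz.1 ((contMDiff_fst_comp hp _).mdifferentiableAt (by simp)) v
  · exact (frame_readMap (contMDiff_snd_comp hp) hz v).symm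

omit [IsManifold (𝓡 m) ∞ M] [IsManifold (𝓡 d) ∞ N] hp in
theorem readMap_mem_target {x : M} {y : N} {z : 𝔼}
    (hz : z ∈ readDomain (d := d) (fun y => (proj y).2) x y) :
    readMap (fun y => (proj y).2) x y z ∈ (extChartAt (𝓡 d) y).target :=
  (extChartAt (𝓡 d) y).map_source hz.2

theorem coordDeriv_eq_zero_iff {x : M} {y : N} {z : 𝔼}
    (hz : z ∈ readDomain (d := d) (fun y => (proj y).2) x y) (v : 𝔼) :
    coordDeriv hp x y z v = 0 ↔
      projDeriv d proj ((extChartAt (𝓡 m) x).symm z) (frame x z v) = 0 := by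
  rw [projDeriv_frame hp hz, Prod.ext_iff, Prod.ext_iff]
  have h := (frameEquiv (readMap_mem_target hz)).map_eq_zero_iff (x := (coordDeriv hp x y z v).2)
  rw [frameEquiv_apply] at h
  simp only [Prod.fst_zero, Prod.snd_zero, h]

theorem coordDeriv_surjective {x : M} {y : N} {z : 𝔼}
    (hz : z ∈ readDomain (d := d) (fun y => (proj y).2) x y)
    (hs : Function.Surjective (projDeriv (m := m) d proj ((extChartAt (𝓡 m) x).symm z))) :
    Function.Surjective (coordDeriv hp x y z) := fun a => by
  obtain ⟨u, hu⟩ := hs (a.1, frame y (readMap (fun y => (proj y).2) x y z) a.2)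
  obtain ⟨w, rfl⟩ := (frameEquiv hz.1).surjective u
  rw [frameEquiv_apply, projDeriv_frame hp hz] at hu
  obtain ⟨h1, h2⟩ := Prod.ext_iff.1 hu
  exact ⟨w, Prod.ext h1 ((frameEquiv (readMap_mem_target hz)).injective h2)⟩

theorem contDiffOn_coordDeriv (x : M) (y : N) :
    ContDiffOn ℝ ∞ (coordDeriv (m := m) (d := d) hp x y)
      (readDomain (m := m) (d := d) (fun y => (proj y).2) x y) := by
  refine contDiffOn_clm_apply.2 fun v z hz => ?_
  have hn := (isOpen_readDomain (contMDiff_snd_comp hp) x y).mem_nhds hz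
  have h1 : ContDiffAt ℝ ∞ (fderiv ℝ fun z => (proj ((extChartAt (𝓡 m) x).symm z)).1) z :=
    ((contDiffOn_comp_symm le_rfl (contMDiff_fst_comp hp) x).contDiffAt
      ((isOpen_extChartAt_target x).mem_nhds hz.1)).fderiv_right (m := (∞ : ℕ∞ω)) (by simp)
  have h2 : ContDiffAt ℝ ∞ (fderiv ℝ (readMap (m := m) (d := d) (fun y => (proj y).2) x y)) z :=
    ((contDiffOn_readMap (contMDiff_snd_comp hp) x y).contDiffAt hn).fderiv_right
      (m := (∞ : ℕ∞ω)) (by simp)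
  exact ((h1.clm_apply contDiffAt_const).prodMk (h2.clm_apply contDiffAt_const)).contDiffWithinAt

end Maps

variable [RiemannianBundle (fun x : M => TangentSpace (𝓡 m) x)]
  {g₀ : ContMDiffRiemannianMetric (𝓡 d) ∞ (EuclideanSpace ℝ (Fin d))
    (fun x : N => TangentSpace (𝓡 d) x)}
  {ρ : ℝ → ℝ} {proj : M → ℝ × N}
  (hproj : IsRiemannianSubmersion (m := m) (warpedMetric g₀ ρ) proj)

variable (g₀ ρ) in
/-- The fiber part of the warped product metric. -/
def fiberInner (y : ℝ × N) : 𝔼d →L[ℝ] 𝔼d →L[ℝ] ℝ :=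
  Real.exp (2 * ρ y.1) • (g₀.inner y.2 : 𝔼d →L[ℝ] 𝔼d →L[ℝ] ℝ)

include hproj

omit [IsManifold (𝓡 m) ∞ M] in
theorem submersion_length (x : M) (v : TangentSpace (𝓡 m) x)
    (hv : v ∈ (vertical (m := m) (𝓘(ℝ, ℝ).prod (𝓡 d)) proj x)ᗮ) :
    (projDeriv d proj x v).1 * (projDeriv d proj x v).1 +
      fiberInner g₀ ρ (proj x) (projDeriv d proj x v).2 (projDeriv d proj x v).2 = ‖v‖ ^ 2 :=
  hproj.length_horizontal x v hv

omit [IsManifold (𝓡 m) ∞ M] [RiemannianBundle fun x : M ↦ TangentSpace (𝓡 m) x] hproj in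
theorem fiberInner_symm (y : ℝ × N) (a b : 𝔼d) : fiberInner g₀ ρ y a b = fiberInner g₀ ρ y b a := by
  have := g₀.symm y.2 a b
  exact congrArg (fun r => Real.exp (2 * ρ y.1) * r) this

omit [IsManifold (𝓡 m) ∞ M] in
theorem submersion_inner (x : M) (u : 𝔼) {v : 𝔼}
    (hv : v ∈ (vertical (m := m) (𝓘(ℝ, ℝ).prod (𝓡 d)) proj x)ᗮ) :
    (projDeriv d proj x u).1 * (projDeriv d proj x v).1 +
      fiberInner g₀ ρ (proj x) (projDeriv d proj x u).2 (projDeriv d proj x v).2 =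
      tangentInner x u v :=
  inner_eq_of_mem_orthogonal (F := TangentSpace (𝓡 m) x) (D := projDeriv d proj x)
    (fiberInner_symm _) (submersion_length hproj x) u hv

omit [IsManifold (𝓡 m) ∞ M] in
theorem submersion_le (x : M) (u : 𝔼) :
    (projDeriv d proj x u).1 * (projDeriv d proj x u).1 +
      fiberInner g₀ ρ (proj x) (projDeriv d proj x u).2 (projDeriv d proj x u).2 ≤
      tangentInner x u u :=
  add_le_inner_self (F := TangentSpace (𝓡 m) x) (D := projDeriv d proj x)
    (submersion_length hproj x) u

omit [IsManifold (𝓡 m) ∞ M] in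
theorem submersion_gradient (x : M) :
    gradientVec (m := m) (fun y => (proj y).1) x ∈
      (vertical (m := m) (𝓘(ℝ, ℝ).prod (𝓡 d)) proj x)ᗮ ∧
    projDeriv d proj x (gradientVec (m := m) (fun y => (proj y).1) x) = (1, 0) := by
  have h := rieszVector_fst_properties (F := TangentSpace (𝓡 m) x) (D := projDeriv d proj x)
    (fiberInner_symm _) (submersion_length hproj x) (hproj.mfderiv_surjective x)
  have h1 : gradientVec (m := m) (fun y => (proj y).1) x = rieszVector (F := TangentSpace (𝓡 m) x)
      ((ContinuousLinearMap.fst ℝ ℝ 𝔼d).comp (projDeriv d proj x)) := by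
    unfold gradientVec gradient
    congr 1
    exact ContinuousLinearMap.ext fun v => (congrArg Prod.fst
      (projDeriv_apply hproj.contMDiff x v)).symm
  rw [h1]
  exact h

omit [IsManifold (𝓡 m) ∞ M] in
theorem tangentInner_gradient_self (x : M) :
    tangentInner x (gradientVec (m := m) (fun y => (proj y).1) x)
      (gradientVec (m := m) (fun y => (proj y).1) x) = 1 := by
  obtain ⟨h1, h2⟩ := submersion_gradient hproj x
  rw [← submersion_inner hproj x _ h1, h2]
  simp

end Submersion

/-! ### Vertical directions: the second fundamental form of the fibers. -/

section Curvature

variable {m d : ℕ} {M : Type*} [TopologicalSpace M] [ChartedSpace (EuclideanSpace ℝ (Fin m)) M]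
  [IsManifold (𝓡 m) ∞ M]
  {N : Type*} [TopologicalSpace N] [ChartedSpace (EuclideanSpace ℝ (Fin d)) N]
  [IsManifold (𝓡 d) ∞ N]
  [RiemannianBundle (fun x : M => TangentSpace (𝓡 m) x)]
  [IsContMDiffRiemannianBundle (𝓡 m) ∞ (EuclideanSpace ℝ (Fin m))
    (fun x : M => TangentSpace (𝓡 m) x)]
  {g₀ : ContMDiffRiemannianMetric (𝓡 d) ∞ (EuclideanSpace ℝ (Fin d))
    (fun x : N => TangentSpace (𝓡 d) x)}
  {ρ : ℝ → ℝ} {proj : M → ℝ × N}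

local notation "𝔼" => EuclideanSpace ℝ (Fin m)
local notation "𝔼d" => EuclideanSpace ℝ (Fin d)

omit [IsManifold (𝓡 m) ∞ M] [IsManifold (𝓡 d) ∞ N]
  [RiemannianBundle (fun x : M => TangentSpace (𝓡 m) x)]
  [IsContMDiffRiemannianBundle (𝓡 m) ∞ (EuclideanSpace ℝ (Fin m))
    (fun x : M => TangentSpace (𝓡 m) x)] in
theorem readDomain_mem_nhds (hp : ContMDiff (𝓡 m) (𝓘(ℝ, ℝ).prod (𝓡 d)) ∞ proj) (x : M) :
    readDomain (m := m) (d := d) (fun y => (proj y).2) x (proj x).2 ∈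
      𝓝 (extChartAt (𝓡 m) x x) := by
  refine (isOpen_readDomain (contMDiff_snd_comp hp) x _).mem_nhds
    ⟨mem_extChartAt_target x, ?_⟩
  simp only [mem_preimage, extChartAt_to_inv]
  exact mem_extChartAt_source _

omit [IsContMDiffRiemannianBundle (𝓡 m) ∞ (EuclideanSpace ℝ (Fin m))
    (fun x : M => TangentSpace (𝓡 m) x)] in
/-- The vertical part of a field of constant coefficients in a chart. -/
theorem verticalPart_frame (hproj : IsRiemannianSubmersion (m := m) (warpedMetric g₀ ρ) proj)
    {x : M} {y : N} {z : 𝔼} (hz : z ∈ readDomain (d := d) (fun y => (proj y).2) x y) (v : 𝔼) :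
    verticalPart (m := m) (𝓘(ℝ, ℝ).prod (𝓡 d)) proj ((extChartAt (𝓡 m) x).symm z)
      (frame x z v) =
      frame x z (v - horizontalProj (coordMetric x z) (coordDeriv hproj.contMDiff x y z) v) := by
  have hsurj := coordDeriv_surjective hproj.contMDiff hz
    (hproj.mfderiv_surjective ((extChartAt (𝓡 m) x).symm z))
  have hpos := coordMetric_pos hz.1
  -- The candidate is identified by two properties: it lies in the kernel of the differential, and
  -- its difference from the given vector is orthogonal to that kernel.
  refine Submodule.eq_starProjection_of_mem_orthogonal
    (E := TangentSpace (𝓡 m) ((extChartAt (𝓡 m) x).symm z)) ?_ ?_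
  · refine (coordDeriv_eq_zero_iff hproj.contMDiff hz _).1 ?_
    rw [map_sub, apply_horizontalProj hpos hsurj, sub_self]
  · intro k hk
    obtain ⟨w, rfl⟩ := (frameEquiv hz.1).surjective k
    have hw : coordDeriv hproj.contMDiff x y z w = 0 :=
      (coordDeriv_eq_zero_iff hproj.contMDiff hz _).2 hk
    have h1 : frame x z v - frame x z (v - horizontalProj (coordMetric x z)
        (coordDeriv hproj.contMDiff x y z) v) = frame x z (horizontalProj (coordMetric x z)
        (coordDeriv hproj.contMDiff x y z) v) := by
      rw [← map_sub, sub_sub_cancel]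
    have h2 : coordMetric x z w (horizontalProj (coordMetric x z)
        (coordDeriv hproj.contMDiff x y z) v) = 0 := by
      rw [coordMetric_symm]
      exact horizontalProj_orthogonal hpos _ v hw
    rw [coordMetric_apply, ← h1] at h2
    exact h2

/-- The second fundamental form of the fibers in the direction of the gradient of the first
coordinate. -/
theorem tangentInner_secondFundamentalForm
    (hproj : IsRiemannianSubmersion (m := m) (warpedMetric g₀ ρ) proj) (x : M) {v : 𝔼}
    (hv : v ∈ vertical (m := m) (𝓘(ℝ, ℝ).prod (𝓡 d)) proj x) :
    tangentInner (m := m) x (secondFundamentalForm (m := m) (𝓘(ℝ, ℝ).prod (𝓡 d)) proj x v v)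
      (gradientVec (m := m) (fun y => (proj y).1) x) =
    -lieDerivForm (coordMetric x) (coordGradient (m := m) (fun y => (proj y).1) x)
      (extChartAt (𝓡 m) x x) v / 2 := by
  set z₀ := extChartAt (𝓡 m) x x with hz₀
  set f : M → ℝ := fun y => (proj y).1 with hf
  set G := coordMetric (m := m) x with hG
  set X := coordGradient (m := m) f x with hX
  have hU := readDomain_mem_nhds hproj.contMDiff x
  set U := readDomain (m := m) (d := d) (fun y => (proj y).2) x (proj x).2 with hUdef
  have hzU : z₀ ∈ U := mem_of_mem_nhds hU
  set W' : 𝔼 → 𝔼 := fun z =>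
    v - horizontalProj (G z) (coordDeriv hproj.contMDiff x (proj x).2 z) v with hW'
  have hfs := contMDiff_fst_comp hproj.contMDiff
  have hW : ∀ᶠ z in 𝓝 z₀, verticalPart (m := m) (𝓘(ℝ, ℝ).prod (𝓡 d)) proj
      ((extChartAt (𝓡 m) x).symm z) (FiberBundle.extend 𝔼 (E := TangentSpace (𝓡 m)) (x := x) v
        ((extChartAt (𝓡 m) x).symm z)) = frame x z (W' z) := by
    filter_upwards [hU] with z hz
    exact (congrArg (verticalPart (m := m) (𝓘(ℝ, ℝ).prod (𝓡 d)) proj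
      ((extChartAt (𝓡 m) x).symm z)) (extend_eq_frame x v hz.1)).trans
      (verticalPart_frame hproj hz v)
  have htn := (isOpen_extChartAt_target (I := 𝓡 m) x).mem_nhds hzU.1
  have hd : DifferentiableAt ℝ W' z₀ := by
    have h1 : ContDiffAt ℝ ∞ (fun z => horizontalProj (G z)
        (coordDeriv hproj.contMDiff x (proj x).2 z)) z₀ :=
      contDiffAt_horizontalProj ((contDiffOn_coordMetric x).contDiffAt htn)
        ((contDiffOn_coordDeriv hproj.contMDiff x _).contDiffAt hU) (coordMetric_pos hzU.1)
        (coordDeriv_surjective hproj.contMDiff hzU (hproj.mfderiv_surjective _))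
    exact (differentiableAt_const v).sub ((h1.clm_apply
      contDiffAt_const).differentiableAt (by simp))
  have hWz : W' z₀ = v := by
    have h0 : coordDeriv hproj.contMDiff x (proj x).2 z₀ v = 0 := by
      refine (coordDeriv_eq_zero_iff hproj.contMDiff hzU v).2 ?_
      rw [hz₀, frame_self, extChartAt_to_inv]
      exact hv
    simp only [hW', horizontalProj, ContinuousLinearMap.comp_apply, h0, map_zero, sub_zero]
  have hXd : DifferentiableAt ℝ X z₀ :=
    ((contDiffOn_coordGradient hfs x).contDiffAt htn).differentiableAt (by simp)
  have hGd : DifferentiableAt ℝ G z₀ := differentiableAt_coordMetric hzU.1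
  have hsm := coordMetric_symm (m := m) x
  -- W' is vertical and X horizontal near the point, not only at it. Differentiating this identity
  -- along v exchanges the derivative of W' for that of X.
  have horth : ∀ᶠ z in 𝓝 z₀, G z (W' z) (X z) = 0 := by
    filter_upwards [hU] with z hz
    have h1 := verticalPart_frame hproj hz v
    have h2 := frame_coordGradient hz.1 ((hfs ((extChartAt (𝓡 m) x).symm z)).mdifferentiableAt
      (by simp))
    rw [hG, coordMetric_apply, h2]
    refine (submersion_gradient hproj ((extChartAt (𝓡 m) x).symm z)).1 _ ?_
    rw [hW', ← h1]
    exact Submodule.starProjection_apply_mem _ _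
  have hXx : X z₀ = gradientVec (m := m) f x := by
    have := frame_coordGradient hzU.1 ((hfs ((extChartAt (𝓡 m) x).symm z₀)).mdifferentiableAt
      (by simp))
    rw [hz₀, frame_self, extChartAt_to_inv] at this
    exact this
  have h1 := ((hGd.hasFDerivAt.clm_apply hd.hasFDerivAt).clm_apply hXd.hasFDerivAt)
  have h2 : HasFDerivAt (fun z => G z (W' z) (X z)) (0 : 𝔼 →L[ℝ] ℝ) z₀ :=
    (hasFDerivAt_const (0 : ℝ) z₀).congr_of_eventuallyEq horth
  have h3 := congrArg (fun L : 𝔼 →L[ℝ] ℝ => L v) (h1.unique h2)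
  simp only [add_apply, ContinuousLinearMap.comp_apply, ContinuousLinearMap.flip_apply, hWz,
    zero_apply] at h3
  have hDsm : fderiv ℝ G z₀ v (X z₀) v = fderiv ℝ G z₀ v v (X z₀) := by
    have h4 := (hGd.hasFDerivAt.clm_apply (hasFDerivAt_const (X z₀) z₀)).clm_apply
      (hasFDerivAt_const v z₀)
    have h5 := (hGd.hasFDerivAt.clm_apply (hasFDerivAt_const v z₀)).clm_apply
      (hasFDerivAt_const (X z₀) z₀)
    have h6 : (fun z => G z (X z₀) v) = fun z => G z v (X z₀) := funext fun z => hsm z _ _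
    rw [h6] at h4
    have h7 := congrArg (fun L : 𝔼 →L[ℝ] ℝ => L v) (h4.unique h5)
    simpa using h7
  -- The Koszul expression in coordinates, as a linear form in its last vector.
  set l : 𝔼 →ₗ[ℝ] ℝ :=
    ((1 / 2 : ℝ) • (fderiv ℝ G z₀ v v + (fderiv ℝ G z₀ v).flip v -
      ((fderiv ℝ G z₀).flip v).flip v) + G z₀ (fderiv ℝ W' z₀ v)).toLinearMap with hl
  have hkos : ∀ ζ : 𝔼, koszul (FiberBundle.extend 𝔼 (E := TangentSpace (𝓡 m)) (x := x) v)
      (fun y => verticalPart (m := m) (𝓘(ℝ, ℝ).prod (𝓡 d)) proj y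
        (FiberBundle.extend 𝔼 (E := TangentSpace (𝓡 m)) (x := x) v y))
      (FiberBundle.extend 𝔼 (E := TangentSpace (𝓡 m)) (x := x) ζ) x = l ζ := fun ζ => by
    rw [koszul_extend x v ζ hW hd, ← hz₀, hWz]
    simp only [hl, ← hG, ContinuousLinearMap.coe_coe, add_apply, sub_apply, smul_apply,
      ContinuousLinearMap.flip_apply, smul_eq_mul]
    ring
  set D : 𝔼 := leviCivita (m := m) x v fun y =>
    verticalPart (m := m) (𝓘(ℝ, ℝ).prod (𝓡 d)) proj y
      (FiberBundle.extend 𝔼 (E := TangentSpace (𝓡 m)) (x := x) v y) with hD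
  have hDl : tangentInner (m := m) x D (gradientVec (m := m) f x) =
      l (gradientVec (m := m) f x) :=
    (inner_vectorOfInner (F := TangentSpace (𝓡 m) x) l hkos _).trans (hkos _)
  have hvert : tangentInner (m := m) x
      (verticalPart (m := m) (𝓘(ℝ, ℝ).prod (𝓡 d)) proj x D) (gradientVec (m := m) f x) = 0 :=
    (submersion_gradient hproj x).1 _ (Submodule.starProjection_apply_mem _ _)
  have hsub : tangentInner (m := m) x
      (secondFundamentalForm (m := m) (𝓘(ℝ, ℝ).prod (𝓡 d)) proj x v v)
      (gradientVec (m := m) f x) = tangentInner (m := m) x D (gradientVec (m := m) f x) -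
      tangentInner (m := m) x (verticalPart (m := m) (𝓘(ℝ, ℝ).prod (𝓡 d)) proj x D)
      (gradientVec (m := m) f x) :=
    inner_sub_left (E := TangentSpace (𝓡 m) x) D _ _
  -- Now l(X) = D_v G(v, X) - ½ D_X G(v, v) + G(DW' v, X), and by `h3` the first and last terms sum
  -- to -G(v, DX v).
  rw [hsub, hvert, hDl, ← hXx]
  simp only [lieDerivForm, hl, ContinuousLinearMap.coe_coe, add_apply, sub_apply, smul_apply,
      ContinuousLinearMap.flip_apply, smul_eq_mul]
  rw [hDsm, hsm z₀ (fderiv ℝ X z₀ v) v]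
  linarith

end Curvature

/-- A family of linear maps on a finite-dimensional space is differentiable if all its values
are. -/
theorem differentiableAt_of_clm_apply {D E F : Type*} [NormedAddCommGroup D] [NormedSpace ℝ D]
    [NormedAddCommGroup E] [NormedSpace ℝ E] [FiniteDimensional ℝ E] [NormedAddCommGroup F]
    [NormedSpace ℝ F] {f : D → E →L[ℝ] F} {x : D}
    (h : ∀ v, DifferentiableAt ℝ (fun y => f y v) x) : DifferentiableAt ℝ f x := by
  let e₁ := ContinuousLinearEquiv.ofFinrankEq (𝕜 := ℝ)
    (Module.finrank_fin_fun ℝ (n := Module.finrank ℝ E)).symm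
  let e₂ := (e₁.arrowCongr (1 : F ≃L[ℝ] F)).trans
    (ContinuousLinearEquiv.piRing (𝕜 := ℝ) (Fin (Module.finrank ℝ E)))
  exact e₂.comp_differentiableAt_iff.1 (differentiableAt_pi.2 fun i => h _)

/-! ### The warped product metric in coordinates -/

section WarpedCoordinates

variable {d : ℕ} {N : Type*} [TopologicalSpace N] [ChartedSpace (EuclideanSpace ℝ (Fin d)) N]
  [IsManifold (𝓡 d) ∞ N]
  (g₀ : ContMDiffRiemannianMetric (𝓡 d) ∞ (EuclideanSpace ℝ (Fin d))
    (fun x : N => TangentSpace (𝓡 d) x))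

local notation "𝔼d" => EuclideanSpace ℝ (Fin d)

/-- The metric `g₀` in the chart at `y`. -/
def baseMetric (y : N) (w : 𝔼d) : 𝔼d →L[ℝ] 𝔼d →L[ℝ] ℝ :=
  (g₀.inner ((extChartAt (𝓡 d) y).symm w) : 𝔼d →L[ℝ] 𝔼d →L[ℝ] ℝ).bilinearComp
    (frame y w) (frame y w)

theorem baseMetric_apply_of_eq {y a : N} {w : 𝔼d} (h : (extChartAt (𝓡 d) y).symm w = a)
    (u v : 𝔼d) : baseMetric g₀ y w u v =
      (g₀.inner a : 𝔼d →L[ℝ] 𝔼d →L[ℝ] ℝ) (frame y w u) (frame y w v) := by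
  subst h
  rfl

theorem contDiffOn_baseMetric (y : N) :
    ContDiffOn ℝ ∞ (baseMetric g₀ y) (extChartAt (𝓡 d) y).target := by
  -- With g₀ installed as the Riemannian structure of N, this becomes the smoothness of
  -- `coordMetric`.
  let _ : RiemannianBundle (fun x : N => TangentSpace (𝓡 d) x) := ⟨g₀.toRiemannianMetric⟩
  exact contDiffOn_coordMetric (m := d) y

/-- The warped product metric in the chart at `y` on the second factor. -/
def warpedCoordMetric (ρ : ℝ → ℝ) (y : N) (q : ℝ × 𝔼d) : (ℝ × 𝔼d) →L[ℝ] (ℝ × 𝔼d) →L[ℝ] ℝ :=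
  (ContinuousLinearMap.mul ℝ ℝ).bilinearComp (ContinuousLinearMap.fst ℝ ℝ 𝔼d)
      (ContinuousLinearMap.fst ℝ ℝ 𝔼d)
    + Real.exp (2 * ρ q.1) • (baseMetric g₀ y q.2).bilinearComp
      (ContinuousLinearMap.snd ℝ ℝ 𝔼d) (ContinuousLinearMap.snd ℝ ℝ 𝔼d)

theorem warpedCoordMetric_apply (ρ : ℝ → ℝ) (y : N) (q u w : ℝ × 𝔼d) :
    warpedCoordMetric g₀ ρ y q u w =
      u.1 * w.1 + Real.exp (2 * ρ q.1) * baseMetric g₀ y q.2 u.2 w.2 :=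
  rfl

variable {ρ : ℝ → ℝ} (hρ : ContDiff ℝ ∞ ρ)
include hρ

theorem differentiableAt_warpedCoordMetric {y : N} {q : ℝ × 𝔼d}
    (hq : q.2 ∈ (extChartAt (𝓡 d) y).target) :
    DifferentiableAt ℝ (warpedCoordMetric g₀ ρ y) q := by
  have h1 : DifferentiableAt ℝ (baseMetric g₀ y) q.2 :=
    ((contDiffOn_baseMetric g₀ y).contDiffAt
      ((isOpen_extChartAt_target (I := 𝓡 d) y).mem_nhds hq)).differentiableAt (by simp)
  have h2 : DifferentiableAt ℝ (fun q : ℝ × 𝔼d => baseMetric g₀ y q.2) q :=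
    (DifferentiableAt.comp (𝕜 := ℝ) (g := baseMetric g₀ y) (f := fun q : ℝ × 𝔼d => q.2) q h1
      (differentiableAt_snd (𝕜 := ℝ)) :)
  have h3 : Differentiable ℝ ρ := hρ.differentiable (by simp)
  have h4 : DifferentiableAt ℝ (fun q : ℝ × 𝔼d => Real.exp (2 * ρ q.1)) q := by fun_prop
  refine differentiableAt_of_clm_apply fun u => differentiableAt_of_clm_apply fun w => ?_
  simp only [warpedCoordMetric_apply]
  exact (differentiableAt_const _).add (h4.mul
    ((h2.clm_apply (differentiableAt_const _)).clm_apply (differentiableAt_const _)))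

/-- The Lie derivative of the warped product metric along the field of the first factor. -/
theorem lieDerivForm_warpedCoordMetric {y : N} {q : ℝ × 𝔼d}
    (hq : q.2 ∈ (extChartAt (𝓡 d) y).target) (u : ℝ × 𝔼d) :
    lieDerivForm (warpedCoordMetric g₀ ρ y) (fun _ => ((1 : ℝ), (0 : 𝔼d))) q u =
      2 * deriv ρ q.1 * (Real.exp (2 * ρ q.1) * baseMetric g₀ y q.2 u.2 u.2) := by
  -- The field is constant, so only the derivative of the coefficients in t remains, and only the
  -- factor e^{2ρ} depends on t.
  have h1 := (((differentiableAt_warpedCoordMetric g₀ hρ hq).hasFDerivAt.clm_apply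
    (hasFDerivAt_const u q)).clm_apply (hasFDerivAt_const u q))
  have h2 : HasDerivAt (fun s : ℝ => (s, q.2)) ((1 : ℝ), (0 : 𝔼d)) q.1 :=
    (hasDerivAt_id q.1).prodMk (hasDerivAt_const q.1 q.2)
  have h3 := HasFDerivAt.comp_hasDerivAt (x := q.1) (f := fun s : ℝ => (s, q.2)) h1 h2
  have h4 : HasDerivAt (fun s : ℝ => u.1 * u.1 + Real.exp (2 * ρ s) *
      baseMetric g₀ y q.2 u.2 u.2)
      (Real.exp (2 * ρ q.1) * (2 * deriv ρ q.1) * baseMetric g₀ y q.2 u.2 u.2) q.1 :=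
    ((((hρ.differentiable (by simp)).differentiableAt.hasDerivAt.const_mul 2).exp).mul_const
      _).const_add _
  have h5 := h3.unique h4
  simp at h5
  simp only [lieDerivForm, fderiv_fun_const, Pi.zero_apply, zero_apply, map_zero, add_zero]
  rw [h5]
  ring

end WarpedCoordinates

/-! ### Horizontal directions: comparison with the warped product. -/

section Horizontal

variable {m d : ℕ} {M : Type*} [TopologicalSpace M] [ChartedSpace (EuclideanSpace ℝ (Fin m)) M]
  [IsManifold (𝓡 m) ∞ M]
  {N : Type*} [TopologicalSpace N] [ChartedSpace (EuclideanSpace ℝ (Fin d)) N]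
  [IsManifold (𝓡 d) ∞ N]
  [RiemannianBundle (fun x : M => TangentSpace (𝓡 m) x)]
  {g₀ : ContMDiffRiemannianMetric (𝓡 d) ∞ (EuclideanSpace ℝ (Fin d))
    (fun x : N => TangentSpace (𝓡 d) x)}
  {ρ : ℝ → ℝ} {proj : M → ℝ × N}

local notation "𝔼" => EuclideanSpace ℝ (Fin m)
local notation "𝔼d" => EuclideanSpace ℝ (Fin d)

/-- `proj` read in charts of `M` and `N`. -/
def readProj (proj : M → ℝ × N) (x : M) (y : N) (z : 𝔼) : ℝ × 𝔼d :=
  ((proj ((extChartAt (𝓡 m) x).symm z)).1, readMap (fun y => (proj y).2) x y z)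

omit [RiemannianBundle (fun x : M => TangentSpace (𝓡 m) x)] in
theorem contDiffAt_readProj (hp : ContMDiff (𝓡 m) (𝓘(ℝ, ℝ).prod (𝓡 d)) ∞ proj) {x : M} {y : N}
    {z : 𝔼} (hz : z ∈ readDomain (d := d) (fun y => (proj y).2) x y) :
    ContDiffAt ℝ ∞ (readProj (d := d) proj x y) z :=
  ((contDiffOn_comp_symm le_rfl (contMDiff_fst_comp hp) x).contDiffAt
    ((isOpen_extChartAt_target x).mem_nhds hz.1)).prodMk
    ((contDiffOn_readMap (contMDiff_snd_comp hp) x y).contDiffAt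
      ((isOpen_readDomain (contMDiff_snd_comp hp) x y).mem_nhds hz))

omit [RiemannianBundle (fun x : M => TangentSpace (𝓡 m) x)] in
theorem fderiv_readProj (hp : ContMDiff (𝓡 m) (𝓘(ℝ, ℝ).prod (𝓡 d)) ∞ proj) {x : M} {y : N}
    {z : 𝔼} (hz : z ∈ readDomain (d := d) (fun y => (proj y).2) x y) :
    fderiv ℝ (readProj (d := d) proj x y) z = coordDeriv hp x y z :=
  (((contDiffOn_comp_symm le_rfl (contMDiff_fst_comp hp) x).contDiffAt
    ((isOpen_extChartAt_target x).mem_nhds hz.1)).differentiableAt (by simp)).fderiv_prodMk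
    (((contDiffOn_readMap (contMDiff_snd_comp hp) x y).contDiffAt
      ((isOpen_readDomain (contMDiff_snd_comp hp) x y).mem_nhds hz)).differentiableAt (by simp))

omit [RiemannianBundle (fun x : M => TangentSpace (𝓡 m) x)] in
/-- The pullback of the warped product metric, in charts and on tangent vectors. -/
theorem warpedCoordMetric_coordDeriv (hp : ContMDiff (𝓡 m) (𝓘(ℝ, ℝ).prod (𝓡 d)) ∞ proj) {x : M}
    {y : N} {z : 𝔼} (hz : z ∈ readDomain (d := d) (fun y => (proj y).2) x y) (v w : 𝔼) :
    warpedCoordMetric g₀ ρ y (readProj proj x y z) (coordDeriv hp x y z v)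
      (coordDeriv hp x y z w) =
    (projDeriv d proj ((extChartAt (𝓡 m) x).symm z) (frame x z v)).1 *
      (projDeriv d proj ((extChartAt (𝓡 m) x).symm z) (frame x z w)).1 +
    fiberInner g₀ ρ (proj ((extChartAt (𝓡 m) x).symm z))
      (projDeriv d proj ((extChartAt (𝓡 m) x).symm z) (frame x z v)).2
      (projDeriv d proj ((extChartAt (𝓡 m) x).symm z) (frame x z w)).2 := by
  have h : (extChartAt (𝓡 d) y).symm (readMap (fun y => (proj y).2) x y z) =
      (proj ((extChartAt (𝓡 m) x).symm z)).2 := (extChartAt (𝓡 d) y).left_inv hz.2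
  rw [projDeriv_frame hp hz, projDeriv_frame hp hz, warpedCoordMetric_apply, readProj,
    baseMetric_apply_of_eq g₀ h]
  rfl

theorem coordDeriv_coordGradient
    (hproj : IsRiemannianSubmersion (m := m) (warpedMetric g₀ ρ) proj)
    {x : M} {y : N} {z : 𝔼} (hz : z ∈ readDomain (d := d) (fun y => (proj y).2) x y) :
    coordDeriv hproj.contMDiff x y z (coordGradient (m := m) (fun y => (proj y).1) x z) =
      ((1 : ℝ), (0 : 𝔼d)) := by
  have h1 := frame_coordGradient hz.1 ((contMDiff_fst_comp hproj.contMDiff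
    ((extChartAt (𝓡 m) x).symm z)).mdifferentiableAt (by simp))
  have h2 := (submersion_gradient hproj ((extChartAt (𝓡 m) x).symm z)).2
  have h3 := projDeriv_frame hproj.contMDiff hz
    (coordGradient (m := m) (fun y => (proj y).1) x z)
  rw [h1] at h3
  obtain ⟨h4, h5⟩ := Prod.ext_iff.1 (h3.symm.trans h2)
  exact Prod.ext h4 ((frameEquiv (readMap_mem_target hz)).map_eq_zero_iff.1 h5)

variable [IsContMDiffRiemannianBundle (𝓡 m) ∞ (EuclideanSpace ℝ (Fin m))
    (fun x : M => TangentSpace (𝓡 m) x)]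

/-- On horizontal vectors, the Lie derivative of the metric along the gradient of the first
coordinate is that of the warped product metric. -/
theorem lieDerivForm_horizontal
    (hproj : IsRiemannianSubmersion (m := m) (warpedMetric g₀ ρ) proj) (hρ : ContDiff ℝ ∞ ρ)
    (x : M) {v : 𝔼} (hv : v ∈ (vertical (m := m) (𝓘(ℝ, ℝ).prod (𝓡 d)) proj x)ᗮ) :
    lieDerivForm (coordMetric x) (coordGradient (m := m) (fun y => (proj y).1) x)
      (extChartAt (𝓡 m) x x) v =
    2 * deriv ρ (proj x).1 * (tangentInner x v v -
      tangentInner x v (gradientVec (m := m) (fun y => (proj y).1) x) ^ 2) := by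
  have hp := hproj.contMDiff
  set z₀ := extChartAt (𝓡 m) x x with hz₀
  set f : M → ℝ := fun y => (proj y).1 with hf
  set y := (proj x).2 with hy
  set G := coordMetric (m := m) x with hG
  set X := coordGradient (m := m) f x with hX
  have hU : readDomain (m := m) (d := d) (fun y => (proj y).2) x y ∈ 𝓝 z₀ :=
    readDomain_mem_nhds hp x
  have hzU := mem_of_mem_nhds hU
  have hsymm : (extChartAt (𝓡 m) x).symm z₀ = x := extChartAt_to_inv x
  set Ψ := readProj (m := m) (d := d) proj x y with hΨ
  set γ := warpedCoordMetric g₀ ρ y with hγ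
  have hΨs : ContDiffAt ℝ ∞ Ψ z₀ := contDiffAt_readProj hp hzU
  have hXd : DifferentiableAt ℝ X z₀ :=
    ((contDiffOn_coordGradient (contMDiff_fst_comp hp) x).contDiffAt
      ((isOpen_extChartAt_target (I := 𝓡 m) x).mem_nhds hzU.1)).differentiableAt (by simp)
  have hGd : DifferentiableAt ℝ G z₀ := differentiableAt_coordMetric hzU.1
  have hγd : DifferentiableAt ℝ γ (Ψ z₀) :=
    differentiableAt_warpedCoordMetric g₀ hρ (readMap_mem_target hzU)
  -- The pullback of the warped metric: degenerate along the fibers, at most G everywhere, and equal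
  -- to G as soon as one argument is horizontal.
  set b : 𝔼 → 𝔼 →L[ℝ] 𝔼 →L[ℝ] ℝ := fun z =>
    (γ (Ψ z)).bilinearComp (fderiv ℝ Ψ z) (fderiv ℝ Ψ z) with hb
  have hbd : DifferentiableAt ℝ b z₀ := by
    refine differentiableAt_of_clm_apply fun u => differentiableAt_of_clm_apply fun w => ?_
    have h1 : DifferentiableAt ℝ (fun z => γ (Ψ z)) z₀ :=
      DifferentiableAt.comp (g := γ) z₀ hγd (hΨs.differentiableAt (by simp))
    have h2 : DifferentiableAt ℝ (fderiv ℝ Ψ) z₀ :=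
      (hΨs.fderiv_right (m := (∞ : ℕ∞ω)) (by simp)).differentiableAt (by simp)
    exact (h1.clm_apply (h2.clm_apply (differentiableAt_const _))).clm_apply
      (h2.clm_apply (differentiableAt_const _))
  have hbU : ∀ z ∈ readDomain (m := m) (d := d) (fun y => (proj y).2) x y, ∀ u w,
      b z u w = (projDeriv d proj ((extChartAt (𝓡 m) x).symm z) (frame x z u)).1 *
      (projDeriv d proj ((extChartAt (𝓡 m) x).symm z) (frame x z w)).1 +
    fiberInner g₀ ρ (proj ((extChartAt (𝓡 m) x).symm z))
      (projDeriv d proj ((extChartAt (𝓡 m) x).symm z) (frame x z u)).2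
      (projDeriv d proj ((extChartAt (𝓡 m) x).symm z) (frame x z w)).2 := fun z hz u w => by
    have := warpedCoordMetric_coordDeriv (g₀ := g₀) (ρ := ρ) hp hz u w
    rw [← fderiv_readProj hp hz] at this
    exact this
  have hb0 : ∀ u, b z₀ u v = G z₀ u v := fun u => by
    rw [hbU z₀ hzU, hz₀, frame_self, extChartAt_to_inv, coordMetric_self]
    exact submersion_inner hproj x u hv
  -- With v kept constant in the chart, G(v, v) - b(v, v) is nonnegative nearby and zero at z₀, so
  -- its derivative along X vanishes. The two Lie derivatives thus agree on v without extending v to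
  -- a horizontal field.
  have hmin : IsLocalMin (fun z => G z v v - b z v v) z₀ := by
    filter_upwards [hU] with z hz
    rw [hb0, sub_self, sub_nonneg, hbU z hz]
    exact submersion_le hproj _ _
  have h1 := hmin.fderiv_eq_zero
  have h2 := ((hGd.hasFDerivAt.clm_apply (hasFDerivAt_const v z₀)).clm_apply
    (hasFDerivAt_const v z₀)).sub ((hbd.hasFDerivAt.clm_apply (hasFDerivAt_const v z₀)).clm_apply
    (hasFDerivAt_const v z₀))
  have h3 := congrArg (fun L : 𝔼 →L[ℝ] ℝ => L (X z₀)) (h2.fderiv.symm.trans h1)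
  simp at h3
  have hbs : b z₀ v (fderiv ℝ X z₀ v) = G z₀ v (fderiv ℝ X z₀ v) := by
    rw [coordMetric_symm x z₀ v, ← hG, ← hb0, hbU z₀ hzU, hbU z₀ hzU, mul_comm,
      fiberInner_symm]
  have h4 : lieDerivForm G X z₀ v = lieDerivForm b X z₀ v := by
    unfold lieDerivForm
    rw [hb0, hbs]
    linarith
  -- The gradient of f is related to ∂_t by the projection, so the Lie derivative of the pullback is
  -- computed downstairs.
  have h5 : lieDerivForm b X z₀ v =
      lieDerivForm γ (fun _ => ((1 : ℝ), (0 : 𝔼d))) (Ψ z₀) (fderiv ℝ Ψ z₀ v) := by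
    refine lieDerivForm_pullback (hΨs.of_le (WithTop.coe_le_coe.2 (le_top : (2 : ℕ∞) ≤ ⊤))) hXd hγd
      (differentiableAt_const _) (Eventually.of_forall fun z u w => rfl) ?_ hbd v
    filter_upwards [hU] with z hz
    rw [fderiv_readProj hp hz]
    exact coordDeriv_coordGradient hproj hz
  -- The first component of the image of v is ⟨v, ∇f⟩. Since v is horizontal, the fiber part of its
  -- squared length is therefore ⟨v, v⟩ - ⟨v, ∇f⟩².
  have hv1 := submersion_inner hproj x v (submersion_gradient hproj x).1
  rw [(submersion_gradient hproj x).2] at hv1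
  have hv2 := submersion_inner hproj x v hv
  have h6 := warpedCoordMetric_apply g₀ ρ y (Ψ z₀) (fderiv ℝ Ψ z₀ v) (fderiv ℝ Ψ z₀ v)
  have h7 : γ (Ψ z₀) (fderiv ℝ Ψ z₀ v) (fderiv ℝ Ψ z₀ v) = tangentInner x v v :=
    (hb0 v).trans (coordMetric_self x v v)
  have h8 : (fderiv ℝ Ψ z₀ v).1 = (projDeriv d proj x v).1 := by
    have := projDeriv_frame hp hzU v
    rw [hz₀, frame_self, extChartAt_to_inv] at this
    rw [hΨ, fderiv_readProj hp hzU]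
    exact (congrArg Prod.fst this).symm
  have h9 : (Ψ z₀).1 = (proj x).1 := congrArg (fun a => (proj a).1) hsymm
  rw [h4, h5, hγ, lieDerivForm_warpedCoordMetric g₀ hρ (readMap_mem_target hzU), h9]
  rw [← hγ, h7, h8, h9] at h6
  simp only [mul_one, map_zero, add_zero] at hv1
  rw [← hv1, h6]
  ring

end Horizontal

/-! ### Linear algebra of the lower bound for the trace. -/

section TraceEstimate

variable {F : Type*} [NormedAddCommGroup F] [InnerProductSpace ℝ F] [FiniteDimensional ℝ F]

/-- A lower bound for the trace of a map whose quadratic form is given by a second fundamental form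
on `K` and is that of a multiple of a projection on the complement. -/
theorem sub_le_trace {K : Submodule ℝ F} {S : F →ₗ[ℝ] F} {X : F} {A : F → F → F} {α r : ℝ}
    (hX : X ∈ Kᗮ) (hX1 : inner ℝ X X = (1 : ℝ))
    (hK : ∀ v ∈ K, inner ℝ v (S v) = -inner ℝ (A v v) X)
    (hKo : ∀ v ∈ Kᗮ, inner ℝ v (S v) = r * (inner ℝ v v - inner ℝ v X ^ 2))
    (hA : ‖traceOn K A‖ ≤ α) :
    r * ((Module.finrank ℝ Kᗮ : ℝ) - 1) - α ≤ LinearMap.trace ℝ F S := by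
  have hn : ‖X‖ = 1 := by
    rw [real_inner_self_eq_norm_sq] at hX1
    exact (pow_eq_one_iff_of_nonneg (norm_nonneg X) two_ne_zero).1 hX1
  have h1 : ∑ i, inner ℝ (stdOrthonormalBasis ℝ K i : F) (S (stdOrthonormalBasis ℝ K i)) =
      -inner ℝ (traceOn K A) X := by
    rw [traceOn, sum_inner, ← Finset.sum_neg_distrib]
    exact Finset.sum_congr rfl fun i _ => hK _ (stdOrthonormalBasis ℝ K i).2
  have h2 : ∑ i, inner ℝ (stdOrthonormalBasis ℝ Kᗮ i : F) (S (stdOrthonormalBasis ℝ Kᗮ i)) =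
      r * ((Module.finrank ℝ Kᗮ : ℝ) - 1) := by
    have h3 : ∀ i, inner ℝ (stdOrthonormalBasis ℝ Kᗮ i : F) (S (stdOrthonormalBasis ℝ Kᗮ i)) =
        r * (1 - inner ℝ (stdOrthonormalBasis ℝ Kᗮ i) (⟨X, hX⟩ : Kᗮ) ^ 2) := fun i => by
      rw [hKo _ (stdOrthonormalBasis ℝ Kᗮ i).2, real_inner_self_eq_norm_sq, Submodule.norm_coe,
        (stdOrthonormalBasis ℝ Kᗮ).orthonormal.1 i, one_pow, Submodule.coe_inner]
    simp only [h3]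
    -- Parseval for the unit vector X in the complement: the squared coefficients sum to 1, so one
    -- dimension is lost.
    rw [← Finset.mul_sum, Finset.sum_sub_distrib, OrthonormalBasis.sum_sq_inner_right]
    simp [hn]
  -- Cauchy–Schwarz with ‖X‖ = 1 turns the bound on the mean curvature vector into one on its
  -- component along X.
  have h4 := (abs_le.1 (abs_real_inner_le_norm (traceOn K A) X)).2
  rw [hn, mul_one] at h4
  rw [trace_eq_sum_add_sum_orthogonal K S, h1, h2]
  linarith

end TraceEstimate

/-! ### The lower bound for the divergence of the gradient. -/

section Divergence

variable {m d : ℕ} {M : Type*} [TopologicalSpace M] [ChartedSpace (EuclideanSpace ℝ (Fin m)) M]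
  [IsManifold (𝓡 m) ∞ M]
  {N : Type*} [TopologicalSpace N] [ChartedSpace (EuclideanSpace ℝ (Fin d)) N]
  [IsManifold (𝓡 d) ∞ N]
  [RiemannianBundle (fun x : M => TangentSpace (𝓡 m) x)]
  {g₀ : ContMDiffRiemannianMetric (𝓡 d) ∞ (EuclideanSpace ℝ (Fin d))
    (fun x : N => TangentSpace (𝓡 d) x)}
  {ρ : ℝ → ℝ} {proj : M → ℝ × N}

local notation "𝔼" => EuclideanSpace ℝ (Fin m)
local notation "𝔼d" => EuclideanSpace ℝ (Fin d)

/-- The zeroth-order part of the covariant derivative of a field along itself, up to the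
antisymmetric part. -/
def christoffelPart (G : 𝔼 → 𝔼 →L[ℝ] 𝔼 →L[ℝ] ℝ) (X : 𝔼 → 𝔼) (z : 𝔼) : 𝔼 →L[ℝ] 𝔼 :=
  (1 / 2 : ℝ) • (G z).inverse.comp (fderiv ℝ G z (X z))

theorem apply_christoffelPart {G : 𝔼 → 𝔼 →L[ℝ] 𝔼 →L[ℝ] ℝ} {z : 𝔼}
    (hp : ∀ v, v ≠ 0 → 0 < G z v v) (X : 𝔼 → 𝔼) (v w : 𝔼) :
    G z (christoffelPart G X z v) w = fderiv ℝ G z (X z) v w / 2 := by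
  simp only [christoffelPart, smul_apply, ContinuousLinearMap.comp_apply, map_smul,
    (isInvertible_of_pos hp).self_apply_inverse, smul_eq_mul]
  ring

omit [IsManifold (𝓡 m) ∞ M] in
theorem finrank_horizontal
    (hproj : IsRiemannianSubmersion (m := m) (warpedMetric g₀ ρ) proj) (x : M) :
    Module.finrank ℝ (vertical (m := m) (𝓘(ℝ, ℝ).prod (𝓡 d)) proj x)ᗮ = d + 1 := by
  have h1 := Submodule.finrank_add_finrank_orthogonal
    (vertical (m := m) (𝓘(ℝ, ℝ).prod (𝓡 d)) proj x)
  have h2 := LinearMap.finrank_range_add_finrank_ker (K := ℝ) (V := 𝔼)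
    (V₂ := ℝ × 𝔼d) (projDeriv d proj x).toLinearMap
  have h3 : LinearMap.range (projDeriv d proj x).toLinearMap = ⊤ :=
    LinearMap.range_eq_top.2 (hproj.mfderiv_surjective x)
  rw [h3, finrank_top, Module.finrank_prod, Module.finrank_self, finrank_euclideanSpace_fin,
    add_comm 1 d, add_comm] at h2
  exact Nat.add_left_cancel (h1.trans h2.symm)

variable [IsContMDiffRiemannianBundle (𝓡 m) ∞ (EuclideanSpace ℝ (Fin m))
    (fun x : M => TangentSpace (𝓡 m) x)]

/-- The Lie derivative of the metric along a gradient does not depend on the chart. -/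
theorem lieDerivForm_coordMetric {f : M → ℝ} (hf : ContMDiff (𝓡 m) 𝓘(ℝ, ℝ) ∞ f) {x : M} {z : 𝔼}
    (hz : z ∈ (extChartAt (𝓡 m) x).target) (v : 𝔼) :
    lieDerivForm (coordMetric x) (coordGradient f x) z v =
      lieDerivForm (coordMetric ((extChartAt (𝓡 m) x).symm z))
        (coordGradient f ((extChartAt (𝓡 m) x).symm z))
        (extChartAt (𝓡 m) ((extChartAt (𝓡 m) x).symm z) ((extChartAt (𝓡 m) x).symm z))
        (frame x z v) := by
  set y := (extChartAt (𝓡 m) x).symm z with hy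
  have hys : (extChartAt (𝓡 m) x).symm z ∈ (extChartAt (𝓡 m) y).source :=
    mem_extChartAt_source y
  have hD := (isOpen_transition_domain x y).mem_nhds ⟨hz, hys⟩
  have ht : transition x y z = extChartAt (𝓡 m) y y := rfl
  have htn : extChartAt (𝓡 m) y y ∈ (extChartAt (𝓡 m) y).target := mem_extChartAt_target y
  have hf' : MDifferentiable (𝓡 m) 𝓘(ℝ, ℝ) f := hf.mdifferentiable (by simp)
  have h := lieDerivForm_pullback (z := z) (v := v) (G := coordMetric (m := m) x)
    (X := coordGradient f x) (ψ := transition x y) (γ := coordMetric (m := m) y)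
    (Y := coordGradient f y)
    (((contDiffOn_transition x y).contDiffAt hD).of_le
      (WithTop.coe_le_coe.2 (le_top : (2 : ℕ∞) ≤ ⊤)))
    (((contDiffOn_coordGradient hf x).contDiffAt
      ((isOpen_extChartAt_target (I := 𝓡 m) x).mem_nhds hz)).differentiableAt (by simp))
    (differentiableAt_coordMetric htn)
    (((contDiffOn_coordGradient hf y).contDiffAt
      ((isOpen_extChartAt_target (I := 𝓡 m) y).mem_nhds htn)).differentiableAt (by simp))
    (by filter_upwards [hD] with a ha using coordMetric_transition ha.1 ha.2)
    (by filter_upwards [hD] with a ha using transition_coordGradient hf' ha.1 ha.2)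
    (differentiableAt_coordMetric hz)
  have h2 := frame_transition hz hys v
  rw [ht, frame_self] at h2
  rw [h, ht]
  exact congrArg _ h2

/-- The lower bound for the divergence of the gradient of the first coordinate. -/
theorem le_divergence (hproj : IsRiemannianSubmersion (m := m) (warpedMetric g₀ ρ) proj)
    (hρ : ContDiff ℝ ∞ ρ) {κ α : ℝ} (hρκ : ∀ t, κ ≤ deriv ρ t)
    (hH : ∀ x : M, ‖meanCurvature (m := m) (𝓘(ℝ, ℝ).prod (𝓡 d)) proj x‖ ≤ α)
    {x : M} {z : 𝔼} (hz : z ∈ (extChartAt (𝓡 m) x).target) :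
    d * κ - α ≤ LinearMap.trace ℝ 𝔼
      (fderiv ℝ (coordGradient (m := m) (fun y => (proj y).1) x) z +
        christoffelPart (coordMetric x) (coordGradient (m := m) (fun y => (proj y).1) x)
          z).toLinearMap := by
  set f : M → ℝ := fun y => (proj y).1 with hf
  set G := coordMetric (m := m) x with hG
  set X := coordGradient (m := m) f x with hX
  set S : 𝔼 →L[ℝ] 𝔼 := fderiv ℝ X z + christoffelPart G X z with hS
  set y := (extChartAt (𝓡 m) x).symm z with hy
  have hfs : ContMDiff (𝓡 m) 𝓘(ℝ, ℝ) ∞ f := contMDiff_fst_comp hproj.contMDiff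
  -- S may differ from the covariant derivative of X by an antisymmetric map, which affects neither
  -- this quadratic form nor the trace.
  have hGS : ∀ v, G z v (S v) = lieDerivForm G X z v / 2 := fun v => by
    rw [hG, coordMetric_symm, ← hG, hS, add_apply, map_add, add_apply,
      apply_christoffelPart (coordMetric_pos hz)]
    unfold lieDerivForm
    rw [hG, coordMetric_symm x z v]
    ring
  -- Conjugation by the frame transports S to the tangent space at y, where vertical and horizontal
  -- spaces live; the trace does not change.
  set A : 𝔼 ≃ₗ[ℝ] 𝔼 := (frameEquiv hz).toLinearEquiv with hA
  set S' : 𝔼 →ₗ[ℝ] 𝔼 := A.conj S.toLinearMap with hS'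
  have key : ∀ v : 𝔼, tangentInner y v (S' v) =
      lieDerivForm (coordMetric y) (coordGradient f y) (extChartAt (𝓡 m) y y) v / 2 := fun v => by
    obtain ⟨w, rfl⟩ := (frameEquiv hz).surjective v
    have h1 : S' (frameEquiv hz w) = frame x z (S w) := by
      have : A.symm (frameEquiv hz w) = w := (frameEquiv hz).symm_apply_apply w
      rw [hS', LinearEquiv.conj_apply_apply, this]
      rfl
    rw [h1]
    refine Eq.trans ?_ ((hGS w).trans ?_)
    · rfl
    · rw [hG, hX, lieDerivForm_coordMetric hfs hz]
      rfl
  have htr := LinearMap.trace_conj' S.toLinearMap A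
  rw [← htr]
  have hle := sub_le_trace (F := TangentSpace (𝓡 m) y)
    (K := vertical (m := m) (𝓘(ℝ, ℝ).prod (𝓡 d)) proj y) (S := S')
    (X := gradientVec (m := m) f y)
    (A := fun v w => secondFundamentalForm (m := m) (𝓘(ℝ, ℝ).prod (𝓡 d)) proj y v w) (α := α)
    (r := deriv ρ (proj y).1) (submersion_gradient hproj y).1 (tangentInner_gradient_self hproj y)
    (fun v hv => by
      refine (key v).trans ?_
      have := tangentInner_secondFundamentalForm hproj y hv
      refine Eq.trans ?_ (congrArg Neg.neg this).symm
      rw [neg_div, neg_neg])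
    (fun v hv => by
      refine (key v).trans ?_
      rw [lieDerivForm_horizontal hproj hρ y hv]
      have : ∀ a b c : ℝ, 2 * a * (b - c ^ 2) / 2 = a * (b - c ^ 2) := fun a b c => by ring
      exact this _ _ _)
    (hH y)
  rw [finrank_horizontal hproj] at hle
  refine le_trans ?_ hle
  push_cast
  rw [add_sub_cancel_right, mul_comm]
  gcongr
  exact hρκ _

end Divergence

/-! ### The divergence inequality integrated over the manifold. -/

section Integral

variable {m : ℕ} {M : Type*} [TopologicalSpace M] [ChartedSpace (EuclideanSpace ℝ (Fin m)) M]
  [IsManifold (𝓡 m) ∞ M]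
  [RiemannianBundle (fun x : M => TangentSpace (𝓡 m) x)]

local notation "𝔼" => EuclideanSpace ℝ (Fin m)

/-- The derivative of `η` along the gradient of `f`. -/
def gradientDeriv (f η : M → ℝ) (y : M) : ℝ :=
  mfderiv (𝓡 m) 𝓘(ℝ, ℝ) η y (gradientVec (m := m) f y)

omit [IsManifold (𝓡 m) ∞ M] in
theorem gradientDeriv_eq_inner (f η : M → ℝ) (y : M) : gradientDeriv (m := m) f η y =
    tangentInner y (gradientVec (m := m) η y) (gradientVec (m := m) f y) :=
  (tangentInner_gradient η y _).symm

omit [IsManifold (𝓡 m) ∞ M] in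
theorem gradientDeriv_add (f : M → ℝ) {η₁ η₂ : M → ℝ} (h₁ : MDifferentiable (𝓡 m) 𝓘(ℝ, ℝ) η₁)
    (h₂ : MDifferentiable (𝓡 m) 𝓘(ℝ, ℝ) η₂) :
    gradientDeriv (m := m) f (η₁ + η₂) =
      gradientDeriv (m := m) f η₁ + gradientDeriv (m := m) f η₂ := by
  ext y
  exact congrArg (fun L : 𝔼 →L[ℝ] ℝ => L (gradientVec (m := m) f y)) (mfderiv_add (h₁ y) (h₂ y))

omit [IsManifold (𝓡 m) ∞ M] in
theorem gradientDeriv_eq_zero (f : M → ℝ) {η : M → ℝ} {y : M} (hy : y ∉ tsupport η) :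
    gradientDeriv (m := m) f η y = 0 := by
  have h1 : η =ᶠ[𝓝 y] fun _ => (0 : ℝ) := notMem_tsupport_iff_eventuallyEq.1 hy
  have h2 : mfderiv (𝓡 m) 𝓘(ℝ, ℝ) η y = mfderiv (𝓡 m) 𝓘(ℝ, ℝ) (fun _ : M => (0 : ℝ)) y :=
    h1.mfderiv_eq
  rw [mfderiv_const] at h2
  exact congrArg (fun L : 𝔼 →L[ℝ] ℝ => L (gradientVec (m := m) f y)) h2

omit [IsManifold (𝓡 m) ∞ M] in
theorem tsupport_gradientDeriv_subset (f η : M → ℝ) :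
    tsupport (gradientDeriv (m := m) f η) ⊆ tsupport η :=
  closure_minimal (fun y hy => by
    by_contra h
    exact hy (gradientDeriv_eq_zero f h)) (isClosed_tsupport _)

/-- The chain rule through the inverse chart, to which the suffix of the name refers. -/
theorem gradientDeriv_symm {f η : M → ℝ} (hf : MDifferentiable (𝓡 m) 𝓘(ℝ, ℝ) f)
    (hη : MDifferentiable (𝓡 m) 𝓘(ℝ, ℝ) η) {x : M} {z : 𝔼}
    (hz : z ∈ (extChartAt (𝓡 m) x).target) :
    gradientDeriv (m := m) f η ((extChartAt (𝓡 m) x).symm z) =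
      fderiv ℝ (fun y => η ((extChartAt (𝓡 m) x).symm y)) z (coordGradient f x z) := by
  have h := mfderiv_frame hz (hη _) (coordGradient f x z)
  rw [frame_coordGradient hz (hf _)] at h
  exact h

variable [IsContMDiffRiemannianBundle (𝓡 m) ∞ (EuclideanSpace ℝ (Fin m))
    (fun x : M => TangentSpace (𝓡 m) x)]

theorem continuous_gradientDeriv {f η : M → ℝ} (hf : ContMDiff (𝓡 m) 𝓘(ℝ, ℝ) ∞ f)
    (hη : ContMDiff (𝓡 m) 𝓘(ℝ, ℝ) 1 η) : Continuous (gradientDeriv (m := m) f η) := by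
  refine continuous_iff_continuousAt.2 fun x => ?_
  have ho := isOpen_extChartAt_target (I := 𝓡 m) x
  have h1 : ContinuousOn (fun z => fderiv ℝ (fun y => η ((extChartAt (𝓡 m) x).symm y)) z
      (coordGradient f x z)) (extChartAt (𝓡 m) x).target :=
    ((contDiffOn_comp_symm (by simp) hη x).continuousOn_fderiv_of_isOpen ho le_rfl).clm_apply
      (contDiffOn_coordGradient hf x).continuousOn
  have h2 : ContinuousOn (gradientDeriv (m := m) f η) (extChartAt (𝓡 m) x).source := by
    refine (h1.comp (continuousOn_extChartAt x) fun y hy =>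
      (extChartAt (𝓡 m) x).map_source hy).congr fun y hy => ?_
    have h3 := gradientDeriv_symm (hf.mdifferentiable (by simp)) (hη.mdifferentiable (by simp))
      ((extChartAt (𝓡 m) x).map_source hy)
    rw [(extChartAt (𝓡 m) x).left_inv hy] at h3
    exact h3
  exact h2.continuousAt (extChartAt_source_mem_nhds x)

/-- The gradient field of `f` has divergence at least `c`. -/
def LeDivergence (f : M → ℝ) (c : ℝ) : Prop :=
  ∀ x : M, ∀ z ∈ (extChartAt (𝓡 m) x).target, c ≤ LinearMap.trace ℝ 𝔼
    (fderiv ℝ (coordGradient (m := m) f x) z +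
      christoffelPart (coordMetric x) (coordGradient (m := m) f x) z).toLinearMap

variable [MeasurableSpace M] [BorelSpace M]

/-- When η lives in one chart, both integrals become coordinate integrals, and the image of its
support is the compact set required by `integral_fderiv_le_of_le_divergence`. -/
theorem integral_le_of_tsupport_subset_source {f η : M → ℝ} {c : ℝ}
    (hf : ContMDiff (𝓡 m) 𝓘(ℝ, ℝ) ∞ f) (hc : LeDivergence (m := m) f c)
    (hη : ContMDiff (𝓡 m) 𝓘(ℝ, ℝ) 1 η) (hη0 : ∀ y, 0 ≤ η y) (hηc : HasCompactSupport η) {x : M}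
    (hηx : tsupport η ⊆ (extChartAt (𝓡 m) x).source) :
    c * ∫ y, η y ∂(riemannianVolume m M) ≤
      -∫ y, gradientDeriv (m := m) f η y ∂(riemannianVolume m M) := by
  have hD := continuous_gradientDeriv hf hη
  have ho := isOpen_extChartAt_target (I := 𝓡 m) x
  rw [← setIntegral_eq_integral_of_forall_compl_eq_zero (s := (extChartAt (𝓡 m) x).source)
      fun y hy => image_eq_zero_of_notMem_tsupport fun h => hy (hηx h),
    ← setIntegral_eq_integral_of_forall_compl_eq_zero (s := (extChartAt (𝓡 m) x).source)
      fun y hy => gradientDeriv_eq_zero f fun h => hy (hηx h),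
    setIntegral_source_eq x hη.continuous.continuousOn, setIntegral_source_eq x hD.continuousOn]
  have h1 : ∫ z in (extChartAt (𝓡 m) x).target,
      gradientDeriv (m := m) f η ((extChartAt (𝓡 m) x).symm z) * density (coordMetric x) z =
      ∫ z in (extChartAt (𝓡 m) x).target, fderiv ℝ (fun y => η ((extChartAt (𝓡 m) x).symm y)) z
        (coordGradient f x z) * density (coordMetric x) z :=
    setIntegral_congr_fun ho.measurableSet fun z hz => by
      simp only [gradientDeriv_symm (hf.mdifferentiable (by simp))
        (hη.mdifferentiable (by simp)) hz]
  rw [h1]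
  have hle : ((1 : ℕ∞ω)) ≤ (∞ : ℕ∞ω) := by simp
  refine integral_fderiv_le_of_le_divergence ho
    (hηc.isCompact.image_of_continuousOn ((continuousOn_extChartAt x).mono hηx))
    (image_subset_iff.2 fun y hy => (extChartAt (𝓡 m) x).map_source (hηx hy))
    ((contDiffOn_coordMetric x).of_le hle) (fun z _ v w => coordMetric_symm x z v w)
    (fun z hz => coordMetric_pos hz) ((contDiffOn_coordGradient hf x).of_le hle)
    (fun z hz v w => apply_christoffelPart (coordMetric_pos hz) _ v w) (hc x)
    (contDiffOn_comp_symm (by simp) hη x) (fun z _ => hη0 _) fun z hz => ?_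
  refine image_eq_zero_of_notMem_tsupport fun h => hz.2 ⟨_, h, (extChartAt (𝓡 m) x).right_inv hz.1⟩

/-- The integrated form of a lower bound for the divergence of a gradient. -/
theorem integral_le_neg_integral_gradientDeriv [T2Space M] [SigmaCompactSpace M] {f η : M → ℝ}
    {c : ℝ} (hf : ContMDiff (𝓡 m) 𝓘(ℝ, ℝ) ∞ f) (hc : LeDivergence (m := m) f c)
    (hη : ContMDiff (𝓡 m) 𝓘(ℝ, ℝ) 1 η) (hη0 : ∀ y, 0 ≤ η y) (hηc : HasCompactSupport η) :
    c * ∫ y, η y ∂(riemannianVolume m M) ≤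
      -∫ y, gradientDeriv (m := m) f η y ∂(riemannianVolume m M) := by
  -- The pieces r i · η stay nonnegative, so the one-chart inequality applies to each; only finitely
  -- many meet the support of η.
  obtain ⟨r, hr⟩ := SmoothPartitionOfUnity.exists_isSubordinate_chartAt_source (𝓡 m) M
  have hfin := r.locallyFinite.finite_nonempty_inter_compact hηc.isCompact
  -- Regularity and compact support are carried along with the inequality, since integrability is
  -- needed to split the integrals of a sum.
  set P : (M → ℝ) → Prop := fun η => ContMDiff (𝓡 m) 𝓘(ℝ, ℝ) 1 η ∧ HasCompactSupport η ∧
    c * ∫ y, η y ∂(riemannianVolume m M) ≤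
      -∫ y, gradientDeriv (m := m) f η y ∂(riemannianVolume m M) with hP
  have hint : ∀ ζ : M → ℝ, ContMDiff (𝓡 m) 𝓘(ℝ, ℝ) 1 ζ → HasCompactSupport ζ →
      Integrable ζ (riemannianVolume m M) ∧
      Integrable (gradientDeriv (m := m) f ζ) (riemannianVolume m M) := fun ζ h1 h2 =>
    ⟨h1.continuous.integrable_of_hasCompactSupport h2,
      (continuous_gradientDeriv hf h1).integrable_of_hasCompactSupport
        (h2.of_isClosed_subset (isClosed_tsupport _) (tsupport_gradientDeriv_subset f ζ))⟩
  have hsum : P (∑ i ∈ hfin.toFinset, fun y => r i y * η y) := by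
    refine Finset.sum_induction _ P ?_ ?_ fun i _ => ?_
    · rintro a b ⟨ha1, ha2, ha3⟩ ⟨hb1, hb2, hb3⟩
      refine ⟨ha1.add hb1, ha2.add hb2, ?_⟩
      rw [gradientDeriv_add f (ha1.mdifferentiable (by simp)) (hb1.mdifferentiable (by simp))]
      simp only [Pi.add_apply]
      rw [integral_add (hint a ha1 ha2).1 (hint b hb1 hb2).1,
        integral_add (hint a ha1 ha2).2 (hint b hb1 hb2).2]
      linarith
    · refine ⟨contMDiff_const, HasCompactSupport.zero, ?_⟩
      have h0 : ∀ y, gradientDeriv (m := m) f (0 : M → ℝ) y = 0 := fun y =>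
        gradientDeriv_eq_zero f (by simp)
      simp [h0]
    · have h1 : ContMDiff (𝓡 m) 𝓘(ℝ, ℝ) 1 (fun y => r i y * η y) :=
        ((r i).contMDiff.of_le (by simp)).mul hη
      have h2 : HasCompactSupport (fun y => r i y * η y) := hηc.mul_left
      refine ⟨h1, h2, integral_le_of_tsupport_subset_source hf hc h1
        (fun y => mul_nonneg (r.nonneg i y) (hη0 y)) h2 (x := i) ?_⟩
      rw [extChartAt_source]
      exact (closure_mono (Function.support_mul_subset_left _ _)).trans (hr i)
  have heq : (∑ i ∈ hfin.toFinset, fun y => r i y * η y) = η := by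
    ext y
    rw [Finset.sum_apply, ← Finset.sum_mul]
    by_cases hy : η y = 0
    · rw [hy, mul_zero]
    · have h1 := r.sum_eq_one (mem_univ y)
      rw [finsum_eq_sum_of_support_subset (s := hfin.toFinset)] at h1
      · rw [h1, one_mul]
      · intro i hi
        simp only [Finite.coe_toFinset, mem_ofPred_eq]
        exact ⟨y, hi, subset_tsupport _ hy⟩
  rw [heq] at hsum
  exact hsum.2.2

end Integral

/-! ### The inequality for smooth functions with compact support. -/

/-- Young's inequality with the weight `k`. -/
theorem rpow_sub_one_mul_le {p k a g : ℝ} (hp : 1 < p) (hk : 0 < k) (ha : 0 ≤ a) (hg : 0 ≤ g) :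
    p * (a ^ (p - 1) * g) ≤ (p - 1) * (k * a ^ p) + k ^ (1 - p) * g ^ p := by
  have hp0 : 0 < p := by linarith
  -- The powers k and k^{1-p} are chosen so that, with weights (p-1)/p and 1/p, they cancel in the
  -- geometric mean.
  have h := Real.geom_mean_le_arith_mean2_weighted (w₁ := (p - 1) / p) (w₂ := 1 / p)
    (p₁ := k * a ^ p) (p₂ := k ^ (1 - p) * g ^ p) (div_nonneg (by linarith) hp0.le)
    (by positivity) (by positivity) (by positivity) (by field_simp; ring)
  rw [Real.mul_rpow hk.le (by positivity), Real.mul_rpow (by positivity) (by positivity),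
    ← Real.rpow_mul ha, ← Real.rpow_mul hg, ← Real.rpow_mul hk.le, mul_div_cancel₀ _ hp0.ne',
    mul_one_div_cancel hp0.ne', Real.rpow_one] at h
  have h2 : k ^ ((p - 1) / p) * k ^ ((1 - p) * (1 / p)) = 1 := by
    rw [← Real.rpow_add hk, show (p - 1) / p + (1 - p) * (1 / p) = 0 by field_simp; ring,
      Real.rpow_zero]
  have h3 : a ^ (p - 1) * g ≤ (p - 1) / p * (k * a ^ p) + 1 / p * (k ^ (1 - p) * g ^ p) := by
    calc a ^ (p - 1) * g = k ^ ((p - 1) / p) * k ^ ((1 - p) * (1 / p)) * (a ^ (p - 1) * g) := by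
          rw [h2, one_mul]
      _ = k ^ ((p - 1) / p) * a ^ (p - 1) * (k ^ ((1 - p) * (1 / p)) * g) := by ring
      _ ≤ _ := h
  calc p * (a ^ (p - 1) * g) ≤
      p * ((p - 1) / p * (k * a ^ p) + 1 / p * (k ^ (1 - p) * g ^ p)) := by gcongr
    _ = _ := by field_simp

section Smooth

variable {m : ℕ} {M : Type*} [TopologicalSpace M] [ChartedSpace (EuclideanSpace ℝ (Fin m)) M]
  [IsManifold (𝓡 m) ∞ M]
  [RiemannianBundle (fun x : M => TangentSpace (𝓡 m) x)]

local notation "𝔼" => EuclideanSpace ℝ (Fin m)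

/-- The length of the gradient. -/
def gradientNorm (φ : M → ℝ) (y : M) : ℝ :=
  ‖gradient (m := m) φ y‖

omit [IsManifold (𝓡 m) ∞ M] in
theorem gradientNorm_eq_sqrt (φ : M → ℝ) (y : M) :
    gradientNorm (m := m) φ y = Real.sqrt (gradientDeriv (m := m) φ φ y) := by
  rw [gradientDeriv_eq_inner]
  exact norm_eq_sqrt_real_inner (F := TangentSpace (𝓡 m) y) _

omit [IsManifold (𝓡 m) ∞ M] in
theorem gradientNorm_eq_zero {φ : M → ℝ} {y : M} (hy : y ∉ tsupport φ) :
    gradientNorm (m := m) φ y = 0 := by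
  rw [gradientNorm_eq_sqrt, gradientDeriv_eq_zero φ hy, Real.sqrt_zero]

omit [IsManifold (𝓡 m) ∞ M] in
theorem abs_gradientDeriv_le {f : M → ℝ} {y : M}
    (hf1 : tangentInner y (gradientVec (m := m) f y) (gradientVec (m := m) f y) = 1) (φ : M → ℝ) :
    |gradientDeriv (m := m) f φ y| ≤ gradientNorm (m := m) φ y := by
  rw [gradientDeriv_eq_inner]
  have h := abs_real_inner_le_norm (F := TangentSpace (𝓡 m) y) (gradientVec (m := m) φ y)
    (gradientVec (m := m) f y)
  have h1 := norm_eq_sqrt_real_inner (F := TangentSpace (𝓡 m) y) (gradientVec (m := m) f y)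
  have h2 := h1.trans ((congrArg Real.sqrt hf1).trans Real.sqrt_one)
  exact h.trans_eq ((congrArg (fun r => ‖gradient (m := m) φ y‖ * r) h2).trans (mul_one _))

omit [IsManifold (𝓡 m) ∞ M] in
-- For p > 1 the function |·|^p is differentiable even at 0, so the chain rule holds at the zeros of
-- φ as well.
theorem gradientDeriv_abs_rpow (f : M → ℝ) {φ : M → ℝ} (hφ : MDifferentiable (𝓡 m) 𝓘(ℝ, ℝ) φ)
    {p : ℝ} (hp : 1 < p) (y : M) : gradientDeriv (m := m) f (fun y => |φ y| ^ p) y =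
      p * |φ y| ^ (p - 2) * φ y * gradientDeriv (m := m) f φ y := by
  have h := HasMFDerivAt.comp (I' := 𝓘(ℝ, ℝ)) y
    (hasDerivAt_abs_rpow (φ y) hp).hasFDerivAt.hasMFDerivAt (hφ y).hasMFDerivAt
  have h2 := congrArg (fun L : 𝔼 →L[ℝ] ℝ => L (gradientVec (m := m) f y)) h.mfderiv
  refine Eq.trans h2 ?_
  exact mul_comm _ _

variable [IsContMDiffRiemannianBundle (𝓡 m) ∞ (EuclideanSpace ℝ (Fin m))
    (fun x : M => TangentSpace (𝓡 m) x)]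

theorem continuous_gradientNorm {φ : M → ℝ} (hφ : ContMDiff (𝓡 m) 𝓘(ℝ, ℝ) ∞ φ) :
    Continuous (gradientNorm (m := m) φ) := by
  rw [funext (gradientNorm_eq_sqrt (m := m) φ)]
  exact (continuous_gradientDeriv hφ (hφ.of_le (by simp))).sqrt

variable [MeasurableSpace M] [BorelSpace M] [T2Space M] [SigmaCompactSpace M]

/-- Test the divergence inequality with |φ|^p, which is C¹ and nonnegative, and bound ⟨∇φ, ∇f⟩ by
‖∇φ‖ since ∇f is a unit field. Young's inequality then separates φ from its gradient. -/
theorem integral_abs_rpow_le {f φ : M → ℝ} {c p : ℝ} (hp : 1 < p) (hc0 : 0 < c)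
    (hf : ContMDiff (𝓡 m) 𝓘(ℝ, ℝ) ∞ f) (hc : LeDivergence (m := m) f c)
    (hf1 : ∀ y, tangentInner y (gradientVec (m := m) f y) (gradientVec (m := m) f y) = 1)
    (hφ : ContMDiff (𝓡 m) 𝓘(ℝ, ℝ) ∞ φ) (hφc : HasCompactSupport φ) :
    (c / p) ^ p * ∫ y, |φ y| ^ p ∂(riemannianVolume m M) ≤
      ∫ y, gradientNorm (m := m) φ y ^ p ∂(riemannianVolume m M) := by
  have hp0 : 0 < p := by linarith
  -- With c = pk, the Young term (p-1)k∫|φ|^p is absorbed on the left and k∫|φ|^p remains. This k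
  -- also gives the sharpest constant of the method.
  set k := c / p with hk
  have hk0 : 0 < k := div_pos hc0 hp0
  have hηs : ContMDiff (𝓡 m) 𝓘(ℝ, ℝ) 1 fun y => |φ y| ^ p :=
    (contDiff_norm_rpow (E := ℝ) hp).comp_contMDiff (hφ.of_le (by simp))
  have hηc : HasCompactSupport fun y => |φ y| ^ p :=
    hφc.comp_left (g := fun a : ℝ => |a| ^ p) (by simp [Real.zero_rpow hp0.ne'])
  have hgc : HasCompactSupport fun y => gradientNorm (m := m) φ y ^ p :=
    HasCompactSupport.intro hφc.isCompact fun y hy => by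
      rw [gradientNorm_eq_zero hy, Real.zero_rpow hp0.ne']
  have hg : Continuous fun y => gradientNorm (m := m) φ y ^ p :=
    (continuous_gradientNorm hφ).rpow_const fun _ => Or.inr hp0.le
  have h1 := integral_le_neg_integral_gradientDeriv hf hc hηs (fun y => by positivity) hηc
  have hηi := hηs.continuous.integrable_of_hasCompactSupport hηc (μ := riemannianVolume m M)
  have hgi := hg.integrable_of_hasCompactSupport hgc (μ := riemannianVolume m M)
  have hpt : ∀ y, -gradientDeriv (m := m) f (fun y => |φ y| ^ p) y ≤
      (p - 1) * k * |φ y| ^ p + k ^ (1 - p) * gradientNorm (m := m) φ y ^ p := fun y => by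
    have h2 := rpow_sub_one_mul_le hp hk0 (abs_nonneg (φ y)) (norm_nonneg (gradient (m := m) φ y))
    refine le_trans ?_ (h2.trans_eq (by rw [← mul_assoc (p - 1)]; rfl))
    rw [gradientDeriv_abs_rpow f (hφ.mdifferentiable (by simp)) hp]
    have h3 : |φ y| ^ (p - 2) * |φ y| = |φ y| ^ (p - 1) := by
      by_cases h0 : φ y = 0
      · rw [h0, abs_zero, mul_zero, Real.zero_rpow (by linarith)]
      · rw [← Real.rpow_add_one (abs_ne_zero.2 h0)]
        congr 1
        ring
    refine (neg_le_abs _).trans ?_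
    rw [abs_mul, abs_mul, abs_mul, abs_of_pos hp0,
      abs_of_nonneg (Real.rpow_nonneg (abs_nonneg _) _),
      mul_assoc p, h3, mul_assoc]
    gcongr
    exact abs_gradientDeriv_le (hf1 y) φ
  have h4 : -∫ y, gradientDeriv (m := m) f (fun y => |φ y| ^ p) y ∂(riemannianVolume m M) ≤
      (p - 1) * k * (∫ y, |φ y| ^ p ∂(riemannianVolume m M)) +
      k ^ (1 - p) * ∫ y, gradientNorm (m := m) φ y ^ p ∂(riemannianVolume m M) := by
    rw [← integral_neg, ← integral_const_mul, ← integral_const_mul,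
      ← integral_add (hηi.const_mul _) (hgi.const_mul _)]
    refine integral_mono ?_ ((hηi.const_mul _).add (hgi.const_mul _)) hpt
    exact ((continuous_gradientDeriv hf hηs).integrable_of_hasCompactSupport
      (hηc.of_isClosed_subset (isClosed_tsupport _) (tsupport_gradientDeriv_subset f _))).neg
  have h5 : c = p * k := by rw [hk, mul_div_cancel₀ _ hp0.ne']
  have h6 : k * ∫ y, |φ y| ^ p ∂(riemannianVolume m M) ≤
      k ^ (1 - p) * ∫ y, gradientNorm (m := m) φ y ^ p ∂(riemannianVolume m M) := by
    have := h1.trans h4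
    rw [h5] at this
    linarith
  calc k ^ p * ∫ y, |φ y| ^ p ∂(riemannianVolume m M) =
      k ^ (p - 1) * (k * ∫ y, |φ y| ^ p ∂(riemannianVolume m M)) := by
        rw [← mul_assoc, ← Real.rpow_add_one hk0.ne', sub_add_cancel]
    _ ≤ k ^ (p - 1) * (k ^ (1 - p) *
        ∫ y, gradientNorm (m := m) φ y ^ p ∂(riemannianVolume m M)) := by gcongr
    _ = _ := by
      rw [← mul_assoc, ← Real.rpow_add hk0, sub_add_sub_cancel, sub_self, Real.rpow_zero, one_mul]

theorem lintegral_enorm_rpow_le {f φ : M → ℝ} {c p : ℝ} (hp : 1 < p) (hc0 : 0 < c)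
    (hf : ContMDiff (𝓡 m) 𝓘(ℝ, ℝ) ∞ f) (hc : LeDivergence (m := m) f c)
    (hf1 : ∀ y, tangentInner y (gradientVec (m := m) f y) (gradientVec (m := m) f y) = 1)
    (hφ : ContMDiff (𝓡 m) 𝓘(ℝ, ℝ) ∞ φ) (hφc : HasCompactSupport φ) {Ω : Set M}
    (hφΩ : tsupport φ ⊆ Ω) :
    ENNReal.ofReal ((c / p) ^ p) * ∫⁻ y in Ω, ‖φ y‖ₑ ^ p ∂(riemannianVolume m M) ≤
      ∫⁻ y in Ω, ‖gradient (m := m) φ y‖ₑ ^ p ∂(riemannianVolume m M) := by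
  have hp0 : 0 < p := by linarith
  have h := integral_abs_rpow_le hp hc0 hf hc hf1 hφ hφc
  have hηi : Integrable (fun y => |φ y| ^ p) (riemannianVolume m M) :=
    (hφ.continuous.abs.rpow_const fun _ => Or.inr hp0.le).integrable_of_hasCompactSupport
      (hφc.comp_left (g := fun a : ℝ => |a| ^ p) (by simp [Real.zero_rpow hp0.ne']))
  have hgi : Integrable (fun y => gradientNorm (m := m) φ y ^ p) (riemannianVolume m M) :=
    ((continuous_gradientNorm hφ).rpow_const fun _ => Or.inr hp0.le).integrable_of_hasCompactSupport
      (HasCompactSupport.intro hφc.isCompact fun y hy => by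
        rw [gradientNorm_eq_zero hy, Real.zero_rpow hp0.ne'])
  have e1 : ∫ y in Ω, |φ y| ^ p ∂(riemannianVolume m M) =
      ∫ y, |φ y| ^ p ∂(riemannianVolume m M) :=
    setIntegral_eq_integral_of_forall_compl_eq_zero fun y hy => by
      rw [image_eq_zero_of_notMem_tsupport fun h => hy (hφΩ h), abs_zero, Real.zero_rpow hp0.ne']
  have e2 : ∫ y in Ω, gradientNorm (m := m) φ y ^ p ∂(riemannianVolume m M) =
      ∫ y, gradientNorm (m := m) φ y ^ p ∂(riemannianVolume m M) :=
    setIntegral_eq_integral_of_forall_compl_eq_zero fun y hy => by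
      rw [gradientNorm_eq_zero (m := m) fun h => hy (hφΩ h), Real.zero_rpow hp0.ne']
  rw [← e1, ← e2] at h
  have h1 : ∫⁻ y in Ω, ‖φ y‖ₑ ^ p ∂(riemannianVolume m M) =
      ENNReal.ofReal (∫ y in Ω, |φ y| ^ p ∂(riemannianVolume m M)) := by
    rw [ofReal_integral_eq_lintegral_ofReal hηi.restrict (ae_of_all _ fun y => by positivity)]
    refine lintegral_congr fun y => ?_
    rw [← ENNReal.ofReal_rpow_of_nonneg (abs_nonneg _) hp0.le, Real.enorm_eq_ofReal_abs]
  have h2 : ∫⁻ y in Ω, ‖gradient (m := m) φ y‖ₑ ^ p ∂(riemannianVolume m M) =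
      ENNReal.ofReal (∫ y in Ω, gradientNorm (m := m) φ y ^ p ∂(riemannianVolume m M)) := by
    rw [ofReal_integral_eq_lintegral_ofReal hgi.restrict
      (ae_of_all _ fun y => Real.rpow_nonneg (norm_nonneg _) _)]
    refine lintegral_congr fun y => ?_
    have h3 : 0 ≤ gradientNorm (m := m) φ y := norm_nonneg _
    rw [← ENNReal.ofReal_rpow_of_nonneg h3 hp0.le, gradientNorm, ofReal_norm]
  rw [h1, h2, ← ENNReal.ofReal_mul (by positivity)]
  exact ENNReal.ofReal_le_ofReal h

end Smooth

/-! ### Inequalities between p-th powers under L^p limits. -/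

/-- The constant in the convexity inequality for powers, with weight `w`. -/
def convexityConst (p : ℝ) (w : ℝ≥0∞) : ℝ≥0∞ :=
  w * w⁻¹ ^ p

theorem convexityConst_ne_top {p : ℝ} (hp : 0 ≤ p) {w : ℝ≥0∞} (h0 : w ≠ 0) (h1 : w ≠ ⊤) :
    convexityConst p w ≠ ⊤ :=
  ENNReal.mul_ne_top h1 (ENNReal.rpow_ne_top_of_nonneg hp (ENNReal.inv_ne_top.2 h0))

theorem tendsto_convexityConst {p : ℝ} :
    Tendsto (convexityConst p) (𝓝 1) (𝓝 1) := by
  have h1 : Tendsto (fun w : ℝ≥0∞ => w⁻¹ ^ p) (𝓝 1) (𝓝 1) := by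
    have : ContinuousAt (fun w : ℝ≥0∞ => w⁻¹ ^ p) 1 :=
      (ENNReal.continuous_rpow_const.comp continuous_inv).continuousAt
    simpa [ContinuousAt] using this
  unfold convexityConst
  simpa using
    ENNReal.Tendsto.mul (tendsto_id (α := ℝ≥0∞) (x := 𝓝 1)) (Or.inr (by simp)) h1 (Or.inr (by simp))

/-- Convexity of the p-th power at w(a/w) + w'(b/w'). As w tends to 1, the constant before a^p tends
to 1, while the large constant before b^p multiplies an error that tends to 0. -/
theorem rpow_le_convexityConst {p : ℝ} (hp : 1 ≤ p) {w w' a b e : ℝ≥0∞} (hw : w + w' = 1)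
    (h0 : w ≠ 0) (h0' : w' ≠ 0) (he : e ≤ a + b) :
    e ^ p ≤ convexityConst p w * a ^ p + convexityConst p w' * b ^ p := by
  have hp0 : 0 ≤ p := by linarith
  have h1 : w ≠ ⊤ := ne_top_of_le_ne_top ENNReal.one_ne_top (hw ▸ le_self_add)
  have h1' : w' ≠ ⊤ := ne_top_of_le_ne_top ENNReal.one_ne_top (hw ▸ le_add_self)
  have h := ENNReal.rpow_arith_mean_le_arith_mean2_rpow w w' (w⁻¹ * a) (w'⁻¹ * b) hw hp
  rw [← mul_assoc, ← mul_assoc, ENNReal.mul_inv_cancel h0 h1, ENNReal.mul_inv_cancel h0' h1',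
    one_mul, one_mul, ENNReal.mul_rpow_of_nonneg _ _ hp0, ENNReal.mul_rpow_of_nonneg _ _ hp0,
    ← mul_assoc, ← mul_assoc] at h
  exact (ENNReal.rpow_le_rpow he hp0).trans h

/-- Measurability of one summand is enough to split the integral, so the error b may be arbitrary.
-/
theorem lintegral_rpow_le_convexityConst {α : Type*} {mα : MeasurableSpace α} {μ : Measure α}
    {p : ℝ} (hp : 1 ≤ p) {w w' : ℝ≥0∞} {a b e : α → ℝ≥0∞} (hw : w + w' = 1) (h0 : w ≠ 0)
    (h0' : w' ≠ 0) (ha : AEMeasurable a μ) (he : ∀ x, e x ≤ a x + b x) :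
    ∫⁻ x, e x ^ p ∂μ ≤ convexityConst p w * ∫⁻ x, a x ^ p ∂μ +
      convexityConst p w' * ∫⁻ x, b x ^ p ∂μ := by
  have hp0 : 0 ≤ p := by linarith
  have h1 : w ≠ ⊤ := ne_top_of_le_ne_top ENNReal.one_ne_top (hw ▸ le_self_add)
  have h1' : w' ≠ ⊤ := ne_top_of_le_ne_top ENNReal.one_ne_top (hw ▸ le_add_self)
  rw [← lintegral_const_mul' _ _ (convexityConst_ne_top hp0 h0 h1),
    ← lintegral_const_mul' _ _ (convexityConst_ne_top hp0 h0' h1'),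
    ← lintegral_add_left' ((ha.pow_const p).const_mul _)]
  exact lintegral_mono fun x => rpow_le_convexityConst hp hw h0 h0' (he x)

/-- An inequality between `p`-th powers of norms passes to limits in `L^p`. -/
theorem mul_lintegral_rpow_le_of_tendsto {α : Type*} {mα : MeasurableSpace α} {μ : Measure α}
    {p : ℝ} (hp : 1 ≤ p) {r : ℝ≥0∞} (hr : r ≠ ⊤) {u V : α → ℝ≥0∞} {φ ψ D D' : ℕ → α → ℝ≥0∞}
    (hV : AEMeasurable V μ) (hφ : ∀ k, AEMeasurable (φ k) μ)
    (hu : ∀ k x, u x ≤ φ k x + D k x) (hψ : ∀ k x, ψ k x ≤ V x + D' k x)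
    (hD : Tendsto (fun k => ∫⁻ x, D k x ^ p ∂μ) atTop (𝓝 0))
    (hD' : Tendsto (fun k => ∫⁻ x, D' k x ^ p ∂μ) atTop (𝓝 0))
    (h : ∀ k, r * ∫⁻ x, φ k x ^ p ∂μ ≤ ∫⁻ x, ψ k x ^ p ∂μ) :
    r * ∫⁻ x, u x ^ p ∂μ ≤ ∫⁻ x, V x ^ p ∂μ := by
  have hp0 : 0 ≤ p := by linarith
  -- For fixed weights the errors vanish in the limit. The constant occurs twice, once for comparing
  -- u with φ and once for comparing ψ with V.
  have key : ∀ w w' : ℝ≥0∞, w + w' = 1 → w ≠ 0 → w' ≠ 0 →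
      r * ∫⁻ x, u x ^ p ∂μ ≤
        convexityConst p w * (convexityConst p w * ∫⁻ x, V x ^ p ∂μ) := by
    intro w w' hw h0 h0'
    have h1 : w ≠ ⊤ := ne_top_of_le_ne_top ENNReal.one_ne_top (hw ▸ le_self_add)
    have h1' : w' ≠ ⊤ := ne_top_of_le_ne_top ENNReal.one_ne_top (hw ▸ le_add_self)
    have hC := convexityConst_ne_top hp0 h0 h1
    have hC' := convexityConst_ne_top hp0 h0' h1'
    have hle : ∀ k, r * ∫⁻ x, u x ^ p ∂μ ≤ convexityConst p w * (convexityConst p w *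
        (∫⁻ x, V x ^ p ∂μ) + convexityConst p w' * ∫⁻ x, D' k x ^ p ∂μ) +
        r * (convexityConst p w' * ∫⁻ x, D k x ^ p ∂μ) := fun k => by
      calc r * ∫⁻ x, u x ^ p ∂μ ≤ r * (convexityConst p w * (∫⁻ x, φ k x ^ p ∂μ) +
            convexityConst p w' * ∫⁻ x, D k x ^ p ∂μ) := by
            gcongr
            exact lintegral_rpow_le_convexityConst hp hw h0 h0' (hφ k) (hu k)
        _ = convexityConst p w * (r * ∫⁻ x, φ k x ^ p ∂μ) +
            r * (convexityConst p w' * ∫⁻ x, D k x ^ p ∂μ) := by ring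
        _ ≤ _ := by
            gcongr
            exact (h k).trans (lintegral_rpow_le_convexityConst hp hw h0 h0' hV (hψ k))
    have hlim : Tendsto (fun k => convexityConst p w * (convexityConst p w *
        (∫⁻ x, V x ^ p ∂μ) + convexityConst p w' * ∫⁻ x, D' k x ^ p ∂μ) +
        r * (convexityConst p w' * ∫⁻ x, D k x ^ p ∂μ)) atTop
        (𝓝 (convexityConst p w * (convexityConst p w * (∫⁻ x, V x ^ p ∂μ) +
          convexityConst p w' * 0) + r * (convexityConst p w' * 0))) :=
      (ENNReal.Tendsto.const_mul (tendsto_const_nhds.add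
        (ENNReal.Tendsto.const_mul hD' (Or.inr hC'))) (Or.inr hC)).add
        (ENNReal.Tendsto.const_mul (ENNReal.Tendsto.const_mul hD (Or.inr hC')) (Or.inr hr))
    have := ge_of_tendsto' hlim hle
    simpa using this
  -- The shift by 2 keeps both weights nonzero even for k = 0.
  have hw : Tendsto (fun k : ℕ => 1 - ((k : ℝ≥0∞) + 2)⁻¹) atTop (𝓝 1) := by
    have h1 : Tendsto (fun k : ℕ => ((k : ℝ≥0∞) + 2)⁻¹) atTop (𝓝 0) := by
      have := ENNReal.tendsto_inv_nat_nhds_zero.comp (tendsto_add_atTop_nat 2)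
      refine this.congr fun k => ?_
      simp
    have h2 := ENNReal.Tendsto.sub (tendsto_const_nhds (x := (1 : ℝ≥0∞))) h1 (Or.inl (by simp))
    simpa using h2
  have hlim : Tendsto (fun k : ℕ => convexityConst p (1 - ((k : ℝ≥0∞) + 2)⁻¹) *
      (convexityConst p (1 - ((k : ℝ≥0∞) + 2)⁻¹) * ∫⁻ x, V x ^ p ∂μ)) atTop
      (𝓝 (1 * (1 * ∫⁻ x, V x ^ p ∂μ))) := by
    have h1 := (tendsto_convexityConst (p := p)).comp hw
    have h2 := ENNReal.Tendsto.mul_const (b := ∫⁻ x, V x ^ p ∂μ) h1 (Or.inl one_ne_zero)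
    exact ENNReal.Tendsto.mul h1 (Or.inl one_ne_zero) h2 (Or.inr ENNReal.one_ne_top)
  rw [one_mul, one_mul] at hlim
  refine ge_of_tendsto' hlim fun k => key _ ((k : ℝ≥0∞) + 2)⁻¹ ?_ ?_ ?_
  · refine tsub_add_cancel_of_le (ENNReal.inv_le_one.2 ?_)
    exact le_add_left (by norm_num)
  · refine (tsub_pos_iff_lt.2 (ENNReal.inv_lt_one.2 ?_)).ne'
    exact lt_of_lt_of_le (by norm_num) (le_add_self (a := (2 : ℝ≥0∞)))
  · exact ENNReal.inv_ne_zero.2 (by simp)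

/-! ### The lower bound for the first eigenvalue of a domain. -/

section Sobolev

variable {m : ℕ} {M : Type*} [TopologicalSpace M] [ChartedSpace (EuclideanSpace ℝ (Fin m)) M]
  [IsManifold (𝓡 m) ∞ M]
  [RiemannianBundle (fun x : M => TangentSpace (𝓡 m) x)]
  [IsContMDiffRiemannianBundle (𝓡 m) ∞ (EuclideanSpace ℝ (Fin m))
    (fun x : M => TangentSpace (𝓡 m) x)]

local notation "𝔼" => EuclideanSpace ℝ (Fin m)

/-- Turns measurability of a weak gradient, as a map to the tangent bundle, into measurability of
its length. -/
theorem continuous_norm_tangentBundle :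
    Continuous fun v : TangentBundle (𝓡 m) M => ‖v.2‖ := by
  have : IsContinuousRiemannianBundle 𝔼 (fun x : M => TangentSpace (𝓡 m) x) := by
    obtain ⟨g, hg, hg'⟩ := IsContMDiffRiemannianBundle.exists_contMDiff (IB := 𝓡 m) (n := ∞)
      (F := 𝔼) (E := fun x : M => TangentSpace (𝓡 m) x)
    exact ⟨g, hg.continuous, hg'⟩
  have h : Continuous fun v : TangentBundle (𝓡 m) M => inner ℝ v.2 v.2 :=
    Continuous.inner_bundle (F := 𝔼) (E := fun x : M => TangentSpace (𝓡 m) x)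
      (b := fun v : TangentBundle (𝓡 m) M => v.1) (v := fun v => v.2) (w := fun v => v.2)
      continuous_id continuous_id
  refine h.sqrt.congr fun v => ?_
  exact (norm_eq_sqrt_real_inner (F := TangentSpace (𝓡 m) v.1) v.2).symm

variable [MeasurableSpace M] [BorelSpace M] [T2Space M] [SigmaCompactSpace M]

theorem ofReal_le_firstEigenvalue {f : M → ℝ} {c p : ℝ} (hp : 1 < p) (hc0 : 0 < c)
    (hf : ContMDiff (𝓡 m) 𝓘(ℝ, ℝ) ∞ f) (hc : LeDivergence (m := m) f c)
    (hf1 : ∀ y, tangentInner y (gradientVec (m := m) f y) (gradientVec (m := m) f y) = 1)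
    (Ω : Set M) : ENNReal.ofReal ((c / p) ^ p) ≤ firstEigenvalue m p Ω := by
  have hp0 : 0 < p := by linarith
  refine le_iInf fun u => le_iInf fun V => le_iInf fun hW => le_iInf fun hu => ?_
  obtain ⟨φ, hφ, hφu, hφV⟩ := hW.exists_approx
  set μ := (riemannianVolume m M).restrict Ω with hμ
  have hφm : ∀ k, AEMeasurable (fun x => ‖φ k x‖ₑ) μ := fun k =>
    (hφ k).1.continuous.enorm.measurable.aemeasurable
  have hVm : AEMeasurable (fun x => ‖V x‖ₑ) μ := by
    have h1 := (continuous_norm_tangentBundle (m := m) (M := M)).comp_aestronglyMeasurable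
      hW.aestronglyMeasurable_gradient
    refine (h1.aemeasurable.ennreal_ofReal).congr (ae_of_all _ fun x => ?_)
    exact ofReal_norm (V x)
  have hsub : ∀ k x, ‖u x‖ₑ ≤ ‖φ k x‖ₑ + ‖u x - φ k x‖ₑ := fun k x => by
    have := enorm_add_le (φ k x) (u x - φ k x)
    rwa [add_sub_cancel] at this
  have hsubV : ∀ k x, ‖gradient (m := m) (φ k) x‖ₑ ≤
      ‖V x‖ₑ + ‖V x - gradient (m := m) (φ k) x‖ₑ := fun k x => by
    have := enorm_sub_le (E := TangentSpace (𝓡 m) x) (a := V x)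
      (b := V x - gradient (m := m) (φ k) x)
    rwa [sub_sub_cancel] at this
  have hmain := mul_lintegral_rpow_le_of_tendsto hp.le ENNReal.ofReal_ne_top hVm hφm hsub hsubV
    hφu hφV fun k => lintegral_enorm_rpow_le hp hc0 hf hc hf1 (hφ k).1 (hφ k).2.1 (hφ k).2.2
  -- Dividing in [0, ∞] requires the integral of |u|^p to be nonzero, which holds as u ≠ 0, and
  -- finite, which holds because u is at finite L^p distance from some φ k.
  refine (ENNReal.le_div_iff_mul_le (Or.inl ?_) (Or.inl ?_)).2 hmain
  · intro h0
    rw [lintegral_eq_zero_iff' (hW.aestronglyMeasurable.enorm.pow_const p)] at h0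
    refine hu ?_
    filter_upwards [h0] with x hx
    simpa [hp0, ENNReal.rpow_eq_zero_iff, hp0.le, not_lt.2 hp0.le] using hx
  · have hfin : ∀ k, ∫⁻ x, ‖φ k x‖ₑ ^ p ∂μ ≠ ⊤ := fun k => by
      have hi : Integrable (fun y => |φ k y| ^ p) (riemannianVolume m M) :=
        ((hφ k).1.continuous.abs.rpow_const
          fun _ => Or.inr hp0.le).integrable_of_hasCompactSupport
          ((hφ k).2.1.comp_left (g := fun a : ℝ => |a| ^ p) (by simp [Real.zero_rpow hp0.ne']))
      refine ne_top_of_le_ne_top (hi.restrict (s := Ω)).lintegral_lt_top.ne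
        (lintegral_mono fun y => ?_)
      rw [← ENNReal.ofReal_rpow_of_nonneg (abs_nonneg _) hp0.le, Real.enorm_eq_ofReal_abs]
    obtain ⟨k, hk⟩ := (hφu.eventually (gt_mem_nhds ENNReal.zero_lt_top)).exists
    have h2 : (2 : ℝ≥0∞)⁻¹ ≠ 0 := by simp
    have h3 : (2 : ℝ≥0∞)⁻¹ ≠ ⊤ := by simp
    have h4 := convexityConst_ne_top hp0.le h2 h3
    exact ne_top_of_le_ne_top
      (ENNReal.add_ne_top.2 ⟨ENNReal.mul_ne_top h4 (hfin k), ENNReal.mul_ne_top h4 hk.ne⟩)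
      (lintegral_rpow_le_convexityConst hp.le ENNReal.inv_two_add_inv_two h2 h2 (hφm k) (hsub k))

end Sobolev

/-! ### Extension by zero and domain monotonicity. -/

theorem setLIntegral_eq_of_subset {α : Type*} {mα : MeasurableSpace α} {μ : Measure α}
    {s t : Set α} (hs : MeasurableSet s) (hst : s ⊆ t) {F F' : α → ℝ≥0∞}
    (h : ∀ x ∈ s, F' x = F x) (h0 : ∀ x, x ∉ s → F' x = 0) :
    ∫⁻ x in t, F' x ∂μ = ∫⁻ x in s, F x ∂μ := by
  have h1 : F' = s.indicator F := by
    ext x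
    by_cases hx : x ∈ s
    · rw [indicator_of_mem hx, h x hx]
    · rw [indicator_of_notMem hx, h0 x hx]
  rw [h1, lintegral_indicator hs, Measure.restrict_restrict hs, inter_eq_left.2 hst]

section Monotone

variable {m : ℕ} {M : Type*} [TopologicalSpace M] [ChartedSpace (EuclideanSpace ℝ (Fin m)) M]
  [IsManifold (𝓡 m) ∞ M]
  [RiemannianBundle (fun x : M => TangentSpace (𝓡 m) x)]

local notation "𝔼" => EuclideanSpace ℝ (Fin m)

omit [IsManifold (𝓡 m) ∞ M] in
theorem gradient_eq_zero {φ : M → ℝ} {y : M} (hy : y ∉ tsupport φ) :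
    gradient (m := m) φ y = 0 :=
  norm_eq_zero.1 (gradientNorm_eq_zero (m := m) hy)

variable [MeasurableSpace M] [BorelSpace M] [TopologicalSpace.PseudoMetrizableSpace M]
  [SecondCountableTopology M]

open Classical in
/-- Extension by zero of a Sobolev function and of its gradient. -/
theorem MemSobolevZero.extend {p : ℝ} (hp : 0 < p) {Ω Ω' : Set M} (hΩ : MeasurableSet Ω)
    (hsub : Ω ⊆ Ω') {u : M → ℝ} {V : Π x : M, TangentSpace (𝓡 m) x}
    (h : MemSobolevZero p Ω u V) :
    MemSobolevZero p Ω' (Ω.indicator u) (fun x => if x ∈ Ω then V x else 0) where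
  aestronglyMeasurable :=
    ((aestronglyMeasurable_indicator_iff hΩ).2 h.aestronglyMeasurable).restrict
  aestronglyMeasurable_gradient := by
    obtain ⟨g, hg, hge⟩ := h.aestronglyMeasurable_gradient
    have hid : StronglyMeasurable (fun x : M => x) := continuous_id.stronglyMeasurable
    have hz : StronglyMeasurable (zeroSection 𝔼 (TangentSpace (𝓡 m) : M → Type _)) :=
      (Trivialization.continuous_zeroSection ℝ).comp_stronglyMeasurable hid
    -- The extended field agrees almost everywhere with a measurable field on Ω glued to the zero
    -- section outside.
    have hae : (fun x => (⟨x, if x ∈ Ω then V x else 0⟩ : TangentBundle (𝓡 m) M)) =ᵐ[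
        riemannianVolume m M] Ω.piecewise g (zeroSection 𝔼 (TangentSpace (𝓡 m) : M → Type _)) := by
      filter_upwards [(ae_restrict_iff' hΩ).1 hge] with x hx
      by_cases hxΩ : x ∈ Ω
      · rw [piecewise_eq_of_mem _ _ _ hxΩ, ← hx hxΩ, if_pos hxΩ]
      · rw [piecewise_eq_of_notMem _ _ _ hxΩ, if_neg hxΩ]
        rfl
    exact AEStronglyMeasurable.restrict ⟨_, hg.piecewise hΩ hz, hae⟩
  exists_approx := by
    obtain ⟨φ, hφ, hφu, hφV⟩ := h.exists_approx
    refine ⟨φ, fun k => ⟨(hφ k).1, (hφ k).2.1, (hφ k).2.2.trans hsub⟩, hφu.congr fun k => ?_,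
      hφV.congr fun k => ?_⟩
    · refine (setLIntegral_eq_of_subset hΩ hsub (fun x hx => ?_) fun x hx => ?_).symm
      · rw [indicator_of_mem hx]
      · rw [indicator_of_notMem hx,
          image_eq_zero_of_notMem_tsupport fun hx' => hx ((hφ k).2.2 hx'), sub_zero, enorm_zero,
          ENNReal.zero_rpow_of_pos hp]
    · refine (setLIntegral_eq_of_subset hΩ hsub (fun x hx => ?_) fun x hx => ?_).symm
      · rw [if_pos hx]
      · rw [if_neg hx, gradient_eq_zero fun hx' => hx ((hφ k).2.2 hx'), sub_zero, enorm_zero,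
          ENNReal.zero_rpow_of_pos hp]

omit [BorelSpace M] [TopologicalSpace.PseudoMetrizableSpace M]
  [SecondCountableTopology M] in
theorem firstEigenvalue_le {p : ℝ} {Ω : Set M} {u : M → ℝ} {V : Π x : M, TangentSpace (𝓡 m) x}
    (hW : MemSobolevZero p Ω u V) (hu : ¬ u =ᵐ[(riemannianVolume m M).restrict Ω] 0) :
    firstEigenvalue m p Ω ≤ (∫⁻ x in Ω, ‖V x‖ₑ ^ p ∂(riemannianVolume m M)) /
      (∫⁻ x in Ω, ‖u x‖ₑ ^ p ∂(riemannianVolume m M)) :=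
  iInf_le_of_le u <| iInf_le_of_le V <| iInf_le_of_le hW <| iInf_le _ hu

/-- Extension by zero keeps a competitor nonzero and preserves both integrals, so the larger domain
has at least the same quotients. -/
theorem firstEigenvalue_anti {p : ℝ} (hp : 0 < p) {Ω Ω' : Set M} (hΩ : MeasurableSet Ω)
    (hsub : Ω ⊆ Ω') : firstEigenvalue m p Ω' ≤ firstEigenvalue m p Ω := by
  classical
  refine le_iInf fun u => le_iInf fun V => le_iInf fun hW => le_iInf fun hu => ?_
  have hu' : ¬ Ω.indicator u =ᵐ[(riemannianVolume m M).restrict Ω'] 0 := fun h0 => by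
    refine hu ?_
    have h1 := ae_mono (Measure.restrict_mono hsub le_rfl) h0
    filter_upwards [h1, ae_restrict_mem hΩ] with x hx hxΩ
    rwa [indicator_of_mem hxΩ] at hx
  refine (firstEigenvalue_le (hW.extend hp hΩ hsub) hu').trans_eq ?_
  congr 1
  · refine setLIntegral_eq_of_subset hΩ hsub (fun x hx => ?_) fun x hx => ?_
    · rw [if_pos hx]
    · rw [if_neg hx, enorm_zero, ENNReal.zero_rpow_of_pos hp]
  · refine setLIntegral_eq_of_subset hΩ hsub (fun x hx => ?_) fun x hx => ?_
    · rw [indicator_of_mem hx]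
    · rw [indicator_of_notMem hx, enorm_zero, ENNReal.zero_rpow_of_pos hp]

end Monotone

/-! ### Exhaustions and independence of the limit. -/

section Exhaustion

theorem IsExhaustion.exists_subset {M : Type*} [TopologicalSpace M] {Ω : ℕ → Set M}
    (h : IsExhaustion Ω) {K : Set M} (hK : IsCompact (closure K)) : ∃ k, K ⊆ Ω k := by
  obtain ⟨k, hk⟩ := hK.elim_directed_cover Ω h.isOpen (by simp [h.iUnion_eq])
    h.monotone.directed_le
  exact ⟨k, subset_closure.trans hk⟩

theorem exists_isExhaustion (M : Type*) [TopologicalSpace M] [T2Space M]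
    [WeaklyLocallyCompactSpace M] [SigmaCompactSpace M] : ∃ Ω : ℕ → Set M, IsExhaustion Ω := by
  let K := CompactExhaustion.choice M
  refine ⟨fun k => interior (K k), fun k => isOpen_interior, fun k => ?_, fun i j hij => ?_, ?_⟩
  · exact (K.isCompact k).closure_of_subset interior_subset
  · exact interior_mono (K.subset hij)
  · refine eq_univ_of_forall fun x => mem_iUnion.2 ?_
    obtain ⟨n, hn⟩ := K.exists_mem x
    exact ⟨n + 1, K.subset_interior_succ n hn⟩

variable {m : ℕ} {M : Type*} [TopologicalSpace M] [ChartedSpace (EuclideanSpace ℝ (Fin m)) M]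
  [IsManifold (𝓡 m) ∞ M]
  [RiemannianBundle (fun x : M => TangentSpace (𝓡 m) x)]
  [MeasurableSpace M] [BorelSpace M] [TopologicalSpace.PseudoMetrizableSpace M]
  [SecondCountableTopology M]

theorem IsExhaustion.tendsto_firstEigenvalue {p : ℝ} (hp : 0 < p) {Ω : ℕ → Set M}
    (h : IsExhaustion Ω) : Tendsto (fun k => firstEigenvalue m p (Ω k)) atTop
      (𝓝 (⨅ k, firstEigenvalue m p (Ω k))) :=
  tendsto_atTop_iInf fun _ _ hij =>
    firstEigenvalue_anti hp (h.isOpen _).measurableSet (h.monotone hij)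

/-- Two exhaustions are cofinal in each other: each member of one has compact closure and hence lies
in some member of the other. Used in both directions, this gives independence of the exhaustion. -/
theorem IsExhaustion.iInf_firstEigenvalue_le {p : ℝ} (hp : 0 < p) {Ω Ω' : ℕ → Set M}
    (h : IsExhaustion Ω) (h' : IsExhaustion Ω') :
    ⨅ k, firstEigenvalue m p (Ω k) ≤ ⨅ k, firstEigenvalue m p (Ω' k) :=
  le_iInf fun k => by
    obtain ⟨j, hj⟩ := h.exists_subset (h'.isCompact_closure k)
    exact iInf_le_of_le j (firstEigenvalue_anti hp (h'.isOpen k).measurableSet hj)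

/-- The fundamental tone is well defined. -/
theorem IsExhaustion.isFundamentalTone {p : ℝ} (hp : 0 < p) {Ω : ℕ → Set M}
    (h : IsExhaustion Ω) : IsFundamentalTone m M p (⨅ k, firstEigenvalue m p (Ω k)) := by
  refine ⟨⟨Ω, h⟩, fun Ω' h' => ?_⟩
  rw [le_antisymm (h.iInf_firstEigenvalue_le hp h') (h'.iInf_firstEigenvalue_le hp h)]
  exact h'.tendsto_firstEigenvalue hp

end Exhaustion

end SubmersionTone
end

/-! ### The lower bound for the fundamental tone. -/

theorem theorem2 {m n : ℕ} (hn : 2 ≤ n)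
    {N : Type*} [TopologicalSpace N] [ChartedSpace (EuclideanSpace ℝ (Fin (n - 1))) N]
    [IsManifold (𝓡 (n - 1)) ∞ N]
    (g₀ : ContMDiffRiemannianMetric (𝓡 (n - 1)) ∞ (EuclideanSpace ℝ (Fin (n - 1)))
      (fun x : N => TangentSpace (𝓡 (n - 1)) x))
    (ρ : ℝ → ℝ) (hρ : ContDiff ℝ ∞ ρ) (κ : ℝ) (hκ : 0 < κ) (hρκ : ∀ t, κ ≤ deriv ρ t)
    {M : Type*} [EMetricSpace M] [CompleteSpace M] [SecondCountableTopology M]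
    [MeasurableSpace M] [BorelSpace M]
    [ChartedSpace (EuclideanSpace ℝ (Fin m)) M] [IsManifold (𝓡 m) ∞ M]
    [RiemannianBundle (fun x : M => TangentSpace (𝓡 m) x)]
    [IsContMDiffRiemannianBundle (𝓡 m) ∞ (EuclideanSpace ℝ (Fin m))
      (fun x : M => TangentSpace (𝓡 m) x)]
    [IsRiemannianManifold (𝓡 m) M]
    (proj : M → ℝ × N)
    (hproj : SubmersionTone.IsRiemannianSubmersion (m := m) (SubmersionTone.warpedMetric g₀ ρ) proj)
    (α : ℝ) (hα : α < ((n : ℝ) - 1) * κ)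
    (hH : ∀ x : M,
      ‖SubmersionTone.meanCurvature (m := m) (𝓘(ℝ, ℝ).prod (𝓡 (n - 1))) proj x‖ ≤ α)
    (p : ℝ) (hp : 1 < p) :
    ∃ L : ℝ≥0∞, SubmersionTone.IsFundamentalTone m M p L ∧
      ENNReal.ofReal ((((n : ℝ) - 1) * κ - α) ^ p / p ^ p) ≤ L := by
  have hlc : LocallyCompactSpace M :=
    ChartedSpace.locallyCompactSpace (EuclideanSpace ℝ (Fin m)) M
  obtain ⟨Ω, hΩ⟩ := SubmersionTone.exists_isExhaustion M
  have hp0 : 0 < p := by linarith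
  have hc0 : 0 < ((n : ℝ) - 1) * κ - α := by linarith
  have hcast : ((n - 1 : ℕ) : ℝ) = (n : ℝ) - 1 := by
    rw [Nat.cast_sub (by omega), Nat.cast_one]
  -- The tone is the infimum over one exhaustion, and the bound for a single domain does not depend
  -- on the domain.
  refine ⟨_, hΩ.isFundamentalTone hp0, le_iInf fun k => ?_⟩
  rw [← Real.div_rpow hc0.le hp0.le]
  refine SubmersionTone.ofReal_le_firstEigenvalue hp hc0
    (SubmersionTone.contMDiff_fst_comp hproj.contMDiff) (fun x z hz => ?_)
    (SubmersionTone.tangentInner_gradient_self hproj) (Ω k)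
  rw [← hcast]
  exact SubmersionTone.le_divergence hproj hρ hρκ hH hz
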